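/- Let $K$ be a field of characteristic zero with algebraic closure $\overline K$, let $\mathfrak g$ be a split simple finite-dimensional Lie algebra over $K$ with splitting Cartan subalgebra $\mathfrak h$ and root system $\Delta$, and let $\Gamma$ be a base of $\Delta$. Let $\langle\ ,\ \rangle$ be the Killing form and let $\Omega_{\mathfrak h}=\sum_i e_i\otimes e^i\in\mathfrak h\otimes\mathfrak h$ for any basis $(e_i)$ of $\mathfrak h$ with dual basis $(e^i)$; write $\kappa$ for the flip $x\otimes y\mapsto y\otimes x$ and $r^{21}=\kappa(r)$. An admissible quadruple $(\Gamma_1,\Gamma_2,\tau,r_{\mathfrak h})$ consists of subsets $\Gamma_1,\Gamma_2\subseteq\Gamma$, an isometric bijection $\tau:\Gamma_1\to\Gamma_2$ such that for each $\alpha\in\Gamma_1$ some iterate $\tau^k(\alpha)$, $k>0$, is defined and not in $\Gamma_1$, and $r_{\mathfrak h}\in\mathfrak h\otimes\mathfrak h$ with $r_{\mathfrak h}+r_{\mathfrak h}^{21}=\Omega_{\mathfrak h}$ and $(\tau(\alpha)\otimes1+1\otimes\alpha)(r_{\mathfrak h})=0$ for all $\alpha\in\Gamma_1$. Extend $\tau$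 additively to the roots in $\mathrm{Span}_{\mathbb Z}(\Gamma_1)$, and choose root vectors $X_\beta\in\mathfrak g_\beta$ $(\beta\in\Delta)$ with $\langle X_\beta,X_{-\beta}\rangle=1$ that are compatible with $\tau$: the assignment $X_\beta\mapsto X_{\tau(\beta)}$, $\beta\in\Delta\cap\mathrm{Span}_{\mathbb Z}(\Gamma_1)$, respects Lie brackets. The associated Belavin–Drinfeld $r$-matrix is $$r_{\mathrm{BD}}=r_{\mathfrak h}+\sum_{\beta>0}X_\beta\otimes X_{-\beta}+\sum_{\beta\in\mathrm{Span}_{\mathbb Z}(\Gamma_1)^+,\ k>0}X_\beta\wedge X_{-\tau^k(\beta)},\qquad x\wedge y=x\otimes y-y\otimes x,$$ where the last sum is over those $\beta,k$ for which $\tau^k(\beta)$ is defined. Put $\partial r(a)=(\mathrm{ad}_a\otimes1+1\otimes\mathrm{ad}_a)(r)$. Let $\alpha\in\overline K^*$ with $\alpha^2\in K^*\setminus K^{*2}$. Let $\overline Z^1_\alpha$ be the set of continuous $\mathrm{Gal}(\overline K/K)$-cocycles $(u_\gamma)$ in the group $\mathrm{Aut}(\mathfrak g_{\overline K})$ of Lie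 algebra automorphisms such that $(u_\gamma\otimes u_\gamma)(r_{\mathrm{BD}})=r_{\mathrm{BD}}$ if $\gamma(\alpha)=\alpha$ and $(u_\gamma\otimes u_\gamma)(r_{\mathrm{BD}})=r_{\mathrm{BD}}^{21}$ if $\gamma(\alpha)=-\alpha$. Let $\overline H^1_{\mathrm{Gal}}(K,\mathbf{Aut}(\mathfrak g,\partial r_{\mathrm{BD}}),\alpha)$ be the quotient of $\overline Z^1_\alpha$ by the relation $(v_\gamma)\sim(u_\gamma)$ if and only if there is an automorphism $\rho$ of the Lie bialgebra $(\mathfrak g_{\overline K},\partial r_{\mathrm{BD}})$ with $v_\gamma=\rho^{-1}u_\gamma{}^{\gamma}\!\rho$ for all $\gamma$. Then $\overline H^1_{\mathrm{Gal}}(K,\mathbf{Aut}(\mathfrak g,\partial r_{\mathrm{BD}}),\alpha)$ is non-empty if and only if there exists a diagram automorphism $\pi$ (a permutation of $\Gamma$ preserving the Cartan matrix) with $$\pi(\Gamma_1)=\Gamma_2,\quad \pi(\Gamma_2)=\Gamma_1,\quad \pi\tau\pi^{-1}=\tau^{-1},\quad (\widehat\pi\otimes\widehat\pi)(r_{\mathfrak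 h})=r_{\mathfrak h}^{21},$$ where $\widehat\pi$ acts on $\mathfrak h$ by permuting the simple coroots according to $\pi$. -/

import Mathlib

open scoped TensorProduct

noncomputable section

namespace LieBialg

/-! ### Coboundary structures and Galois descent -/

section Tensors

variable {F L : Type*} [Field F] [LieRing L] [LieAlgebra F L]

/-- The flip `x ⊗ y ↦ y ⊗ x`; it sends `r` to `r²¹`. -/
abbrev flip {M : Type*} [AddCommGroup M] [Module F M] : M ⊗[F] M →ₗ[F] M ⊗[F] M :=
  (TensorProduct.comm F M M).toLinearMap

/-- The coboundary `∂r : a ↦ (ad a ⊗ 1 + 1 ⊗ ad a) r`. -/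
def coboundary (r : L ⊗[F] L) (a : L) : L ⊗[F] L :=
  LinearMap.rTensor L (LieAlgebra.ad F L a) r +
    LinearMap.lTensor L (LieAlgebra.ad F L a) r

/-- The map `φ ⊗ φ` on `L ⊗ L`, for an automorphism `φ` of `L`. -/
abbrev tensorSq (φ : L ≃ₗ⁅F⁆ L) : L ⊗[F] L →ₗ[F] L ⊗[F] L :=
  TensorProduct.map (φ : L →ₗ[F] L) (φ : L →ₗ[F] L)

/-- `φ` is an automorphism of `(L, ∂r)`: it satisfies `(φ ⊗ φ) ∘ ∂r = ∂r ∘ φ`. -/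
def IsCobracketAut (r : L ⊗[F] L) (φ : L ≃ₗ⁅F⁆ L) : Prop :=
  ∀ a : L, tensorSq φ (coboundary r a) = coboundary r (φ a)

end Tensors

section Galois

variable {K : Type*} [Field K] (L : Type*) [LieRing L] [LieAlgebra K L]
  {Kb : Type*} [Field Kb] [Algebra K Kb]

/-- The action `c ⊗ x ↦ γ(c) ⊗ x` of the Galois group on `Kb ⊗ L`. -/
def galAct (γ : Gal(Kb/K)) : (Kb ⊗[K] L) →ₗ[K] (Kb ⊗[K] L) :=
  LinearMap.rTensor L γ.toLinearMap

lemma galAct_tmul (γ : Gal(Kb/K)) (c : Kb) (x : L) :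
    galAct L γ (c ⊗ₜ[K] x) = γ c ⊗ₜ[K] x := rfl

lemma galAct_symm (γ : Gal(Kb/K)) (x : Kb ⊗[K] L) : galAct L γ (galAct L γ.symm x) = x := by
  induction x with
  | zero => simp
  | tmul c x => simp [galAct_tmul]
  | add x y hx hy => rw [map_add, map_add, hx, hy]

lemma symm_galAct (γ : Gal(Kb/K)) (x : Kb ⊗[K] L) : galAct L γ.symm (galAct L γ x) = x := by
  induction x with
  | zero => simp
  | tmul c x => simp [galAct_tmul]
  | add x y hx hy => rw [map_add, map_add, hx, hy]

lemma galAct_smul (γ : Gal(Kb/K)) (c : Kb) (x : Kb ⊗[K] L) :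
    galAct L γ (c • x) = γ c • galAct L γ x := by
  induction x with
  | zero => simp
  | tmul d x => simp [galAct_tmul, TensorProduct.smul_tmul']
  | add x y hx hy => rw [smul_add, map_add, map_add, hx, hy, smul_add]

lemma galAct_lie (γ : Gal(Kb/K)) (x y : Kb ⊗[K] L) :
    galAct L γ ⁅x, y⁆ = ⁅galAct L γ x, galAct L γ y⁆ := by
  induction x with
  | zero => simp
  | add x x' hx hx' => rw [add_lie, map_add, map_add, hx, hx', add_lie]
  | tmul c x =>
    induction y with
    | zero => simp
    | add y y' hy hy' => rw [lie_add, map_add, map_add, hy, hy', lie_add]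
    | tmul d y => simp [galAct_tmul, LieAlgebra.ExtendScalars.bracket_tmul]

variable {L}

/-- The Galois action `ρ ↦ ᵞρ = γ ∘ ρ ∘ γ⁻¹` on the automorphisms of the Lie algebra `Kb ⊗ L`. -/
def galConj (γ : Gal(Kb/K)) (ρ : (Kb ⊗[K] L) ≃ₗ⁅Kb⁆ (Kb ⊗[K] L)) :
    (Kb ⊗[K] L) ≃ₗ⁅Kb⁆ (Kb ⊗[K] L) where
  toFun x := galAct L γ (ρ (galAct L γ.symm x))
  map_add' x y := by simp
  map_smul' c x := by simp [galAct_smul]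
  map_lie' {x y} := by
    change galAct L γ (ρ (galAct L γ.symm ⁅x, y⁆)) = _
    rw [galAct_lie, LieEquiv.map_lie, galAct_lie]
  invFun x := galAct L γ (ρ.symm (galAct L γ.symm x))
  left_inv x := by simp [symm_galAct, galAct_symm]
  right_inv x := by simp [symm_galAct, galAct_symm]

lemma galConj_apply (γ : Gal(Kb/K)) (ρ : (Kb ⊗[K] L) ≃ₗ⁅Kb⁆ (Kb ⊗[K] L)) (x : Kb ⊗[K] L) :
    galConj γ ρ x = galAct L γ (ρ (galAct L γ.symm x)) := rfl

variable (Kb) in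
/-- The image of `r ∈ L ⊗ L` in `(Kb ⊗ L) ⊗ (Kb ⊗ L)`. -/
def baseChangeTensor (r : L ⊗[K] L) : (Kb ⊗[K] L) ⊗[Kb] (Kb ⊗[K] L) :=
  TensorProduct.AlgebraTensorModule.distribBaseChange K Kb L L (1 ⊗ₜ[K] r)

/-- The twisted cocycles attached to `r` and `α`: the continuous (that is, locally constant)
Galois cocycles `u` in the automorphism group of the Lie algebra `Kb ⊗ L` with
`(u_γ ⊗ u_γ) r = r` if `γ α = α` and `(u_γ ⊗ u_γ) r = r²¹` if `γ α = -α`. -/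
structure TwistedCocycle (r : L ⊗[K] L) (α : Kb) where
  u : Gal(Kb/K) → ((Kb ⊗[K] L) ≃ₗ⁅Kb⁆ (Kb ⊗[K] L))
  continuous : IsLocallyConstant u
  cocycle : ∀ γ σ x, u (γ * σ) x = u γ (galConj γ (u σ) x)
  fixed : ∀ γ, γ α = α →
    tensorSq (u γ) (baseChangeTensor Kb r) = baseChangeTensor Kb r
  flipped : ∀ γ, γ α = -α →
    tensorSq (u γ) (baseChangeTensor Kb r) = flip (baseChangeTensor Kb r)

/-- `v ∼ u` when there is an automorphism `ρ` of `(Kb ⊗ L, ∂r)` with `v_γ = ρ⁻¹ ∘ u_γ ∘ ᵞρ`. -/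
def TwistedCocycle.Cohomologous {r : L ⊗[K] L} {α : Kb} (v u : TwistedCocycle r α) : Prop :=
  ∃ ρ : (Kb ⊗[K] L) ≃ₗ⁅Kb⁆ (Kb ⊗[K] L), IsCobracketAut (baseChangeTensor Kb r) ρ ∧
    ∀ γ x, v.u γ x = ρ.symm (u.u γ (galConj γ ρ x))

lemma isCobracketAut_symm {F L : Type*} [Field F] [LieRing L] [LieAlgebra F L] {r : L ⊗[F] L}
    {φ : L ≃ₗ⁅F⁆ L} (h : IsCobracketAut r φ) : IsCobracketAut r φ.symm := by
  have key : ∀ t, tensorSq φ.symm (tensorSq φ t) = t := by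
    intro t
    induction t with
    | zero => simp
    | tmul x y => simp
    | add x y hx hy => rw [map_add, map_add, hx, hy]
  intro a
  have := h (φ.symm a)
  rw [LieEquiv.apply_symm_apply] at this
  rw [← this, key]

lemma isCobracketAut_trans {F L : Type*} [Field F] [LieRing L] [LieAlgebra F L] {r : L ⊗[F] L}
    {φ ψ : L ≃ₗ⁅F⁆ L} (h : IsCobracketAut r φ) (h' : IsCobracketAut r ψ) :
    IsCobracketAut r (φ.trans ψ) := by
  have key : ∀ t, tensorSq (φ.trans ψ) t = tensorSq ψ (tensorSq φ t) := by
    intro t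
    induction t with
    | zero => simp
    | tmul x y => simp
    | add x y hx hy => simp only [map_add, hx, hy]
  intro a
  rw [key, h, h']
  simp

/-- Being cohomologous is an equivalence relation. -/
instance twistedCocycleSetoid (r : L ⊗[K] L) (α : Kb) : Setoid (TwistedCocycle r α) where
  r := TwistedCocycle.Cohomologous
  iseqv := by
    refine ⟨fun u => ⟨LieEquiv.refl, ?_, ?_⟩, ?_, ?_⟩
    · intro a
      have key : ∀ t, tensorSq (LieEquiv.refl : (Kb ⊗[K] L) ≃ₗ⁅Kb⁆ (Kb ⊗[K] L)) t = t := by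
        intro t
        induction t with
        | zero => simp
        | tmul x y => simp
        | add x y hx hy => rw [map_add, hx, hy]
      rw [key]
      rfl
    · intro γ x
      rw [galConj_apply]
      simp [galAct_symm]
    · rintro v u ⟨ρ, hρ, h⟩
      refine ⟨ρ.symm, isCobracketAut_symm hρ, fun γ x => ?_⟩
      rw [h]
      simp [galConj_apply, symm_galAct, galAct_symm]
    · rintro w v u ⟨ρ, hρ, h⟩ ⟨σ, hσ, h'⟩
      refine ⟨ρ.trans σ, isCobracketAut_trans hρ hσ, fun γ x => ?_⟩
      rw [h, h']
      simp [galConj_apply, symm_galAct]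

/-- The twisted cohomology set attached to `r` and `α`. -/
def TwistedH1 (r : L ⊗[K] L) (α : Kb) : Type _ :=
  Quotient (twistedCocycleSetoid r α)

end Galois

/-! ### Belavin–Drinfeld matrices

`g` is a split simple Lie algebra with splitting Cartan subalgebra `H`; the invariant form is the
Killing form, and `b` is a base of the root system of `(g, H)`. -/

open LieAlgebra LieAlgebra.IsKilling LieModule

variable {K g : Type*} [Field K] [CharZero K] [LieRing g] [LieAlgebra K g]
  [FiniteDimensional K g] [IsSimple K g]
  {H : LieSubalgebra K g} [H.IsCartanSubalgebra] [IsTriangularizable K H g]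

/-- The bilinear form on the dual of `H` induced by the Killing form. -/
def dualForm (f f' : Module.Dual K H) : K := f ((cartanEquivDual H).symm f')

variable (H) in
/-- The Cartan part of the Casimir element: the sum of the tensors `eᵢ ⊗ eⁱ` for a basis `eᵢ` of
`H` and its dual basis `eⁱ` with respect to the Killing form. -/
def cartanCasimir : H ⊗[K] H :=
  ∑ i, Module.finBasis K H i ⊗ₜ[K] (cartanEquivDual H).symm ((Module.finBasis K H).coord i)

/-- The root `-β`. -/
def negRoot (β : H.root) : H.root :=
  ⟨-β.1, by
    have h : β.1.IsNonZero := (Finset.mem_filter.mp β.2).2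
    simpa [LieSubalgebra.root] using h⟩

/-- An admissible quadruple `(Γ₁, Γ₂, τ, r_h)`, where the elements of the base are indexed by
`b.support`. -/
structure AdmissibleQuadruple (b : (rootSystem H).Base) where
  Γ₁ : Finset b.support
  Γ₂ : Finset b.support
  τ : Γ₁ ≃ Γ₂
  /-- `τ` is an isometry. -/
  isometry : ∀ i j : Γ₁,
    dualForm ((rootSystem H).root (τ i)) ((rootSystem H).root (τ j)) =
      dualForm ((rootSystem H).root i) ((rootSystem H).root j)
  /-- For each `i ∈ Γ₁` some iterate `τ^k(i)`, with `k > 0`, is (defined and) outside `Γ₁`. -/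
  nilpotent : ∀ i : Γ₁, ∃ j : b.support, j ∉ Γ₁ ∧
    Relation.TransGen (fun p q : b.support => ∃ hp : p ∈ Γ₁, (τ ⟨p, hp⟩ : b.support) = q) i j
  rh : H ⊗[K] H
  rh_add_flip : rh + flip rh = cartanCasimir H
  /-- `(τ(α) ⊗ 1 + 1 ⊗ α)(r_h) = 0` for `α ∈ Γ₁`. -/
  rh_compat : ∀ i : Γ₁,
    TensorProduct.lid K H (LinearMap.rTensor H ((rootSystem H).root (τ i)) rh) +
      TensorProduct.rid K H (LinearMap.lTensor H ((rootSystem H).root i) rh) = 0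

namespace AdmissibleQuadruple

variable {b : (rootSystem H).Base} (Q : AdmissibleQuadruple b)

/-- `Q.Maps β β'`: the root `β` lies in the integral span of `Γ₁`, and the root `β'` is `τ(β)`,
where `τ` is extended additively to this span. -/
def Maps (β β' : H.root) : Prop :=
  ∃ n : Q.Γ₁ → ℤ, (rootSystem H).root β = ∑ i, n i • (rootSystem H).root (i : b.support) ∧
    (rootSystem H).root β' = ∑ i, n i • (rootSystem H).root (Q.τ i : b.support)

/-- `β' = τ^k(β)` for some `k > 0` (which is unique, as `τ` has no cycles); all of
`β, τ(β), …, τ^(k-1)(β)` have to lie in the span of `Γ₁`. -/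
def Prec : H.root → H.root → Prop := Relation.TransGen Q.Maps

/-- A system of root vectors `X β`, normalised by `⟨X β, X (-β)⟩ = 1` for the Killing form and
adapted to `τ`: the assignment `X β ↦ X (τ β)`, for roots `β` in the span of `Γ₁`, respects
brackets, so that `X (τ β)` is the image of `X β` under the Lie algebra isomorphism defined on
generators by `X (± α) ↦ X (± τ α)`, for `α ∈ Γ₁`. -/
structure RootVectors where
  X : H.root → g
  mem : ∀ β, X β ∈ rootSpace H β.1
  normalised : ∀ β, killingForm K g (X β) (X (negRoot β)) = 1
  adapted : ∀ {β γ δ β' γ' δ' : H.root}, Q.Maps β β' → Q.Maps γ γ' → Q.Maps δ δ' →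
    ∀ c : K, ⁅X β, X γ⁆ = c • X δ → ⁅X β', X γ'⁆ = c • X δ'

open Classical in
/-- The Belavin–Drinfeld matrix
`r_h + ∑_{β > 0} X β ⊗ X (-β) + ∑_{β ∈ Span(Γ₁)⁺, k > 0} X β ∧ X (-τ^k β)`,
where `x ∧ y = x ⊗ y - y ⊗ x`. -/
def rBD (E : Q.RootVectors) : g ⊗[K] g :=
  TensorProduct.map H.toSubmodule.subtype H.toSubmodule.subtype Q.rh +
    ∑ β : H.root with b.IsPos β, E.X β ⊗ₜ[K] E.X (negRoot β) +
    ∑ p : H.root × H.root with b.IsPos p.1 ∧ Q.Prec p.1 p.2,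
      (E.X p.1 ⊗ₜ[K] E.X (negRoot p.2) - E.X (negRoot p.2) ⊗ₜ[K] E.X p.1)

end AdmissibleQuadruple

/-- An automorphism of the Dynkin diagram: a permutation of the simple roots that preserves the
Cartan matrix. -/
def IsDiagramAut (b : (rootSystem H).Base) (π : Equiv.Perm b.support) : Prop :=
  ∀ i j, b.cartanMatrix (π i) (π j) = b.cartanMatrix i j

/-- The action on `H` of the automorphism of `g` defined by a diagram automorphism `π`: it permutes
the simple coroots by `π`. -/
def cartanAct (b : (rootSystem H).Base) (π : Equiv.Perm b.support) : H ≃ₗ[K] H :=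
  b.toCoweightBasis.equiv b.toCoweightBasis π

end LieBialg

end

/-!
Write `g` again for the Lie algebra over the algebraic closure, `h` for its Cartan subalgebra, and
`R` for the endomorphism `a ↦ ∑ ⟨a, xᵢ⟩ yᵢ` attached to `r_BD = ∑ xᵢ ⊗ yᵢ` (`contraction`); the
endomorphism attached to `r_BD²¹` is the adjoint `R'` of `R` for the Killing form. Since `α` is not
in `K`, some element of the Galois group sends `α` to `-α`, and such elements are exactly those that
do not fix `α`. So a twisted cocycle provides an automorphism that exchanges the tensor factors of
`r_BD`, and conversely an automorphism with this property which is defined over `K` and is an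
involution provides a cocycle with values in a group of order two (`involutionCocycle`). It remains
to see when automorphisms exchanging the factors exist.

*From an automorphism to a diagram automorphism* (`exists_isReversedBy`). Let `φ` exchange the
factors, so that `R' φ = φ R`. In the basis of root vectors, `R` is strictly triangular on the span
`n₊` of the positive root spaces, hence nilpotent there, and unitriangular on `n₋`, hence
surjective; so `φ n₊` is orthogonal to `n₋ = R^N n₋`, that is, contained in the Borel subalgebra
`h ⊕ n₋`. The same argument for `R - 1` shows that `φ n₋ ⊆ h ⊕ n₊`. The image of a root vector is
ad-nilpotent, and an ad-nilpotent element of a Borel subalgebra has no Cartan component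
(`killingForm_baseDual_eq_zero_of_isNilpotent`); hence `φ` preserves `h`. It therefore permutes the
root spaces (`exists_actsByRootPerm`) by a permutation `w` that exchanges positive and negative
roots, and `w = -π` on simple roots, for a diagram automorphism `π`. For simple `i ≠ j`, the
coefficient of `X i ⊗ X (-j)` in `r_BD` tells whether `j = τ^k i` for some `k > 0`, and `τ` is the
successor relation of the order defined in this way (`step_iff`); comparing these coefficients, and
the Cartan parts, gives the conditions on `π`.

*From a diagram automorphism to an involution* (`exists_involution`). The orbits of a diagram
automorphism have at most three elements (`pow_six_eq_one`), so if `π` satisfies the conditions then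
`π³` is an involution that satisfies them. By the isomorphism theorem there is an automorphism `u`
of `g` over `K` with `X i ↦ X (-π³ i)` and `X (-i) ↦ X (π³ i)`, and `u² = 1`. It multiplies root
vectors by factors that are constant along `τ` (`ActsByRootPerm.factor_eq_of_maps`), because the
system of root vectors is adapted to `τ`; this is what is needed to see that `u` exchanges the
tensor factors of `r_BD` (`ActsByRootPerm.tensorSq_rBD`).
-/

noncomputable section

namespace LieBialg

open LieAlgebra LieAlgebra.IsKilling LieModule

/-! ### Contracting tensors with the Killing form -/

section Contraction

variable {F L : Type*} [Field F] [LieRing L] [LieAlgebra F L]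

/-- The value of the tensor `t ∈ L ⊗ L` on the functionals `⟨a, ·⟩` and `⟨b, ·⟩`. -/
def killingEval (a b : L) : L ⊗[F] L →ₗ[F] F :=
  (TensorProduct.lid F F).toLinearMap ∘ₗ
    TensorProduct.map (killingForm F L a) (killingForm F L b)

@[simp] lemma killingEval_tmul (a b x y : L) :
    killingEval (F := F) a b (x ⊗ₜ y) = killingForm F L a x * killingForm F L b y := by
  simp [killingEval]

/-- The endomorphism `a ↦ ∑ ⟨a, xᵢ⟩ yᵢ` attached to the tensor `∑ xᵢ ⊗ yᵢ`. -/
def contraction : L ⊗[F] L →ₗ[F] Module.End F L :=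
  dualTensorHom F L L ∘ₗ LinearMap.rTensor L (killingForm F L)

@[simp] lemma contraction_tmul (a x y : L) :
    contraction (F := F) (x ⊗ₜ y) a = killingForm F L x a • y := by
  simp [contraction]

lemma killingForm_comm (x y : L) : killingForm F L x y = killingForm F L y x :=
  LieModule.traceForm_comm F L L x y

lemma killingForm_lie_left (x y z : L) :
    killingForm F L ⁅x, y⁆ z = killingForm F L x ⁅y, z⁆ :=
  LieModule.traceForm_apply_lie_apply F L L x y z

lemma killingForm_lie_right (x y z : L) :
    killingForm F L y ⁅x, z⁆ = - killingForm F L ⁅x, y⁆ z := by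
  rw [← killingForm_lie_left, ← lie_skew, map_neg, LinearMap.neg_apply]

lemma killingForm_contraction (t : L ⊗[F] L) (a b : L) :
    killingForm F L (contraction t a) b = killingEval a b t := by
  induction t with
  | zero => simp
  | tmul x y => simp [killingForm_comm x a, killingForm_comm y b]
  | add x y hx hy => simp [hx, hy]

@[simp] lemma killingEval_flip (t : L ⊗[F] L) (a b : L) :
    killingEval a b (flip t) = killingEval b a t := by
  induction t with
  | zero => simp
  | tmul x y => simp [mul_comm]
  | add x y hx hy => rw [map_add, map_add, map_add, hx, hy]

lemma contraction_tensorSq (φ : L ≃ₗ⁅F⁆ L) (t : L ⊗[F] L) (a : L) :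
    contraction (tensorSq φ t) (φ a) = φ (contraction t a) := by
  induction t with
  | zero => simp
  | tmul x y => simp [killingForm_of_equiv_apply]
  | add x y hx hy => simp only [map_add, LinearMap.add_apply, hx, hy]

lemma killingEval_tensorSq (φ : L ≃ₗ⁅F⁆ L) (t : L ⊗[F] L) (a b : L) :
    killingEval (φ a) (φ b) (tensorSq φ t) = killingEval a b t := by
  rw [← killingForm_contraction, contraction_tensorSq, killingForm_of_equiv_apply,
    killingForm_contraction]

/-- A tensor is determined by its values on pairs of functionals `⟨a, ·⟩`, `⟨b, ·⟩` with `a, b` in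
a spanning set, when the Killing form is non-degenerate. -/
lemma eq_of_killingEval_eq [FiniteDimensional F L]
    (hL : ∀ x, (∀ y, killingForm F L x y = 0) → x = 0) {S : Set L}
    (hS : Submodule.span F S = ⊤) {t t' : L ⊗[F] L}
    (h : ∀ a ∈ S, ∀ b ∈ S, killingEval a b t = killingEval a b t') : t = t' := by
  have h2 : ∀ a b, killingEval a b t = killingEval a b t' := by
    have add_left : ∀ (s : L ⊗[F] L) (a a' b : L), killingEval (a + a') b s =
        killingEval a b s + killingEval a' b s := fun s a a' b ↦ by
      simp [← killingForm_contraction]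
    have add_right : ∀ (s : L ⊗[F] L) (a b b' : L), killingEval a (b + b') s =
        killingEval a b s + killingEval a b' s := fun s a a' b ↦ by
      simp [← killingForm_contraction]
    have smul_left : ∀ (s : L ⊗[F] L) (c : F) (a b : L), killingEval (c • a) b s =
        c * killingEval a b s := fun s c a b ↦ by
      simp [← killingForm_contraction]
    have smul_right : ∀ (s : L ⊗[F] L) (c : F) (a b : L), killingEval a (c • b) s =
        c * killingEval a b s := fun s c a b ↦ by
      simp [← killingForm_contraction]
    have zero_left : ∀ (s : L ⊗[F] L) (b : L), killingEval 0 b s = 0 := fun s b ↦ by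
      simp [← killingForm_contraction]
    have zero_right : ∀ (s : L ⊗[F] L) (b : L), killingEval b 0 s = 0 := fun s b ↦ by
      simp [← killingForm_contraction]
    intro a b
    have ha : a ∈ Submodule.span F S := hS ▸ Submodule.mem_top
    have hb : b ∈ Submodule.span F S := hS ▸ Submodule.mem_top
    induction ha, hb using Submodule.span_induction₂ with
    | mem_mem x y hx hy => exact h x hx y hy
    | zero_left y hy => simp only [zero_left]
    | zero_right x hx => simp only [zero_right]
    | add_left x y z _ _ _ h1 h2 => simp only [add_left, h1, h2]
    | add_right x y z _ _ _ h1 h2 => simp only [add_right, h1, h2]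
    | smul_left c x y _ _ h1 => simp only [smul_left, h1]
    | smul_right c x y _ _ h1 => simp only [smul_right, h1]
  have hinj : Function.Injective (killingForm F L) := by
    rw [injective_iff_map_eq_zero]
    intro x hx
    exact hL x fun y ↦ by rw [hx]; rfl
  have hsurj : Function.Surjective (killingForm F L) :=
    (LinearMap.injective_iff_surjective_of_finrank_eq_finrank
      (Subspace.dual_finrank_eq (K := F) (V := L)).symm).1 hinj
  let e := Module.finBasis F L
  apply (e.tensorProduct e).ext_elem
  rintro ⟨i, j⟩
  obtain ⟨a, ha⟩ := hsurj (e.coord i)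
  obtain ⟨b, hb⟩ := hsurj (e.coord j)
  have key : ∀ s : L ⊗[F] L, (e.tensorProduct e).repr s (i, j) = killingEval a b s := by
    intro s
    induction s with
    | zero => simp
    | tmul x y => simp [ha, hb, mul_comm]
    | add x y hx hy => simp only [map_add, Finsupp.add_apply, hx, hy]
  rw [key, key, h2]

end Contraction

/-! ### Root vectors of a split simple Lie algebra -/

section Roots

variable {K g : Type*} [Field K] [CharZero K] [LieRing g] [LieAlgebra K g]
  [FiniteDimensional K g] [IsSimple K g]
  {H : LieSubalgebra K g} [H.IsCartanSubalgebra] [IsTriangularizable K H g]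

@[simp] lemma root_negRoot (β : H.root) :
    (rootSystem H).root (negRoot β) = -(rootSystem H).root β := rfl

@[simp] lemma negRoot_negRoot (β : H.root) : negRoot (negRoot β) = β := by
  apply (rootSystem H).root.injective
  simp only [root_negRoot, neg_neg]

lemma negRoot_injective : Function.Injective (negRoot (H := H)) :=
  Function.LeftInverse.injective negRoot_negRoot

lemma negRoot_eq_iff {β γ : H.root} : negRoot β = γ ↔ β = negRoot γ :=
  ⟨fun h ↦ by rw [← h, negRoot_negRoot], fun h ↦ by rw [h, negRoot_negRoot]⟩

lemma negRoot_eq_reflectionPerm (β : H.root) :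
    negRoot β = (rootSystem H).reflectionPerm β β := by
  apply (rootSystem H).root.injective
  rw [root_negRoot]
  simp [-rootSystem_root_apply]

@[simp] lemma isPos_negRoot {b : (rootSystem H).Base} (β : H.root) :
    b.IsPos (negRoot β) ↔ ¬ b.IsPos β := by
  rw [negRoot_eq_reflectionPerm]
  exact RootPairing.Base.IsPos.neg_iff_not (b := b) β

lemma height_negRoot {b : (rootSystem H).Base} (β : H.root) :
    b.height (negRoot β) = - b.height β := by
  rw [negRoot_eq_reflectionPerm]
  exact b.height_reflectionPerm_self β

/-- The element of `H` that corresponds to the root `β` under the Killing form. -/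
def rootDual (β : H.root) : H := (cartanEquivDual H).symm ((rootSystem H).root β)

lemma killingForm_rootDual (β : H.root) (h : H) :
    killingForm K g (rootDual β : H) (h : g) = (rootSystem H).root β h := by
  have := LinearEquiv.apply_symm_apply (cartanEquivDual H) ((rootSystem H).root β)
  exact LinearMap.congr_fun this h

lemma span_rootDual (b : (rootSystem H).Base) :
    Submodule.span K (Set.range fun i : b.support ↦ rootDual (H := H) i) = ⊤ := by
  have h := b.toWeightBasis.span_eq
  have : (Set.range fun i : b.support ↦ rootDual (H := H) i) =
      (cartanEquivDual H).symm '' (Set.range b.toWeightBasis) := by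
    rw [← Set.range_comp]
    congr 1
    ext i
    simp [rootDual]
  rw [this, ← LinearEquiv.coe_coe, Submodule.span_image, h, Submodule.map_top, LinearEquiv.range]

lemma root_rootDual_self_ne_zero (β : H.root) : (rootSystem H).root β (rootDual β) ≠ 0 :=
  root_apply_cartanEquivDual_symm_ne_zero (H.isNonZero_coe_root β)

lemma coroot_eq_smul_rootDual (β : H.root) :
    (rootSystem H).coroot β =
      (2 * ((rootSystem H).root β (rootDual β))⁻¹) • rootDual β := by
  rw [mul_smul, ofNat_smul_eq_nsmul]
  rfl

@[simp] lemma rootDual_negRoot (β : H.root) : rootDual (negRoot β) = - rootDual β := by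
  rw [rootDual, root_negRoot, map_neg, rootDual]

lemma exists_smul_eq_of_mem_rootSpace {α : Weight K H g} (hα : α.IsNonZero) {x y : g}
    (hx : x ∈ rootSpace H α) (hy : y ∈ rootSpace H α) (hx0 : x ≠ 0) : ∃ c : K, c • x = y := by
  simpa using (finrank_eq_one_iff_of_nonzero' (⟨x, hx⟩ : rootSpace H α) (by simpa using hx0)).mp
      (finrank_rootSpace_eq_one _ hα) ⟨y, hy⟩

/-- If `α`, `β` and `α + β` are roots then `[g_α, g_β] ≠ 0`: a vector of `g_β` is obtained by
lowering a vector at the top of the `α`-chain through `β`, and raising it back does not kill it. -/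
lemma lie_ne_zero_of_mem_rootSpace {α β : Weight K H g} (hα : α.IsNonZero) (hβ : β.IsNonZero)
    {x y : g} (hx : x ∈ rootSpace H α) (hy : y ∈ rootSpace H β) (hx0 : x ≠ 0) (hy0 : y ≠ 0)
    (hαβ : rootSpace H (α + β) ≠ ⊥) : ⁅x, y⁆ ≠ 0 := by
  obtain ⟨w, hw, hw0⟩ := (chainTop α β).exists_ne_zero
  obtain ⟨h, e, f, isSl2, he, hf⟩ := exists_isSl2Triple_of_weight_isNonZero hα
  obtain rfl := isSl2.h_eq_coroot hα he hf
  have prim : isSl2.HasPrimitiveVectorWith w (chainLength α β : K) :=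
    have := lie_mem_genWeightSpace_of_mem_genWeightSpace he hw
    ⟨hw0, (chainLength_smul _ _ hw).symm, by rwa [genWeightSpace_add_chainTop _ _ hα] at this⟩
  have h1 : 1 ≤ chainTopCoeff α β := by
    have := ((rootSpace_zsmul_add_ne_bot_iff α β hα 1).1 (by simpa using hαβ)).1
    exact_mod_cast this
  obtain ⟨q, hq⟩ : ∃ q, chainTopCoeff α β = q + 1 := ⟨_, (Nat.sub_add_cancel h1).symm⟩
  have hq' : q + 1 ≤ chainLength α β := hq ▸ chainTopCoeff_le_chainLength α β
  have hv0 : ((toEnd K g g f) ^ (q + 1)) w ≠ 0 := prim.pow_toEnd_f_ne_zero_of_eq_nat rfl hq'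
  have hv : ((toEnd K g g f) ^ (q + 1)) w ∈ rootSpace H β := by
    have := toEnd_pow_apply_mem hf hw (q + 1)
    have h2 : (q + 1) • (-α : H → K) + (chainTop α β : H → K) = β := by
      rw [coe_chainTop', hq, smul_neg, neg_add_cancel_left]
    rwa [h2] at this
  have he0 : e ≠ 0 := isSl2.e_ne_zero
  obtain ⟨c, rfl⟩ := exists_smul_eq_of_mem_rootSpace hα he hx he0
  obtain ⟨d, rfl⟩ := exists_smul_eq_of_mem_rootSpace hβ hv hy hv0
  rw [smul_lie, lie_smul, prim.lie_e_pow_succ_toEnd_f]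
  have hq0 : ((toEnd K g g f) ^ q) w ≠ 0 :=
    prim.pow_toEnd_f_ne_zero_of_eq_nat rfl ((Nat.le_succ q).trans hq')
  have h3 : ((chainLength α β : K) - q) ≠ 0 := by
    rw [sub_ne_zero]
    exact_mod_cast (Nat.lt_of_succ_le hq').ne'
  have h4 : (q : K) + 1 ≠ 0 := Nat.cast_add_one_ne_zero q
  refine smul_ne_zero ?_ (smul_ne_zero ?_ (smul_ne_zero (mul_ne_zero h4 h3) hq0))
  · rintro rfl; simp at hx0
  · rintro rfl; simp at hy0

namespace AdmissibleQuadruple.RootVectors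

variable {b : (rootSystem H).Base} {Q : AdmissibleQuadruple b} (E : Q.RootVectors)
include E

lemma X_ne_zero (β : H.root) : E.X β ≠ 0 := by
  intro h
  have := E.normalised β
  simp [h] at this

lemma lie_coe_X (h : H) (β : H.root) : ⁅(h : g), E.X β⁆ = (rootSystem H).root β h • E.X β :=
  lie_eq_smul_of_mem_rootSpace (E.mem β) h

lemma killingForm_X_X (β γ : H.root) [Decidable (γ = negRoot β)] :
    killingForm K g (E.X β) (E.X γ) = if γ = negRoot β then 1 else 0 := by
  split_ifs with h
  · rw [h, E.normalised]
  · refine killingForm_apply_eq_zero_of_mem_rootSpace_of_add_ne_zero K g H (E.mem β) (E.mem γ) ?_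
    intro h2
    apply h
    apply (rootSystem H).root.injective
    rw [root_negRoot, eq_neg_iff_add_eq_zero, add_comm]
    ext x
    exact congrFun h2 x

lemma killingForm_X_coe (β : H.root) (h : H) : killingForm K g (E.X β) h = 0 := by
  refine killingForm_apply_eq_zero_of_mem_rootSpace_of_add_ne_zero K g H (E.mem β)
    (β := 0) ?_ ?_
  · rw [rootSpace_zero_eq]; exact h.2
  · rw [add_zero]
    intro h0
    exact H.isNonZero_coe_root β h0

lemma killingForm_coe_X (β : H.root) (h : H) : killingForm K g h (E.X β) = 0 := by
  rw [killingForm_comm, E.killingForm_X_coe]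

lemma lie_X_negRoot (β : H.root) : ⁅E.X β, E.X (negRoot β)⁆ = rootDual β := by
  have h2 : E.X (negRoot β) ∈ rootSpace H (-(β.1 : H → K)) := E.mem (negRoot β)
  rw [lie_eq_killingForm_smul_of_mem_rootSpace_of_mem_rootSpace_neg (E.mem β) h2,
    E.normalised, one_smul]
  rfl

lemma lie_X_X {β γ δ : H.root}
    (h : (rootSystem H).root δ = (rootSystem H).root β + (rootSystem H).root γ) :
    ∃ c : K, c ≠ 0 ∧ ⁅E.X β, E.X γ⁆ = c • E.X δ := by
  have h' : (δ.1 : H → K) = β.1 + γ.1 := by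
    ext x
    exact LinearMap.congr_fun h x
  have h1 := lie_mem_genWeightSpace_of_mem_genWeightSpace (E.mem β) (E.mem γ)
  rw [← h'] at h1
  obtain ⟨c, hc⟩ := exists_smul_eq_of_mem_rootSpace (H.isNonZero_coe_root δ) (E.mem δ) h1
    (E.X_ne_zero δ)
  refine ⟨c, ?_, hc.symm⟩
  rintro rfl
  refine lie_ne_zero_of_mem_rootSpace (H.isNonZero_coe_root β) (H.isNonZero_coe_root γ) (E.mem β)
    (E.mem γ) (E.X_ne_zero β) (E.X_ne_zero γ) ?_ (by rw [← hc, zero_smul])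
  rw [← h']
  exact δ.1.genWeightSpace_ne_bot

lemma lie_X_X_eq_zero {β γ : H.root} (h0 : γ ≠ negRoot β)
    (h : ∀ δ, (rootSystem H).root δ ≠ (rootSystem H).root β + (rootSystem H).root γ) :
    ⁅E.X β, E.X γ⁆ = 0 := by
  have h1 := lie_mem_genWeightSpace_of_mem_genWeightSpace (E.mem β) (E.mem γ)
  by_contra hne
  have hbot : rootSpace H (β.1 + γ.1 : H → K) ≠ ⊥ := by
    intro hb
    have h2 : ⁅E.X β, E.X γ⁆ ∈ rootSpace H (β.1 + γ.1 : H → K) := h1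
    rw [hb] at h2
    exact hne h2
  let δ : Weight K H g := ⟨_, hbot⟩
  have hδ : δ.IsNonZero := by
    intro hz
    apply h0
    apply (rootSystem H).root.injective
    rw [root_negRoot, eq_neg_iff_add_eq_zero, add_comm]
    ext x
    exact congrFun hz x
  refine h ⟨δ, by simpa [LieSubalgebra.root] using hδ⟩ ?_
  ext x
  rfl

/-- `g` is spanned by `H` and the root vectors. -/
lemma span_eq_top : Submodule.span K ((H : Set g) ∪ Set.range E.X) = ⊤ := by
  have h := iSup_genWeightSpace_eq_top K H g
  rw [← LieSubmodule.toSubmodule_inj, LieSubmodule.iSup_toSubmodule,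
    LieSubmodule.top_toSubmodule] at h
  rw [eq_top_iff, ← h, iSup_le_iff]
  intro χ
  by_cases hb : rootSpace H χ = ⊥
  · change (rootSpace H χ).toSubmodule ≤ _
    rw [hb]; simp
  · let δ : Weight K H g := ⟨_, hb⟩
    by_cases hδ : δ.IsZero
    · have : χ = 0 := hδ
      intro x hx
      apply Submodule.subset_span
      left
      rw [this] at hx
      change x ∈ rootSpace H 0 at hx
      rwa [rootSpace_zero_eq] at hx
    · intro x hx
      obtain ⟨c, rfl⟩ := exists_smul_eq_of_mem_rootSpace (α := δ) hδ
        (E.mem ⟨δ, by simpa [LieSubalgebra.root] using hδ⟩) hx (E.X_ne_zero _)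
      exact Submodule.smul_mem _ _ (Submodule.subset_span (Or.inr ⟨_, rfl⟩))

lemma isNilpotent_ad_X (β : H.root) : IsNilpotent (ad K g (E.X β)) :=
  LieModule.isNilpotent_toEnd_of_mem_rootSpace g H (χ := β.1) (H.isNonZero_coe_root β) (E.mem β)

end AdmissibleQuadruple.RootVectors

end Roots

/-! ### The partial order on roots generated by `τ` -/

section Combinatorics

variable {K g : Type*} [Field K] [CharZero K] [LieRing g] [LieAlgebra K g]
  [FiniteDimensional K g] [IsSimple K g]
  {H : LieSubalgebra K g} [H.IsCartanSubalgebra] [IsTriangularizable K H g]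
  {b : (rootSystem H).Base}

variable (b) in
/-- The linear form on the dual of `H` which takes the value `1` on the simple roots. -/
def heightForm : Module.Dual K H →ₗ[K] K := b.toWeightBasis.constr K fun _ ↦ 1

@[simp] lemma heightForm_simple (i : b.support) :
    heightForm b ((rootSystem H).root i) = 1 := by
  rw [heightForm, ← b.toWeightBasis_apply, Module.Basis.constr_basis]

lemma heightForm_root (β : H.root) : heightForm b ((rootSystem H).root β) = b.height β := by
  obtain ⟨f, -, -, hf⟩ := b.exists_root_eq_sum_int β
  rw [RootPairing.Base.height_eq_sum hf, hf, map_sum, Int.cast_sum]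
  refine Finset.sum_congr rfl fun j hj ↦ ?_
  rw [map_zsmul, heightForm_simple ⟨j, hj⟩]
  simp

lemma exists_nat_coeff {β : H.root} (hβ : b.IsPos β) :
    ∃ n : b.support → ℕ, (rootSystem H).root β = ∑ i, n i • (rootSystem H).root i := by
  obtain ⟨f, -, hf | hf⟩ := b.exists_root_eq_sum_nat_or_neg β
  · exact ⟨fun i ↦ f i, by rw [hf, ← Finset.sum_coe_sort]⟩
  · exfalso
    have h1 := heightForm_root (b := b) β
    rw [hf, ← Finset.sum_coe_sort, map_neg, map_sum] at h1
    simp only [map_nsmul, heightForm_simple] at h1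
    have h2 : (b.height β : K) = ((-∑ i : b.support, (f i : ℤ) : ℤ) : K) := by
      rw [← h1]; push_cast; simp
    have h3 := Int.cast_injective h2
    have h4 : 0 < b.height β := hβ
    have h5 : (0 : ℤ) ≤ ∑ i : b.support, (f i : ℤ) := Finset.sum_nonneg fun _ _ ↦ by positivity
    lia

lemma repr_sum_zsmul (n : b.support → ℤ) (i : b.support) :
    b.toWeightBasis.repr (∑ i, n i • (rootSystem H).root i) i = n i := by
  have : ∑ i, n i • (rootSystem H).root i = ∑ i, (n i : K) • b.toWeightBasis i := by
    refine Finset.sum_congr rfl fun i _ ↦ ?_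
    rw [b.toWeightBasis_apply]
    exact (Int.cast_smul_eq_zsmul K (n i) _).symm
  rw [this, Module.Basis.repr_sum_self]

lemma eq_simple_of_height_eq_one {β : H.root} (h : b.height β = 1) :
    ∃ i : b.support, (i : H.root) = β := by
  classical
  have hβ : b.IsPos β := by rw [RootPairing.Base.isPos_iff, h]; exact one_pos
  obtain ⟨n, hn⟩ := exists_nat_coeff hβ
  have h1 := heightForm_root (b := b) β
  rw [hn, map_sum, h] at h1
  simp only [map_nsmul, heightForm_simple, nsmul_eq_mul, mul_one, Int.cast_one] at h1
  have h2 : ∑ i, n i = 1 := by exact_mod_cast h1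
  obtain ⟨i, hi, h3⟩ : ∃ i, n i = 1 ∧ ∀ j, j ≠ i → n j = 0 := by
    obtain ⟨i, -, hi⟩ := Finset.exists_ne_zero_of_sum_ne_zero (by rw [h2]; exact one_ne_zero)
    have h4 := Finset.add_sum_erase Finset.univ n (Finset.mem_univ i)
    refine ⟨i, by lia, fun j hj ↦ ?_⟩
    have h5 : ∑ x ∈ Finset.univ.erase i, n x = 0 := by lia
    exact Finset.sum_eq_zero_iff.1 h5 j (by simp [hj])
  refine ⟨i, (rootSystem H).root.injective ?_⟩
  rw [hn, Finset.sum_eq_single i, hi, one_smul]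
  · intro j _ hj; rw [h3 j hj, zero_smul]
  · simp

namespace AdmissibleQuadruple

variable (Q : AdmissibleQuadruple b)

/-- `τ` maps the simple root `i` to the simple root `j`. -/
def Step (i j : b.support) : Prop := ∃ hi : i ∈ Q.Γ₁, (Q.τ ⟨i, hi⟩ : b.support) = j

variable {Q}

lemma step_coe (i : Q.Γ₁) : Q.Step i (Q.τ i) := ⟨i.2, rfl⟩

lemma Step.left_unique {i i' j : b.support} (h : Q.Step i j) (h' : Q.Step i' j) : i = i' := by
  obtain ⟨hi, rfl⟩ := h
  obtain ⟨hi', h⟩ := h'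
  have := Q.τ.injective (Subtype.ext h)
  exact (Subtype.ext_iff.1 this).symm

lemma Step.right_unique {i j j' : b.support} (h : Q.Step i j) (h' : Q.Step i j') : j = j' := by
  obtain ⟨hi, rfl⟩ := h
  obtain ⟨hi', rfl⟩ := h'
  rfl

lemma mem_Γ₁_iff {i : b.support} : i ∈ Q.Γ₁ ↔ ∃ j, Q.Step i j :=
  ⟨fun h ↦ ⟨_, h, rfl⟩, fun ⟨_, h, _⟩ ↦ h⟩

lemma mem_Γ₂_iff {j : b.support} : j ∈ Q.Γ₂ ↔ ∃ i, Q.Step i j := by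
  refine ⟨fun h ↦ ⟨Q.τ.symm ⟨j, h⟩, (Q.τ.symm ⟨j, h⟩).2, by simp⟩, ?_⟩
  rintro ⟨i, hi, rfl⟩
  exact (Q.τ ⟨i, hi⟩).2

/-- `τ` has no cycles: the elements reached from an element of a cycle all lie on the cycle, hence
in `Γ₁`. -/
lemma not_transGen_step_self (i : b.support) : ¬ Relation.TransGen Q.Step i i := by
  intro h
  have key : ∀ j, Relation.TransGen Q.Step i j → Relation.TransGen Q.Step j i := by
    intro j hj
    have step : ∀ {j k}, Relation.TransGen Q.Step j i → Q.Step j k →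
        Relation.TransGen Q.Step k i := by
      intro j k hji hjk
      obtain ⟨k', hk', hk'i⟩ := Relation.TransGen.head'_iff.1 hji
      rw [hjk.right_unique hk']
      rcases Relation.reflTransGen_iff_eq_or_transGen.1 hk'i with h1 | h1
      · rw [← h1]; exact h
      · exact h1
    induction hj with
    | single hj => exact step h hj
    | tail _ hjk ih => exact step ih hjk
  have hi : i ∈ Q.Γ₁ := by
    obtain ⟨k, hk, -⟩ := Relation.TransGen.head'_iff.1 h
    exact hk.1
  obtain ⟨j, hj, hij⟩ := Q.nilpotent ⟨i, hi⟩
  obtain ⟨k, hk, -⟩ := Relation.TransGen.head'_iff.1 (key j hij)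
  exact hj hk.1

lemma Maps.neg {β β' : H.root} (h : Q.Maps β β') : Q.Maps (negRoot β) (negRoot β') := by
  obtain ⟨n, h1, h2⟩ := h
  exact ⟨-n, by simp [h1, -rootSystem_root_apply], by simp [h2, -rootSystem_root_apply]⟩

lemma maps_coe (i : Q.Γ₁) : Q.Maps ((i : b.support) : H.root) ((Q.τ i : b.support) : H.root) := by
  classical
  exact ⟨Pi.single i 1, by simp [Pi.single_apply, -rootSystem_root_apply],
    by simp [Pi.single_apply, -rootSystem_root_apply]⟩

lemma Maps.height_eq {β β' : H.root} (h : Q.Maps β β') : b.height β' = b.height β := by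
  obtain ⟨n, h1, h2⟩ := h
  apply Int.cast_injective (α := K)
  rw [← heightForm_root, ← heightForm_root, h1, h2]
  simp only [map_sum, map_zsmul, heightForm_simple]

lemma Maps.isPos_iff {β β' : H.root} (h : Q.Maps β β') : b.IsPos β' ↔ b.IsPos β := by
  rw [RootPairing.Base.isPos_iff, h.height_eq, RootPairing.Base.isPos_iff]

lemma Prec.isPos_iff {β β' : H.root} (h : Q.Prec β β') : b.IsPos β' ↔ b.IsPos β := by
  induction h with
  | single h => exact h.isPos_iff
  | tail _ h ih => rw [h.isPos_iff, ih]

lemma prec_negRoot_iff {β β' : H.root} : Q.Prec (negRoot β) (negRoot β') ↔ Q.Prec β β' := by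
  have : ∀ {γ γ' : H.root}, Q.Prec γ γ' → Q.Prec (negRoot γ) (negRoot γ') :=
    Relation.TransGen.lift negRoot (fun _ _ h ↦ Maps.neg h) _ _
  exact ⟨fun h ↦ by simpa using this h, this⟩

variable (Q) in
/-- The root `β` lies in the integral span of `Γ₁`. -/
def InSpan (β : H.root) : Prop :=
  ∃ n : Q.Γ₁ → ℤ, (rootSystem H).root β = ∑ i, n i • (rootSystem H).root (i : b.support)

lemma Maps.inSpan {β β' : H.root} (h : Q.Maps β β') : Q.InSpan β := ⟨h.choose, h.choose_spec.1⟩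

open Classical in
lemma repr_sum_Γ₁ (n : Q.Γ₁ → ℤ) (j : b.support) :
    b.toWeightBasis.repr (∑ i, n i • (rootSystem H).root (i : b.support)) j =
      ∑ i : Q.Γ₁, if (i : b.support) = j then (n i : K) else 0 := by
  rw [map_sum, Finsupp.finsetSum_apply]
  refine Finset.sum_congr rfl fun i _ ↦ ?_
  rw [map_zsmul, b.toWeightBasis_repr_root, Finsupp.smul_apply, Finsupp.single_apply]
  split_ifs <;> simp

lemma InSpan.repr_eq_zero {β : H.root} (h : Q.InSpan β) {j : b.support} (hj : j ∉ Q.Γ₁) :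
    b.toWeightBasis.repr ((rootSystem H).root β) j = 0 := by
  obtain ⟨n, hn⟩ := h
  rw [hn, repr_sum_Γ₁]
  refine Finset.sum_eq_zero fun i _ ↦ if_neg ?_
  rintro rfl
  exact hj i.2

lemma Maps.repr_eq {β β' : H.root} (h : Q.Maps β β') (i : Q.Γ₁) :
    b.toWeightBasis.repr ((rootSystem H).root β') (Q.τ i) =
      b.toWeightBasis.repr ((rootSystem H).root β) i := by
  classical
  obtain ⟨n, h1, h2⟩ := h
  rw [h1, h2, repr_sum_Γ₁, map_sum, Finsupp.finsetSum_apply]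
  refine Finset.sum_congr rfl fun k _ ↦ ?_
  rw [map_zsmul, b.toWeightBasis_repr_root, Finsupp.smul_apply, Finsupp.single_apply]
  have : ((Q.τ k : b.support) = (Q.τ i : b.support)) ↔ (k : b.support) = i := by
    rw [← Subtype.ext_iff, Q.τ.injective.eq_iff, Subtype.ext_iff]
  simp only [this]
  split_ifs <;> simp

/-- If `δ = τ^k β` with `k > 0`, then every simple root involved in `β` is moved by `τ`, at least
once, to a simple root involved in `δ`. -/
lemma Prec.exists_transGen {β δ : H.root} (h : Q.Prec β δ) {i : b.support}
    (hi : b.toWeightBasis.repr ((rootSystem H).root β) i ≠ 0) :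
    ∃ j, b.toWeightBasis.repr ((rootSystem H).root δ) j ≠ 0 ∧ Relation.TransGen Q.Step i j := by
  have step : ∀ {β β' : H.root} (_ : Q.Maps β β') {i : b.support}
      (_ : b.toWeightBasis.repr ((rootSystem H).root β) i ≠ 0),
      ∃ j, b.toWeightBasis.repr ((rootSystem H).root β') j ≠ 0 ∧ Q.Step i j := by
    intro β β' h i hi
    have hi1 : i ∈ Q.Γ₁ := by
      by_contra h1
      exact hi (h.inSpan.repr_eq_zero h1)
    exact ⟨Q.τ ⟨i, hi1⟩, by rwa [h.repr_eq ⟨i, hi1⟩], step_coe ⟨i, hi1⟩⟩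
  induction h with
  | single h =>
    obtain ⟨j, hj, hij⟩ := step h hi
    exact ⟨j, hj, .single hij⟩
  | tail _ h ih =>
    obtain ⟨j, hj, hij⟩ := ih
    obtain ⟨k, hk, hjk⟩ := step h hj
    exact ⟨k, hk, hij.tail hjk⟩

lemma not_prec_self (β : H.root) : ¬ Q.Prec β β := by
  intro h
  let S := {i : b.support // b.toWeightBasis.repr ((rootSystem H).root β) i ≠ 0}
  have hS : Nonempty S := by
    by_contra hS
    apply (rootSystem H).ne_zero β
    apply b.toWeightBasis.repr.injective
    ext i
    by_contra hi
    exact hS ⟨i, by simpa using hi⟩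
  have hwf : WellFounded fun i j : S ↦ Relation.TransGen Q.Step j.1 i.1 := by
    have : Std.Irrefl fun i j : S ↦ Relation.TransGen Q.Step j.1 i.1 :=
      ⟨fun i ↦ not_transGen_step_self i.1⟩
    have : IsTrans S fun i j : S ↦ Relation.TransGen Q.Step j.1 i.1 :=
      ⟨fun i j k h1 h2 ↦ h2.trans h1⟩
    exact Finite.wellFounded_of_trans_of_irrefl _
  obtain ⟨i, -, hi⟩ := hwf.has_min Set.univ ⟨hS.some, trivial⟩
  obtain ⟨j, hj, hij⟩ := h.exists_transGen i.2
  exact hi ⟨j, hj⟩ trivial hij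

lemma prec_wellFounded : WellFounded Q.Prec := by
  have : Std.Irrefl Q.Prec := ⟨not_prec_self⟩
  have : IsTrans H.root Q.Prec := ⟨fun _ _ _ ↦ Relation.TransGen.trans⟩
  exact Finite.wellFounded_of_trans_of_irrefl _

lemma prec_swap_wellFounded : WellFounded (Function.swap Q.Prec) := by
  have : Std.Irrefl (Function.swap Q.Prec) := ⟨not_prec_self⟩
  have : IsTrans H.root (Function.swap Q.Prec) := ⟨fun _ _ _ h1 h2 ↦ Relation.TransGen.trans h2 h1⟩
  exact Finite.wellFounded_of_trans_of_irrefl _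

lemma maps_simple_iff {i : b.support} {δ : H.root} :
    Q.Maps i δ ↔ ∃ j : b.support, Q.Step i j ∧ (j : H.root) = δ := by
  classical
  constructor
  · intro h
    have h1 : b.height δ = 1 := by
      rw [h.height_eq, b.height_one_of_mem_support i.2]
    obtain ⟨j, rfl⟩ := eq_simple_of_height_eq_one h1
    refine ⟨j, ?_, rfl⟩
    have hi1 : i ∈ Q.Γ₁ := by
      by_contra h2
      have := h.inSpan.repr_eq_zero h2
      simp [-rootSystem_root_apply] at this
    refine ⟨hi1, ?_⟩
    have h3 := h.repr_eq ⟨i, hi1⟩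
    rw [b.toWeightBasis_repr_root, b.toWeightBasis_repr_root] at h3
    by_contra h4
    rw [Finsupp.single_apply, if_neg (Ne.symm h4), Finsupp.single_eq_same] at h3
    exact zero_ne_one h3
  · rintro ⟨j, ⟨hi, rfl⟩, rfl⟩
    exact maps_coe ⟨i, hi⟩

lemma prec_simple_iff {i j : b.support} :
    Q.Prec i j ↔ Relation.TransGen Q.Step i j := by
  constructor
  · intro h
    have key : ∀ {β δ : H.root}, Q.Prec β δ → ∀ i : b.support, (i : H.root) = β →
        ∃ j : b.support, (j : H.root) = δ ∧ Relation.TransGen Q.Step i j := by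
      intro β δ h
      induction h with
      | single h =>
        rintro i rfl
        obtain ⟨j, hij, hj⟩ := maps_simple_iff.1 h
        exact ⟨j, hj, .single hij⟩
      | tail _ h ih =>
        intro i hi
        obtain ⟨j, rfl, hij⟩ := ih i hi
        obtain ⟨k, hjk, hk⟩ := maps_simple_iff.1 h
        exact ⟨k, hk, hij.tail hjk⟩
    obtain ⟨k, hk, hik⟩ := key h i rfl
    rwa [Subtype.ext hk] at hik
  · exact Relation.TransGen.lift (fun i : b.support ↦ (i : H.root))
      (fun i j h ↦ maps_simple_iff.2 ⟨j, h, rfl⟩) _ _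

/-- `τ` is the successor relation of the order that it generates. -/
lemma step_iff {i j : b.support} :
    Q.Step i j ↔ Relation.TransGen Q.Step i j ∧
      ∀ k, Relation.TransGen Q.Step i k → ¬ Relation.TransGen Q.Step k j := by
  constructor
  · refine fun h ↦ ⟨.single h, fun k hik hkj ↦ ?_⟩
    obtain ⟨k', hk', hk'k⟩ := Relation.TransGen.head'_iff.1 hik
    rw [hk'.right_unique h] at hk'k
    exact not_transGen_step_self j (Relation.TransGen.trans_right hk'k hkj)
  · rintro ⟨h, h'⟩
    obtain ⟨k, hik, hkj⟩ := Relation.TransGen.head'_iff.1 h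
    rcases Relation.reflTransGen_iff_eq_or_transGen.1 hkj with h1 | h1
    · rwa [h1]
    · exact absurd h1 (h' k (.single hik))

end AdmissibleQuadruple

end Combinatorics

/-! ### Coefficients of the Belavin–Drinfeld matrix -/

section DualEval

variable {F M : Type*} [Field F] [AddCommGroup M] [Module F M]

/-- The value of a tensor in `M ⊗ M` on a pair of functionals. -/
def dualEval (f f' : Module.Dual F M) : M ⊗[F] M →ₗ[F] F :=
  (TensorProduct.lid F F).toLinearMap ∘ₗ TensorProduct.map f f'

@[simp] lemma dualEval_tmul (f f' : Module.Dual F M) (x y : M) :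
    dualEval f f' (x ⊗ₜ y) = f x * f' y := by
  simp [dualEval]

@[simp] lemma dualEval_flip (f f' : Module.Dual F M) (t : M ⊗[F] M) :
    dualEval f f' (flip t) = dualEval f' f t := by
  induction t with
  | zero => simp
  | tmul x y => simp [mul_comm]
  | add x y hx hy => rw [map_add, map_add, map_add, hx, hy]

lemma dualEval_map (f f' : Module.Dual F M) (φ ψ : M →ₗ[F] M) (t : M ⊗[F] M) :
    dualEval f f' (TensorProduct.map φ ψ t) = dualEval (f ∘ₗ φ) (f' ∘ₗ ψ) t := by
  induction t with
  | zero => simp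
  | tmul x y => simp
  | add x y hx hy => simp only [map_add, hx, hy]

lemma dualEval_neg_neg (f f' : Module.Dual F M) (t : M ⊗[F] M) :
    dualEval (-f) (-f') t = dualEval f f' t := by
  induction t with
  | zero => simp
  | tmul x y => simp
  | add x y hx hy => simp only [map_add, hx, hy]

end DualEval

section Evaluation

variable {K g : Type*} [Field K] [CharZero K] [LieRing g] [LieAlgebra K g]
  [FiniteDimensional K g] [IsSimple K g]
  {H : LieSubalgebra K g} [H.IsCartanSubalgebra] [IsTriangularizable K H g]
  {b : (rootSystem H).Base}

variable (H) in
/-- The inclusion of `H ⊗ H` in `g ⊗ g`. -/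
abbrev cartanTensor : H ⊗[K] H →ₗ[K] g ⊗[K] g :=
  TensorProduct.map H.toSubmodule.subtype H.toSubmodule.subtype

lemma killingEval_cartanTensor (β γ : H.root) (t : H ⊗[K] H) :
    killingEval (rootDual β : g) (rootDual γ : g) (cartanTensor H t) =
      dualEval ((rootSystem H).root β) ((rootSystem H).root γ) t := by
  induction t with
  | zero => simp
  | tmul x y =>
    rw [TensorProduct.map_tmul, killingEval_tmul, dualEval_tmul]
    exact congrArg₂ _ (killingForm_rootDual β x) (killingForm_rootDual γ y)
  | add x y hx hy => simp only [map_add, hx, hy]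

lemma eq_of_dualEval_eq {t t' : H ⊗[K] H} (h : ∀ i j : b.support,
    dualEval ((rootSystem H).root i) ((rootSystem H).root j) t =
      dualEval ((rootSystem H).root i) ((rootSystem H).root j) t') : t = t' := by
  classical
  let e := b.toWeightBasis.dualBasis.map (Module.evalEquiv K H).symm
  have he : ∀ i, e.coord i = (rootSystem H).root i := by
    intro i
    apply e.ext
    intro j
    rw [Module.Basis.coord_apply, Module.Basis.repr_self, Module.Basis.map_apply]
    have : (rootSystem H).root i ((Module.evalEquiv K H).symm (b.toWeightBasis.dualBasis j)) =
        b.toWeightBasis.dualBasis j ((rootSystem H).root i) :=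
      Module.apply_evalEquiv_symm_apply ..
    rw [this, ← b.toWeightBasis_apply, Module.Basis.dualBasis_apply_self, Finsupp.single_apply]
    simp only [eq_comm]
  apply (e.tensorProduct e).ext_elem
  rintro ⟨i, j⟩
  have key : ∀ s : H ⊗[K] H, (e.tensorProduct e).repr s (i, j) =
      dualEval ((rootSystem H).root i) ((rootSystem H).root j) s := by
    intro s
    induction s with
    | zero => simp
    | tmul x y =>
      rw [Module.Basis.tensorProduct_repr_tmul_apply, dualEval_tmul, ← he, ← he, smul_eq_mul,
        mul_comm]
      rfl
    | add x y hx hy => simp only [map_add, Finsupp.add_apply, hx, hy]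
  rw [key, key, h]

namespace AdmissibleQuadruple

variable {Q : AdmissibleQuadruple b} (E : Q.RootVectors)
include E

lemma killingEval_X_cartanTensor (β : H.root) (x : g) (t : H ⊗[K] H) :
    killingEval (E.X β) x (cartanTensor H t) = 0 := by
  induction t with
  | zero => simp
  | tmul y z =>
    rw [TensorProduct.map_tmul, killingEval_tmul]
    exact mul_eq_zero_of_left (E.killingForm_X_coe β y) _
  | add x y hx hy => simp only [map_add, hx, hy, add_zero]

lemma killingEval_cartanTensor_X (β : H.root) (x : g) (t : H ⊗[K] H) :
    killingEval x (E.X β) (cartanTensor H t) = 0 := by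
  induction t with
  | zero => simp
  | tmul y z =>
    rw [TensorProduct.map_tmul, killingEval_tmul]
    exact mul_eq_zero_of_right _ (E.killingForm_X_coe β z)
  | add x y hx hy => simp only [map_add, hx, hy, add_zero]

lemma killingEval_rBD_coe_coe (h h' : H) :
    killingEval (h : g) (h' : g) (Q.rBD E) =
      killingEval (h : g) (h' : g) (cartanTensor H Q.rh) := by
  rw [rBD, map_add, map_add, map_sum, map_sum, Finset.sum_eq_zero, Finset.sum_eq_zero, add_zero,
    add_zero]
  · intro p _
    simp only [map_sub, killingEval_tmul, E.killingForm_coe_X, mul_zero, sub_zero]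
  · intro p _
    rw [killingEval_tmul, E.killingForm_coe_X, zero_mul]

lemma killingEval_rBD_coe_X (h : H) (β : H.root) :
    killingEval (h : g) (E.X β) (Q.rBD E) = 0 := by
  rw [rBD, map_add, map_add, map_sum, map_sum, Finset.sum_eq_zero, Finset.sum_eq_zero, add_zero,
    add_zero, killingEval_cartanTensor_X]
  · intro p _
    simp only [map_sub, killingEval_tmul, E.killingForm_coe_X, zero_mul, sub_zero]
  · intro p _
    rw [killingEval_tmul, E.killingForm_coe_X, zero_mul]

lemma killingEval_rBD_X_coe (β : H.root) (h : H) :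
    killingEval (E.X β) (h : g) (Q.rBD E) = 0 := by
  rw [rBD, map_add, map_add, map_sum, map_sum, Finset.sum_eq_zero, Finset.sum_eq_zero, add_zero,
    add_zero, killingEval_X_cartanTensor]
  · intro p _
    simp only [map_sub, killingEval_tmul, E.killingForm_coe_X, mul_zero, sub_zero]
  · intro p _
    rw [killingEval_tmul, E.killingForm_coe_X, mul_zero]

open Classical in
/-- The root part of the Belavin–Drinfeld matrix has coefficients `0`, `1` and `-1`. -/
lemma killingEval_rBD_X_X (β γ : H.root) :
    killingEval (E.X β) (E.X γ) (Q.rBD E) =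
      (if γ = negRoot β ∧ ¬ b.IsPos β then 1 else 0) +
      ((if ¬ b.IsPos β ∧ Q.Prec (negRoot β) γ then 1 else 0) -
        if ¬ b.IsPos γ ∧ Q.Prec (negRoot γ) β then 1 else 0) := by
  have h1 : ∀ p : H.root × H.root, killingForm K g (E.X β) (E.X p.1) *
      killingForm K g (E.X γ) (E.X (negRoot p.2)) = if p = (negRoot β, γ) then 1 else 0 := by
    intro p
    rw [E.killingForm_X_X, E.killingForm_X_X]
    simp only [negRoot_injective.eq_iff, Prod.ext_iff, mul_ite, mul_one, mul_zero]
    split_ifs <;> simp_all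
  have h2 : ∀ p : H.root × H.root, killingForm K g (E.X β) (E.X (negRoot p.2)) *
      killingForm K g (E.X γ) (E.X p.1) = if p = (negRoot γ, β) then 1 else 0 := by
    intro p
    rw [E.killingForm_X_X, E.killingForm_X_X]
    simp only [negRoot_injective.eq_iff, Prod.ext_iff, mul_ite, mul_one, mul_zero]
    split_ifs <;> simp_all
  rw [rBD, map_add, map_add, killingEval_X_cartanTensor, zero_add, map_sum, map_sum]
  simp only [map_sub, killingEval_tmul, h1, h2, Finset.sum_sub_distrib]
  congr 1
  · have h3 : ∀ δ : H.root, killingForm K g (E.X β) (E.X δ) *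
        killingForm K g (E.X γ) (E.X (negRoot δ)) =
          if δ = negRoot β then (if γ = negRoot β then 1 else 0) else 0 := by
      intro δ
      simp only [h1 (δ, δ), Prod.ext_iff]
      split_ifs <;> simp_all
    simp only [h3, Finset.sum_ite_eq', Finset.mem_filter_univ, isPos_negRoot]
    split_ifs <;> simp_all
  · simp only [Finset.sum_ite_eq', Finset.mem_filter_univ, isPos_negRoot]

end AdmissibleQuadruple

end Evaluation

/-! ### The action of `τ` on roots -/

section ExtendTau

variable {K g : Type*} [Field K] [CharZero K] [LieRing g] [LieAlgebra K g]
  [FiniteDimensional K g] [IsSimple K g]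
  {H : LieSubalgebra K g} [H.IsCartanSubalgebra] [IsTriangularizable K H g]
  {b : (rootSystem H).Base} {Q : AdmissibleQuadruple b}

lemma pairing_eq_root_rootDual (β γ : H.root) : (rootSystem H).pairing β γ =
    2 * ((rootSystem H).root γ (rootDual γ))⁻¹ * (rootSystem H).root β (rootDual γ) := by
  have : (rootSystem H).pairing β γ = (rootSystem H).root β ((rootSystem H).coroot γ) := rfl
  rw [this, coroot_eq_smul_rootDual, map_smul, smul_eq_mul]

lemma dualForm_root (β γ : H.root) :
    dualForm ((rootSystem H).root β) ((rootSystem H).root γ) =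
      (rootSystem H).root β (rootDual γ) := rfl

omit [IsTriangularizable K H g] in
lemma dualForm_sum_sum {ι : Type*} [Fintype ι] (f : ι → Module.Dual K H) (n m : ι → ℤ) :
    dualForm (∑ i, n i • f i) (∑ i, m i • f i) = ∑ i, ∑ j, n i • m j • dualForm (f i) (f j) := by
  simp only [dualForm, map_sum, LinearMap.sum_apply, map_zsmul, LinearMap.smul_apply,
    Finset.smul_sum]
  rw [Finset.sum_comm]
  exact Finset.sum_congr rfl fun i _ ↦ Finset.sum_congr rfl fun j _ ↦ smul_comm _ _ _

lemma root_reflectionPerm_eq (β γ : H.root) :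
    (rootSystem H).root ((rootSystem H).reflectionPerm γ β) =
      (rootSystem H).root β + (-(rootSystem H).pairingIn ℤ β γ) • (rootSystem H).root γ := by
  rw [RootPairing.root_reflectionPerm, neg_smul, RootPairing.reflection_apply_root' ℤ,
    sub_eq_add_neg]

namespace AdmissibleQuadruple

lemma Maps.root_rootDual {β β' γ γ' : H.root} (h : Q.Maps β β') (h' : Q.Maps γ γ') :
    (rootSystem H).root β' (rootDual γ') = (rootSystem H).root β (rootDual γ) := by
  obtain ⟨n, h1, h2⟩ := h
  obtain ⟨m, h3, h4⟩ := h'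
  rw [← dualForm_root, ← dualForm_root, h1, h2, h3, h4, dualForm_sum_sum, dualForm_sum_sum]
  simp only [Q.isometry]

lemma Maps.pairing {β β' γ γ' : H.root} (h : Q.Maps β β') (h' : Q.Maps γ γ') :
    (rootSystem H).pairing β' γ' = (rootSystem H).pairing β γ := by
  rw [pairing_eq_root_rootDual, pairing_eq_root_rootDual, h.root_rootDual h',
    h'.root_rootDual h']

lemma Maps.add_zsmul {β β' γ γ' δ δ' : H.root} (h : Q.Maps β β') (h' : Q.Maps γ γ') (z : ℤ)
    (hδ : (rootSystem H).root δ = (rootSystem H).root β + z • (rootSystem H).root γ)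
    (hδ' : (rootSystem H).root δ' = (rootSystem H).root β' + z • (rootSystem H).root γ') :
    Q.Maps δ δ' := by
  obtain ⟨n, h1, h2⟩ := h
  obtain ⟨m, h3, h4⟩ := h'
  refine ⟨n + z • m, ?_, ?_⟩
  · rw [hδ, h1, h3]
    simp only [Pi.add_apply, Pi.smul_apply, add_smul, Finset.sum_add_distrib, smul_assoc,
      Finset.smul_sum]
  · rw [hδ', h2, h4]
    simp only [Pi.add_apply, Pi.smul_apply, add_smul, Finset.sum_add_distrib, smul_assoc,
      Finset.smul_sum]

/-- A positive root in the span of `Γ₁` pairs positively with an element of `Γ₁`. -/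
lemma InSpan.exists_pos_pairing {β : H.root} (h : Q.InSpan β) (hβ : b.IsPos β) :
    ∃ j : Q.Γ₁, 0 < (rootSystem H).pairingIn ℤ β (j : b.support) := by
  obtain ⟨j, hj, hjβ⟩ := hβ.exists_mem_support_pos_pairingIn
  have hβj : 0 < (rootSystem H).pairingIn ℤ β j := by
    rwa [RootPairing.zero_lt_pairingIn_iff'] at hjβ
  by_cases hj1 : (⟨j, hj⟩ : b.support) ∈ Q.Γ₁
  · exact ⟨⟨⟨j, hj⟩, hj1⟩, hβj⟩
  exfalso
  obtain ⟨n, hn⟩ := exists_nat_coeff hβ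
  have h0 : ∀ i : b.support, i ∉ Q.Γ₁ → n i = 0 := by
    intro i hi
    have h1 := h.repr_eq_zero hi
    have h2 := repr_sum_zsmul (fun i ↦ (n i : ℤ)) i
    simp only [natCast_zsmul] at h2
    rw [← hn, h1] at h2
    exact_mod_cast h2.symm
  have h1 : (rootSystem H).pairingIn ℤ β j =
      ∑ i : b.support, (n i : ℤ) * (rootSystem H).pairingIn ℤ i j := by
    apply Int.cast_injective (α := K)
    have h2 : ∀ γ, (((rootSystem H).pairingIn ℤ γ j : ℤ) : K) =
        (rootSystem H).root γ ((rootSystem H).coroot j) := fun γ ↦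
      (rootSystem H).algebraMap_pairingIn ℤ γ j
    push_cast
    simp only [h2]
    rw [hn, LinearMap.sum_apply]
    simp [-rootSystem_root_apply]
  have h2 : (rootSystem H).pairingIn ℤ β j ≤ 0 := by
    rw [h1]
    refine Finset.sum_nonpos fun i _ ↦ ?_
    by_cases hi : i ∈ Q.Γ₁
    · refine mul_nonpos_of_nonneg_of_nonpos (by positivity)
        (b.pairingIn_le_zero_of_ne ?_ i.2 hj)
      rintro rfl
      exact hj1 hi
    · simp [h0 i hi]
  lia

end AdmissibleQuadruple

end ExtendTau

/-! ### Base change -/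

section BaseChange

variable {K g : Type*} [Field K] [LieRing g] [LieAlgebra K g] (Kb : Type*) [Field Kb] [Algebra K Kb]

/-- The inclusion `x ↦ 1 ⊗ x` of `g` in `Kb ⊗ g`. -/
def baseEmb : g →ₗ[K] Kb ⊗[K] g := TensorProduct.mk K Kb g 1

lemma baseEmb_apply (x : g) : baseEmb Kb x = (1 : Kb) ⊗ₜ[K] x := rfl

lemma lie_baseEmb (x y : g) :
    ⁅baseEmb (K := K) Kb x, baseEmb (K := K) Kb y⁆ = baseEmb (K := K) Kb ⁅x, y⁆ := by
  simp [baseEmb_apply, LieAlgebra.ExtendScalars.bracket_tmul]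

lemma baseEmb_smul (c : K) (x : g) :
    baseEmb Kb (c • x) = algebraMap K Kb c • baseEmb (K := K) Kb x := by
  rw [map_smul, algebraMap_smul]

lemma baseEmb_injective : Function.Injective (baseEmb (K := K) (g := g) Kb) := by
  have h := Module.Flat.rTensor_preserves_injective_linearMap (M := g)
    (Algebra.linearMap K Kb) (FaithfulSMul.algebraMap_injective K Kb)
  have h2 : (LinearMap.rTensor g (Algebra.linearMap K Kb)) ∘ₗ
      (TensorProduct.lid K g).symm.toLinearMap = baseEmb Kb := by
    ext x
    simp [baseEmb_apply]
  rw [← h2]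
  exact h.comp (TensorProduct.lid K g).symm.injective

lemma span_baseEmb {S : Set g} (hS : Submodule.span K S = ⊤) :
    Submodule.span Kb (baseEmb (K := K) Kb '' S) = ⊤ := by
  have := congrArg (Submodule.baseChange Kb) hS
  rwa [Submodule.baseChange_top, Submodule.baseChange_span] at this

variable [FiniteDimensional K g]

lemma killingForm_baseEmb (x y : g) :
    killingForm Kb (Kb ⊗[K] g) (baseEmb (K := K) Kb x) (baseEmb (K := K) Kb y) =
      algebraMap K Kb (killingForm K g x y) := by
  rw [baseEmb_apply, baseEmb_apply, killingForm, LieModule.traceForm_baseChange]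
  simp [Algebra.algebraMap_eq_smul_one]

lemma killingEval_baseEmb (x y : g) (r : g ⊗[K] g) :
    killingEval (baseEmb (K := K) Kb x) (baseEmb (K := K) Kb y) (baseChangeTensor Kb r) =
      algebraMap K Kb (killingEval x y r) := by
  induction r with
  | zero => simp [baseChangeTensor]
  | tmul a b =>
    have : baseChangeTensor Kb (a ⊗ₜ[K] b) =
        baseEmb (K := K) Kb a ⊗ₜ[Kb] baseEmb (K := K) Kb b := by
      simp [baseChangeTensor, baseEmb_apply]
    rw [this, killingEval_tmul, killingEval_tmul, killingForm_baseEmb, killingForm_baseEmb, map_mul]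
  | add a b ha hb =>
    have : baseChangeTensor Kb (a + b) = baseChangeTensor Kb a + baseChangeTensor Kb b := by
      simp [baseChangeTensor, TensorProduct.tmul_add]
    rw [this, map_add, map_add, map_add, ha, hb]

lemma eq_zero_of_killingForm_baseEmb [IsKilling K g] {z : Kb ⊗[K] g}
    (h : ∀ x : g, killingForm Kb (Kb ⊗[K] g) z (baseEmb (K := K) Kb x) = 0) : z = 0 := by
  let e := Module.finBasis K g
  let e' := (killingForm K g).dualBasis (IsKilling.killingForm_nondegenerate K g) e
  let E := Algebra.TensorProduct.basis Kb e
  apply E.ext_elem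
  intro i
  rw [map_zero, Finsupp.zero_apply, ← h (e' i)]
  conv_rhs => rw [← E.sum_repr z]
  have hE : ∀ j, E j = baseEmb (K := K) Kb (e j) := fun j ↦ by simp [E, baseEmb_apply]
  simp only [map_sum, LinearMap.sum_apply, map_smul, LinearMap.smul_apply, hE,
    killingForm_baseEmb]
  have h2 : ∀ j, killingForm K g (e j) (e' i) = if i = j then 1 else 0 := fun j ↦ by
    rw [killingForm_comm]
    have := LinearMap.BilinForm.apply_dualBasis_left (IsKilling.killingForm_nondegenerate K g) e i j
    rw [this]; simp only [eq_comm]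
  simp [h2]

lemma killingForm_baseChange_nondegenerate [IsKilling K g] {z : Kb ⊗[K] g}
    (h : ∀ y, killingForm Kb (Kb ⊗[K] g) z y = 0) : z = 0 :=
  eq_zero_of_killingForm_baseEmb Kb fun _ ↦ h _

omit [FiniteDimensional K g] in
lemma killingForm_lie_baseChange (y z x : Kb ⊗[K] g) : killingForm Kb (Kb ⊗[K] g) ⁅y, z⁆ x =
    - killingForm Kb (Kb ⊗[K] g) z ⁅y, x⁆ := by
  rw [killingForm_lie_right, neg_neg]

end BaseChange

section CartanBase

variable {K g : Type*} [Field K] [CharZero K] [LieRing g] [LieAlgebra K g]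
  [FiniteDimensional K g] [IsSimple K g]
  {H : LieSubalgebra K g} [H.IsCartanSubalgebra] [IsTriangularizable K H g]
  {b : (rootSystem H).Base} {Q : AdmissibleQuadruple b} (E : Q.RootVectors)
  (Kb : Type*) [Field Kb] [Algebra K Kb]

variable (H) in
/-- The Cartan subalgebra of `Kb ⊗ g` spanned by `H`. -/
def cartanBase : Submodule Kb (Kb ⊗[K] g) :=
  Submodule.span Kb (Set.range fun h : H ↦ baseEmb (K := K) Kb (h : g))

/-- The element `1 ⊗ t_β` of `Kb ⊗ g`, where `t_β ∈ H` corresponds to the root `β`. -/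
def baseDual (β : H.root) : Kb ⊗[K] g := baseEmb (K := K) Kb (rootDual β : g)

lemma baseDual_mem (β : H.root) : baseDual Kb β ∈ cartanBase H Kb :=
  Submodule.subset_span ⟨rootDual β, rfl⟩

lemma baseDual_injective : Function.Injective (baseDual (H := H) Kb) := fun _ _ h ↦
  (rootSystem H).root.injective ((cartanEquivDual H).symm.injective
    (Subtype.ext (baseEmb_injective (K := K) Kb h)))

lemma baseDual_negRoot (β : H.root) : baseDual Kb (negRoot β) = -baseDual Kb β := by
  rw [baseDual, rootDual_negRoot]
  exact map_neg (baseEmb (K := K) Kb) (rootDual β : g)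

lemma killingForm_baseDual (β γ : H.root) :
    killingForm Kb (Kb ⊗[K] g) (baseDual Kb β) (baseDual Kb γ) =
      algebraMap K Kb ((rootSystem H).root β (rootDual γ)) := by
  rw [baseDual, baseDual, killingForm_baseEmb, killingForm_rootDual]

namespace AdmissibleQuadruple.RootVectors

/-- The root vector `1 ⊗ X β` of `Kb ⊗ g`. -/
def baseX (β : H.root) : Kb ⊗[K] g := baseEmb (K := K) Kb (E.X β)

lemma killingForm_baseX_baseX (β γ : H.root) [Decidable (γ = negRoot β)] :
    killingForm Kb (Kb ⊗[K] g) (E.baseX Kb β) (E.baseX Kb γ) = if γ = negRoot β then 1 else 0 := by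
  rw [baseX, baseX, killingForm_baseEmb, E.killingForm_X_X]
  split_ifs <;> simp

variable {Kb} in
lemma killingForm_baseX_left (β : H.root) {y : Kb ⊗[K] g} (hy : y ∈ cartanBase H Kb) :
    killingForm Kb (Kb ⊗[K] g) y (E.baseX Kb β) = 0 := by
  induction hy using Submodule.span_induction with
  | mem y hy =>
    obtain ⟨h, rfl⟩ := hy
    simp only [baseX]
    rw [killingForm_baseEmb, E.killingForm_coe_X, map_zero]
  | zero => simp
  | add y z _ _ hy hz => rw [map_add, LinearMap.add_apply, hy, hz, add_zero]
  | smul c y _ hy => rw [map_smul, LinearMap.smul_apply, hy, smul_zero]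

variable {Kb} in
lemma lie_baseX (β : H.root) {y : Kb ⊗[K] g} (hy : y ∈ cartanBase H Kb) :
    ⁅y, E.baseX Kb β⁆ = killingForm Kb (Kb ⊗[K] g) y (baseDual Kb β) • E.baseX Kb β := by
  induction hy using Submodule.span_induction with
  | mem y hy =>
    obtain ⟨h, rfl⟩ := hy
    simp only [baseX, baseDual]
    rw [lie_baseEmb, E.lie_coe_X, baseEmb_smul, killingForm_baseEmb, killingForm_comm,
      killingForm_rootDual]
  | zero => simp
  | add y z _ _ hy hz => rw [add_lie, hy, hz, map_add, LinearMap.add_apply, add_smul]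
  | smul c y _ hy => rw [smul_lie, hy, map_smul, LinearMap.smul_apply, smul_assoc]

/-- The decomposition of `Kb ⊗ g` in its Cartan subalgebra and the root spaces. -/
lemma sub_sum_mem_cartanBase (z : Kb ⊗[K] g) :
    z - ∑ β : H.root, killingForm Kb (Kb ⊗[K] g) z (E.baseX Kb (negRoot β)) • E.baseX Kb β ∈
      cartanBase H Kb := by
  classical
  have hz : z ∈ Submodule.span Kb (baseEmb (K := K) Kb '' ((H : Set g) ∪ Set.range E.X)) := by
    rw [span_baseEmb Kb E.span_eq_top]; trivial
  induction hz using Submodule.span_induction with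
  | mem z hz =>
    obtain ⟨x, hx | ⟨γ, rfl⟩, rfl⟩ := hz
    · have hm : baseEmb (K := K) Kb x ∈ cartanBase H Kb := Submodule.subset_span ⟨⟨x, hx⟩, rfl⟩
      simp only [E.killingForm_baseX_left _ hm, zero_smul, Finset.sum_const_zero, sub_zero]
      exact hm
    · rw [show baseEmb Kb (E.X γ) = E.baseX Kb γ from rfl]
      simp only [E.killingForm_baseX_baseX, negRoot_injective.eq_iff, ite_smul, one_smul,
        zero_smul, Finset.sum_ite_eq', Finset.mem_univ, if_true, sub_self, zero_mem]
  | zero => simp only [map_zero, LinearMap.zero_apply, zero_smul, Finset.sum_const_zero, sub_zero,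
      zero_mem]
  | add y z _ _ hy hz =>
    have := add_mem hy hz
    simp only [map_add, LinearMap.add_apply, add_smul, Finset.sum_add_distrib]
    rwa [add_sub_add_comm]
  | smul c y _ hy =>
    have := Submodule.smul_mem _ c hy
    simp only [map_smul, LinearMap.smul_apply, smul_assoc]
    rwa [← Finset.smul_sum, ← smul_sub]

variable {Kb} in
lemma mem_cartanBase {z : Kb ⊗[K] g}
    (h : ∀ β, killingForm Kb (Kb ⊗[K] g) z (E.baseX Kb β) = 0) : z ∈ cartanBase H Kb := by
  simpa only [h, zero_smul, Finset.sum_const_zero, sub_zero] using E.sub_sum_mem_cartanBase Kb z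

include E in
variable {Kb} in
/-- The Killing form is non-degenerate on the Cartan subalgebra. -/
lemma eq_zero_of_mem_cartanBase {z : Kb ⊗[K] g} (hz : z ∈ cartanBase H Kb)
    (h : ∀ i : b.support, killingForm Kb (Kb ⊗[K] g) z (baseDual Kb (i : H.root)) = 0) : z = 0 := by
  let f : g →ₗ[K] Kb := (killingForm Kb (Kb ⊗[K] g) z).restrictScalars K ∘ₗ baseEmb Kb
  have hfH : f ∘ₗ H.toSubmodule.subtype = 0 := by
    apply LinearMap.ext_on (span_rootDual b)
    rintro _ ⟨i, rfl⟩
    exact h i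
  have hf : f = 0 := by
    apply LinearMap.ext_on E.span_eq_top
    rintro _ (hx | ⟨γ, rfl⟩)
    · exact LinearMap.congr_fun hfH ⟨_, hx⟩
    · exact E.killingForm_baseX_left γ hz
  exact eq_zero_of_killingForm_baseEmb Kb fun x ↦ LinearMap.congr_fun hf x

end AdmissibleQuadruple.RootVectors

/-! ### Automorphisms that preserve the Cartan subalgebra -/

/-- The Lie automorphism `u` of `Kb ⊗ g` permutes the root spaces by `w`, multiplying the root
vectors by the factors `c`, and acts on the Cartan subalgebra accordingly. The set of roots is
regarded as a subset of the Cartan subalgebra by means of the Killing form. -/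
structure ActsByRootPerm (u : (Kb ⊗[K] g) ≃ₗ⁅Kb⁆ (Kb ⊗[K] g)) (w : H.root → H.root)
    (c : H.root → Kb) : Prop where
  apply_baseX : ∀ β, u (E.baseX Kb β) = c β • E.baseX Kb (w β)
  apply_baseDual : ∀ β, u (baseDual Kb β) = baseDual Kb (w β)

variable {Kb} {E} {u : (Kb ⊗[K] g) ≃ₗ⁅Kb⁆ (Kb ⊗[K] g)}

/-- An automorphism that preserves the Cartan subalgebra permutes the root spaces. -/
lemma exists_actsByRootPerm (hu : ∀ y ∈ cartanBase H Kb, u y ∈ cartanBase H Kb) :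
    ∃ w c, ActsByRootPerm E Kb u w c := by
  classical
  have hsurj : ∀ y ∈ cartanBase H Kb, ∃ y' ∈ cartanBase H Kb, u y' = y := by
    have hle : (cartanBase H Kb).map (u : (Kb ⊗[K] g) →ₗ[Kb] (Kb ⊗[K] g)) ≤ cartanBase H Kb := by
      rintro _ ⟨y, hy, rfl⟩
      exact hu y hy
    have := Submodule.eq_of_le_of_finrank_eq hle
      (LinearEquiv.finrank_map_eq u.toLinearEquiv (cartanBase H Kb))
    intro y hy
    rw [← this] at hy
    exact hy
  have key : ∀ β : H.root, ∃ γ : H.root, ∃ c : Kb, u (E.baseX Kb β) = c • E.baseX Kb γ ∧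
      u (baseDual Kb β) = baseDual Kb γ := by
    intro β
    have hut := hu _ (baseDual_mem Kb β)
    have h1 : ∀ y ∈ cartanBase H Kb, ⁅y, u (E.baseX Kb β)⁆ =
        killingForm Kb (Kb ⊗[K] g) y (u (baseDual Kb β)) • u (E.baseX Kb β) := by
      intro y hy
      obtain ⟨y, hy', rfl⟩ := hsurj y hy
      clear hy
      rw [← LieEquiv.map_lie, E.lie_baseX β hy', map_smul, killingForm_of_equiv_apply]
    -- `u (X β)` is a weight vector of weight `u (t_β)`, which is a root as soon as the component
    -- along some root vector does not vanish
    have h2 : ∀ γ, killingForm Kb (Kb ⊗[K] g) (u (E.baseX Kb β)) (E.baseX Kb (negRoot γ)) ≠ 0 →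
        u (baseDual Kb β) = baseDual Kb γ := by
      intro γ hγ
      rw [← sub_eq_zero]
      refine E.eq_zero_of_mem_cartanBase (sub_mem hut (baseDual_mem Kb γ)) fun i ↦ ?_
      have h3 := congrArg (fun z ↦ killingForm Kb (Kb ⊗[K] g) z (E.baseX Kb (negRoot γ)))
        (h1 _ (baseDual_mem Kb i))
      simp only [map_smul, LinearMap.smul_apply, smul_eq_mul] at h3
      rw [killingForm_lie_baseChange, E.lie_baseX _ (baseDual_mem Kb i), map_smul, smul_eq_mul,
        baseDual_negRoot, map_neg, neg_mul, neg_neg] at h3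
      rw [killingForm_comm, map_sub, ← mul_right_cancel₀ hγ h3, sub_self]
    have h4 : u (E.baseX Kb β) = ∑ γ : H.root, killingForm Kb (Kb ⊗[K] g) (u (E.baseX Kb β))
        (E.baseX Kb (negRoot γ)) • E.baseX Kb γ := by
      rw [← sub_eq_zero]
      refine E.eq_zero_of_mem_cartanBase (E.sub_sum_mem_cartanBase Kb _) fun i ↦ ?_
      obtain ⟨y, hy, hy'⟩ := hsurj _ (baseDual_mem Kb (i : H.root))
      rw [← hy', map_sub, LinearMap.sub_apply, killingForm_of_equiv_apply, killingForm_comm,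
        E.killingForm_baseX_left _ hy, hy', killingForm_comm, map_sum, Finset.sum_eq_zero, sub_zero]
      intro γ _
      rw [map_smul, E.killingForm_baseX_left _ (baseDual_mem Kb _), smul_zero]
    have h5 : ∃ γ, killingForm Kb (Kb ⊗[K] g) (u (E.baseX Kb β)) (E.baseX Kb (negRoot γ)) ≠ 0 := by
      by_contra! h
      simp only [h, zero_smul, Finset.sum_const_zero] at h4
      have h6 : E.baseX Kb β = 0 := by simpa using h4
      exact E.X_ne_zero β (baseEmb_injective (K := K) Kb (h6.trans (map_zero _).symm))
    obtain ⟨γ, hγ⟩ := h5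
    refine ⟨γ, killingForm Kb (Kb ⊗[K] g) (u (E.baseX Kb β)) (E.baseX Kb (negRoot γ)), ?_, h2 γ hγ⟩
    conv_lhs => rw [h4]
    rw [Finset.sum_eq_single γ]
    · intro δ _ hδ
      by_contra h0
      have h6 := h2 δ fun h ↦ h0 (by rw [h, zero_smul])
      exact hδ (baseDual_injective Kb (h6.symm.trans (h2 γ hγ)))
    · simp
  choose w c h using key
  exact ⟨w, c, fun β ↦ (h β).1, fun β ↦ (h β).2⟩

namespace ActsByRootPerm

variable {w : H.root → H.root} {c : H.root → Kb} (hu : ActsByRootPerm E Kb u w c)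
include hu

lemma injective : Function.Injective w := fun β γ h ↦ by
  apply baseDual_injective Kb
  refine u.injective ((hu.apply_baseDual β).trans ?_)
  rw [h]
  exact (hu.apply_baseDual γ).symm

/-- `w` is the restriction of a linear map. -/
lemma root_sum {ι : Type*} [Fintype ι] {δ : H.root} (n : ι → ℤ) (f : ι → H.root)
    (h : (rootSystem H).root δ = ∑ i, n i • (rootSystem H).root (f i)) :
    (rootSystem H).root (w δ) = ∑ i, n i • (rootSystem H).root (w (f i)) := by
  have key : ∀ δ' (f' : ι → H.root), baseDual Kb δ' = ∑ i, n i • baseDual Kb (f' i) ↔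
      (rootSystem H).root δ' = ∑ i, n i • (rootSystem H).root (f' i) := by
    intro δ' f'
    have h1 : ∑ i, n i • baseDual Kb (f' i) = baseEmb (K := K) Kb
        (((cartanEquivDual H).symm (∑ i, n i • (rootSystem H).root (f' i)) : H) : g) := by
      rw [map_sum, ← LieSubalgebra.coe_incl, ← LieHom.coe_toLinearMap, map_sum, map_sum]
      refine Finset.sum_congr rfl fun i _ ↦ ?_
      rw [map_zsmul, map_zsmul, map_zsmul]
      rfl
    rw [h1]
    constructor
    · intro h
      exact (cartanEquivDual H).symm.injective (Subtype.ext (baseEmb_injective (K := K) Kb h))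
    · intro h
      rw [← h]
      rfl
  rw [← key] at h ⊢
  rw [← hu.apply_baseDual, h, map_sum]
  refine Finset.sum_congr rfl fun i _ ↦ ?_
  rw [map_zsmul, hu.apply_baseDual]

lemma root_add {β γ δ : H.root}
    (h : (rootSystem H).root δ = (rootSystem H).root β + (rootSystem H).root γ) :
    (rootSystem H).root (w δ) = (rootSystem H).root (w β) + (rootSystem H).root (w γ) := by
  simpa [-rootSystem_root_apply] using hu.root_sum ![1, 1] ![β, γ]
    (by simpa [-rootSystem_root_apply] using h)

lemma apply_negRoot (β : H.root) : w (negRoot β) = negRoot (w β) := by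
  apply baseDual_injective Kb
  rw [← hu.apply_baseDual, baseDual_negRoot, baseDual_negRoot, map_neg, hu.apply_baseDual]

lemma root_rootDual (β γ : H.root) : (rootSystem H).root (w β) (rootDual (w γ)) =
    (rootSystem H).root β (rootDual γ) := by
  apply (algebraMap K Kb).injective
  rw [← killingForm_baseDual, ← killingForm_baseDual, ← hu.apply_baseDual, ← hu.apply_baseDual,
    killingForm_of_equiv_apply]

lemma pairing (β γ : H.root) :
    (rootSystem H).pairing (w β) (w γ) = (rootSystem H).pairing β γ := by
  rw [pairing_eq_root_rootDual, pairing_eq_root_rootDual, hu.root_rootDual, hu.root_rootDual]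

lemma mul_negRoot (β : H.root) : c β * c (negRoot β) = 1 := by
  classical
  have h := killingForm_of_equiv_apply u (E.baseX Kb β) (E.baseX Kb (negRoot β))
  rw [hu.apply_baseX, hu.apply_baseX, hu.apply_negRoot, E.killingForm_baseX_baseX, map_smul,
    map_smul, LinearMap.smul_apply, E.killingForm_baseX_baseX] at h
  simpa [mul_comm] using h

lemma factor_ne_zero (β : H.root) : c β ≠ 0 := left_ne_zero_of_mul_eq_one (hu.mul_negRoot β)

end ActsByRootPerm

end CartanBase

/-! ### Triangular endomorphisms -/

section Triangular

variable {F V ι : Type*} [Field F] [AddCommGroup V] [Module F V] {r : ι → ι → Prop}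
  {f : Module.End F V} {v : ι → V}

/-- A strictly triangular endomorphism is nilpotent. -/
lemma exists_pow_apply_eq_zero (hr : WellFounded r)
    (h : ∀ i, f (v i) ∈ Submodule.span F (v '' {j | r j i})) (i : ι) :
    ∃ n : ℕ, (f ^ n) (v i) = 0 := by
  have key : ∀ x, x ∈ f.maxGenEigenspace 0 ↔ ∃ n : ℕ, (f ^ n) x = 0 := fun x ↦ by
    rw [Module.End.mem_maxGenEigenspace, zero_smul, sub_zero]
  induction i using hr.induction with
  | h i ih =>
    have h1 : f (v i) ∈ f.maxGenEigenspace 0 := by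
      refine Submodule.span_le.2 ?_ (h i)
      rintro _ ⟨j, hj, rfl⟩
      exact (key _).2 (ih j hj)
    obtain ⟨n, hn⟩ := (key _).1 h1
    exact ⟨n + 1, by rwa [pow_succ, Module.End.mul_apply]⟩

/-- A triangular endomorphism with a non-zero constant on the diagonal is surjective. -/
lemma span_le_map_of_triangular (hr : WellFounded r) {ε : F} (hε : ε ≠ 0)
    (h : ∀ i, f (v i) - ε • v i ∈ Submodule.span F (v '' {j | r j i})) :
    Submodule.span F (Set.range v) ≤ (Submodule.span F (Set.range v)).map f := by
  rw [Submodule.span_le]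
  rintro _ ⟨i, rfl⟩
  induction i using hr.induction with
  | h i ih =>
    have h1 : f (v i) - ε • v i ∈ (Submodule.span F (Set.range v)).map f := by
      refine Submodule.span_le.2 ?_ (h i)
      rintro _ ⟨j, hj, rfl⟩
      exact ih j hj
    have h2 : f (v i) ∈ (Submodule.span F (Set.range v)).map f :=
      ⟨_, Submodule.subset_span ⟨i, rfl⟩, rfl⟩
    have h3 := Submodule.smul_mem _ ε⁻¹ (sub_mem h2 h1)
    rwa [sub_sub_cancel, inv_smul_smul₀ hε] at h3

variable {L : Type*} [LieRing L] [LieAlgebra F L]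

/-- If `φ` intertwines `f` with its adjoint `f'` for the Killing form, then the image under `φ` of a
vector killed by a power of `f` is orthogonal to the subspaces on which `f` is surjective. -/
lemma killingForm_eq_zero_of_intertwine {f f' : Module.End F L} {φ : L → L}
    (hadj : ∀ a b, killingForm F L (f' a) b = killingForm F L a (f b))
    (hφ : ∀ a, f' (φ a) = φ (f a)) (hφ0 : φ 0 = 0) {a : L} (ha : ∃ n : ℕ, (f ^ n) a = 0)
    {S : Submodule F L} (hS : S ≤ S.map f) {z : L} (hz : z ∈ S) :
    killingForm F L (φ a) z = 0 := by
  obtain ⟨n, hn⟩ := ha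
  have h1 : ∀ m : ℕ, ∀ z ∈ S, ∃ z' ∈ S, (f ^ m) z' = z := by
    intro m
    induction m with
    | zero => exact fun z hz ↦ ⟨z, hz, rfl⟩
    | succ m ih =>
      intro z hz
      obtain ⟨z', hz', rfl⟩ := hS hz
      obtain ⟨z'', hz'', rfl⟩ := ih z' hz'
      exact ⟨z'', hz'', by rw [pow_succ', Module.End.mul_apply]⟩
  have h2 : ∀ (m : ℕ) (a z : L), killingForm F L ((f' ^ m) a) z =
      killingForm F L a ((f ^ m) z) := by
    intro m
    induction m with
    | zero => simp
    | succ m ih =>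
      intro a z
      rw [pow_succ, Module.End.mul_apply, ih, hadj, pow_succ', Module.End.mul_apply]
  have h3 : ∀ (m : ℕ) (a : L), (f' ^ m) (φ a) = φ ((f ^ m) a) := by
    intro m
    induction m with
    | zero => simp
    | succ m ih =>
      intro a
      rw [pow_succ, Module.End.mul_apply, hφ, ih, pow_succ, Module.End.mul_apply]
  obtain ⟨z', -, rfl⟩ := h1 n z hz
  rw [← h2, h3, hn, hφ0, map_zero, LinearMap.zero_apply]

end Triangular

/-! ### The endomorphism attached to the Belavin–Drinfeld matrix -/

section Flip

variable {K g : Type*} [Field K] [CharZero K] [LieRing g] [LieAlgebra K g]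
  [FiniteDimensional K g] [IsSimple K g]
  {H : LieSubalgebra K g} [H.IsCartanSubalgebra] [IsTriangularizable K H g]
  {b : (rootSystem H).Base} {Q : AdmissibleQuadruple b} (E : Q.RootVectors)
  {Kb : Type*} [Field Kb] [Algebra K Kb]

namespace AdmissibleQuadruple.RootVectors

include E in
/-- An element is determined by its products with the root vectors and the simple `t_i`. -/
lemma ext_killingForm {z z' : Kb ⊗[K] g}
    (h : ∀ β, killingForm Kb (Kb ⊗[K] g) z (E.baseX Kb β) =
      killingForm Kb (Kb ⊗[K] g) z' (E.baseX Kb β))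
    (h' : ∀ i : b.support, killingForm Kb (Kb ⊗[K] g) z (baseDual Kb (i : H.root)) =
      killingForm Kb (Kb ⊗[K] g) z' (baseDual Kb (i : H.root))) : z = z' := by
  rw [← sub_eq_zero]
  refine eq_zero_of_mem_cartanBase E (E.mem_cartanBase fun β ↦ ?_) fun i ↦ ?_
  · rw [map_sub, LinearMap.sub_apply, h, sub_self]
  · rw [map_sub, LinearMap.sub_apply, h', sub_self]

lemma killingForm_contraction_rBD_baseDual (β γ : H.root) :
    killingForm Kb (Kb ⊗[K] g) (contraction (baseChangeTensor Kb (Q.rBD E)) (E.baseX Kb β))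
      (baseDual Kb γ) = 0 := by
  rw [killingForm_contraction, baseX, baseDual, killingEval_baseEmb, killingEval_rBD_X_coe,
    map_zero]

open Classical in
lemma contraction_rBD_of_isPos {β : H.root} (hβ : b.IsPos β) :
    contraction (baseChangeTensor Kb (Q.rBD E)) (E.baseX Kb β) =
      -∑ γ : H.root with Q.Prec γ β, E.baseX Kb γ := by
  refine E.ext_killingForm (fun γ ↦ ?_) fun i ↦ ?_
  · have h1 : (∑ δ : H.root with Q.Prec δ β, killingForm Kb (Kb ⊗[K] g) (E.baseX Kb δ)
        (E.baseX Kb γ)) = if Q.Prec (negRoot γ) β then 1 else 0 := by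
      simp only [E.killingForm_baseX_baseX, eq_comm (a := γ), negRoot_eq_iff, Finset.sum_ite_eq',
        Finset.mem_filter_univ]
    rw [killingForm_contraction, baseX, baseX, killingEval_baseEmb, killingEval_rBD_X_X, map_neg,
      LinearMap.neg_apply, map_sum, LinearMap.sum_apply, ← baseX, h1]
    by_cases h2 : Q.Prec (negRoot γ) β
    · have : ¬ b.IsPos γ := by rw [← isPos_negRoot, ← h2.isPos_iff]; exact hβ
      simp [hβ, h2, this]
    · simp [hβ, h2]
  · rw [E.killingForm_contraction_rBD_baseDual, map_neg, LinearMap.neg_apply, map_sum,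
      LinearMap.sum_apply, Finset.sum_eq_zero, neg_zero]
    intro γ _
    rw [killingForm_comm, E.killingForm_baseX_left _ (baseDual_mem Kb _)]

open Classical in
lemma contraction_rBD_negRoot_of_isPos {β : H.root} (hβ : b.IsPos β) :
    contraction (baseChangeTensor Kb (Q.rBD E)) (E.baseX Kb (negRoot β)) =
      E.baseX Kb (negRoot β) + ∑ γ : H.root with Q.Prec β γ, E.baseX Kb (negRoot γ) := by
  refine E.ext_killingForm (fun γ ↦ ?_) fun i ↦ ?_
  · have h1 : (∑ δ : H.root with Q.Prec β δ, killingForm Kb (Kb ⊗[K] g) (E.baseX Kb (negRoot δ))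
        (E.baseX Kb γ)) = if Q.Prec β γ then 1 else 0 := by
      simp only [E.killingForm_baseX_baseX, negRoot_negRoot, Finset.sum_ite_eq,
        Finset.mem_filter_univ]
    have h3 : ¬ (¬ b.IsPos γ ∧ Q.Prec (negRoot γ) (negRoot β)) := by
      rintro ⟨h4, h5⟩
      rw [prec_negRoot_iff] at h5
      exact h4 (h5.isPos_iff.1 hβ)
    rw [killingForm_contraction, baseX, baseX, killingEval_baseEmb, killingEval_rBD_X_X, if_neg h3,
      map_add (killingForm Kb (Kb ⊗[K] g)), LinearMap.add_apply, map_sum, LinearMap.sum_apply,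
      ← baseX, ← baseX, h1, E.killingForm_baseX_baseX]
    by_cases h2 : Q.Prec β γ <;> by_cases h6 : γ = β <;> simp [hβ, h2, h6]
  · rw [E.killingForm_contraction_rBD_baseDual, map_add, LinearMap.add_apply, map_sum,
      LinearMap.sum_apply, killingForm_comm, E.killingForm_baseX_left _ (baseDual_mem Kb _),
      Finset.sum_eq_zero, add_zero]
    intro γ _
    rw [killingForm_comm, E.killingForm_baseX_left _ (baseDual_mem Kb _)]

/-- An element of a Borel subalgebra of `Kb ⊗ g` that is ad-nilpotent has no component in the Cartan
subalgebra. The Borel subalgebra is spanned by the Cartan subalgebra and the root spaces on which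
the additive function `ht` is negative; taking the height or its negative for `ht`, both standard
Borel subalgebras are covered. -/
lemma killingForm_baseDual_eq_zero_of_isNilpotent {ht : H.root → ℤ}
    (hadd : ∀ β γ δ, (rootSystem H).root δ = (rootSystem H).root β + (rootSystem H).root γ →
      ht δ = ht β + ht γ) (hneg : ∀ β, ht (negRoot β) = - ht β) (h0 : ∀ β, ht β ≠ 0)
    {y : Kb ⊗[K] g} (hy : ∀ δ, ht δ < 0 → killingForm Kb (Kb ⊗[K] g) y (E.baseX Kb δ) = 0)
    (hnil : IsNilpotent (ad Kb (Kb ⊗[K] g) y)) {β : H.root} (hβ : ht β = 1) :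
    killingForm Kb (Kb ⊗[K] g) y (baseDual Kb β) = 0 := by
  classical
  set N : Submodule Kb (Kb ⊗[K] g) :=
    Submodule.span Kb (E.baseX Kb '' {δ | ht δ < 0}) with hN
  -- `β` is simple for `ht`, so brackets of elements of `N` have no component along `X (-β)`; hence
  -- on `N`, this component is an eigenfunctional of `ad y`, whose eigenvalue has to vanish
  have key : ∀ z ∈ N, ⁅y, z⁆ ∈ N ∧ killingForm Kb (Kb ⊗[K] g) ⁅y, z⁆ (E.baseX Kb β) =
      -killingForm Kb (Kb ⊗[K] g) y (baseDual Kb β) *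
        killingForm Kb (Kb ⊗[K] g) z (E.baseX Kb β) := by
    set P : Kb ⊗[K] g → Kb ⊗[K] g → Prop := fun y z ↦ ⁅y, z⁆ ∈ N ∧
      killingForm Kb (Kb ⊗[K] g) ⁅y, z⁆ (E.baseX Kb β) =
      -killingForm Kb (Kb ⊗[K] g) y (baseDual Kb β) *
        killingForm Kb (Kb ⊗[K] g) z (E.baseX Kb β) with hP
    have P_add : ∀ y y' z, P y z → P y' z → P (y + y') z := fun y y' z h h' ↦
      ⟨by rw [add_lie]; exact add_mem h.1 h'.1, by
        rw [add_lie, map_add, LinearMap.add_apply, h.2, h'.2, map_add, LinearMap.add_apply]; ring⟩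
    have P_smul : ∀ (c : Kb) y z, P y z → P (c • y) z := fun c y z h ↦
      ⟨by rw [smul_lie]; exact Submodule.smul_mem _ _ h.1, by
        rw [smul_lie, map_smul, LinearMap.smul_apply, h.2, map_smul, LinearMap.smul_apply,
          smul_eq_mul, smul_eq_mul]; ring⟩
    have P_cartan : ∀ y ∈ cartanBase H Kb, ∀ δ, ht δ < 0 → P y (E.baseX Kb δ) := by
      intro y hy δ hδ
      refine ⟨?_, ?_⟩
      · rw [E.lie_baseX δ hy]
        exact Submodule.smul_mem _ _ (Submodule.subset_span ⟨δ, hδ, rfl⟩)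
      · rw [killingForm_lie_baseChange, E.lie_baseX β hy, map_smul, smul_eq_mul]
        ring
    have P_root : ∀ γ δ, ht γ < 0 → ht δ < 0 → P (E.baseX Kb γ) (E.baseX Kb δ) := by
      intro γ δ hγ hδ
      have h1 : killingForm Kb (Kb ⊗[K] g) (E.baseX Kb γ) (baseDual Kb β) = 0 := by
        rw [killingForm_comm, E.killingForm_baseX_left _ (baseDual_mem Kb _)]
      by_cases h2 : ∃ ε, (rootSystem H).root ε = (rootSystem H).root γ + (rootSystem H).root δ
      · obtain ⟨ε, hε⟩ := h2
        obtain ⟨c, -, hc⟩ := E.lie_X_X hε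
        have hε' := hadd _ _ _ hε
        have h3 : ⁅E.baseX Kb γ, E.baseX Kb δ⁆ = algebraMap K Kb c • E.baseX Kb ε := by
          rw [baseX, baseX, lie_baseEmb, hc, baseEmb_smul]
          rfl
        refine ⟨?_, ?_⟩
        · rw [h3]
          exact Submodule.smul_mem _ _ (Submodule.subset_span ⟨ε, by simp; lia, rfl⟩)
        · have h4 : β ≠ negRoot ε := by
            rintro rfl
            have := hneg ε
            lia
          rw [h3, h1, map_smul, LinearMap.smul_apply, E.killingForm_baseX_baseX, if_neg h4,
            smul_zero, neg_zero, zero_mul]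
      · have h4 : δ ≠ negRoot γ := by
          rintro rfl
          have := hneg γ
          lia
        push Not at h2
        have h3 : ⁅E.baseX Kb γ, E.baseX Kb δ⁆ = 0 := by
          rw [baseX, baseX, lie_baseEmb, E.lie_X_X_eq_zero h4 h2, map_zero]
        refine ⟨?_, ?_⟩
        · rw [h3]; exact zero_mem _
        · rw [h3, h1, map_zero, LinearMap.zero_apply, neg_zero, zero_mul]
    intro z hz
    induction hz using Submodule.span_induction with
    | zero => simp
    | add z z' _ _ hz hz' =>
      exact ⟨by rw [lie_add]; exact add_mem hz.1 hz'.1, by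
        rw [lie_add, map_add, LinearMap.add_apply, hz.2, hz'.2, map_add, LinearMap.add_apply]; ring⟩
    | smul c z _ hz =>
      exact ⟨by rw [lie_smul]; exact Submodule.smul_mem _ _ hz.1, by
        rw [lie_smul, map_smul, LinearMap.smul_apply, hz.2, map_smul, LinearMap.smul_apply,
          smul_eq_mul, smul_eq_mul]; ring⟩
    | mem z hz =>
      obtain ⟨δ, hδ, rfl⟩ := hz
      have h1 := sub_add_cancel y (∑ γ : H.root,
        killingForm Kb (Kb ⊗[K] g) y (E.baseX Kb (negRoot γ)) • E.baseX Kb γ)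
      change P y (E.baseX Kb δ)
      rw [← h1]
      refine P_add _ _ _ (P_cartan _ (E.sub_sum_mem_cartanBase Kb y) δ hδ) ?_
      refine Finset.sum_induction _ (fun y ↦ P y (E.baseX Kb δ)) (fun y y' ↦ P_add y y' _) ?_ ?_
      · simp [hP]
      · intro γ _
        rcases (h0 γ).lt_or_gt with hγ | hγ
        · exact P_smul _ _ _ (P_root γ δ hγ hδ)
        · rw [hy _ (by rw [hneg]; lia), zero_smul]
          simp [hP]
  obtain ⟨n, hn⟩ := hnil
  have h1 : ∀ m : ℕ, ((ad Kb (Kb ⊗[K] g) y) ^ m) (E.baseX Kb (negRoot β)) ∈ N ∧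
      killingForm Kb (Kb ⊗[K] g) (((ad Kb (Kb ⊗[K] g) y) ^ m) (E.baseX Kb (negRoot β)))
        (E.baseX Kb β) = (-killingForm Kb (Kb ⊗[K] g) y (baseDual Kb β)) ^ m := by
    intro m
    induction m with
    | zero =>
      refine ⟨Submodule.subset_span ⟨_, ?_, rfl⟩, ?_⟩
      · have := hneg β
        simp; lia
      · rw [pow_zero, pow_zero, Module.End.one_apply, E.killingForm_baseX_baseX, negRoot_negRoot,
          if_pos rfl]
    | succ m ih =>
      rw [pow_succ', Module.End.mul_apply, ad_apply, pow_succ']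
      exact ⟨(key _ ih.1).1, by rw [(key _ ih.1).2, ih.2]⟩
  have h2 := (h1 n).2
  rw [hn, LinearMap.zero_apply, map_zero, LinearMap.zero_apply, eq_comm] at h2
  simpa only [neg_eq_zero] using eq_zero_of_pow_eq_zero h2

lemma isNilpotent_ad_baseX (β : H.root) : IsNilpotent (ad Kb (Kb ⊗[K] g) (E.baseX Kb β)) := by
  have h : ad Kb (Kb ⊗[K] g) (E.baseX Kb β) = (ad K g (E.X β)).baseChange Kb := by
    apply TensorProduct.AlgebraTensorModule.ext
    intro c x
    rw [ad_apply, baseX, baseEmb_apply, LieAlgebra.ExtendScalars.bracket_tmul, one_mul,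
      LinearMap.baseChange_tmul, ad_apply]
  rw [h]
  obtain ⟨n, hn⟩ := E.isNilpotent_ad_X β
  exact ⟨n, by rw [← LinearMap.baseChange_pow, hn, LinearMap.baseChange_zero]⟩

end AdmissibleQuadruple.RootVectors

end Flip

open AdmissibleQuadruple

section Necessity

variable {K g : Type*} [Field K] [CharZero K] [LieRing g] [LieAlgebra K g]
  [FiniteDimensional K g] [IsSimple K g]
  {H : LieSubalgebra K g} [H.IsCartanSubalgebra] [IsTriangularizable K H g]
  {b : (rootSystem H).Base} {Q : AdmissibleQuadruple b} {E : Q.RootVectors}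
  {Kb : Type*} [Field Kb] [Algebra K Kb]
  {φ : (Kb ⊗[K] g) ≃ₗ⁅Kb⁆ (Kb ⊗[K] g)}

/-! ### Automorphisms that flip the matrix preserve the Cartan subalgebra -/

/-- `φ` maps the positive root spaces to the negative Borel subalgebra. -/
lemma killingForm_apply_baseX_of_isPos
    (hφ : tensorSq φ (baseChangeTensor Kb (Q.rBD E)) = flip (baseChangeTensor Kb (Q.rBD E)))
    {β γ : H.root} (hβ : b.IsPos β) (hγ : ¬ b.IsPos γ) :
    killingForm Kb (Kb ⊗[K] g) (φ (E.baseX Kb β)) (E.baseX Kb γ) = 0 := by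
  classical
  set T := baseChangeTensor Kb (Q.rBD E) with hT
  have hadj : ∀ a c, killingForm Kb (Kb ⊗[K] g) (contraction (flip T) a) c =
      killingForm Kb (Kb ⊗[K] g) a (contraction T c) := fun a c ↦ by
    rw [killingForm_contraction, killingEval_flip, killingForm_comm a, killingForm_contraction]
  have hint : ∀ a, contraction (flip T) (φ a) = φ (contraction T a) := fun a ↦ by
    rw [← hφ, contraction_tensorSq]
  have hn : ∃ n : ℕ, (contraction T ^ n) (E.baseX Kb β) = 0 := by
    refine exists_pow_apply_eq_zero (ι := {β : H.root // b.IsPos β})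
      (r := fun γ β ↦ Q.Prec γ β) (v := fun β ↦ E.baseX Kb β)
      (InvImage.wf _ prec_wellFounded) (fun β ↦ ?_) ⟨β, hβ⟩
    rw [hT, E.contraction_rBD_of_isPos β.2]
    refine neg_mem (sum_mem fun γ hγ ↦ Submodule.subset_span ?_)
    rw [Finset.mem_filter_univ] at hγ
    exact ⟨⟨γ, hγ.isPos_iff.1 β.2⟩, hγ, rfl⟩
  refine killingForm_eq_zero_of_intertwine hadj hint (map_zero φ) hn
    (span_le_map_of_triangular (ι := {β : H.root // b.IsPos β})
      (r := fun γ β ↦ Q.Prec β γ) (v := fun β ↦ E.baseX Kb (negRoot β))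
      (InvImage.wf _ prec_swap_wellFounded) one_ne_zero fun β ↦ ?_)
    (Submodule.subset_span ⟨⟨negRoot γ, (isPos_negRoot γ).2 hγ⟩, by simp⟩)
  rw [hT, E.contraction_rBD_negRoot_of_isPos β.2, one_smul, add_sub_cancel_left]
  refine sum_mem fun γ hγ ↦ Submodule.subset_span ?_
  rw [Finset.mem_filter_univ] at hγ
  exact ⟨⟨γ, hγ.isPos_iff.2 β.2⟩, hγ, rfl⟩

/-- `φ` maps the negative root spaces to the positive Borel subalgebra. Here the endomorphism minus
the identity is used, which is nilpotent on the negative root spaces and invertible on the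
positive ones. -/
lemma killingForm_apply_baseX_of_not_isPos
    (hφ : tensorSq φ (baseChangeTensor Kb (Q.rBD E)) = flip (baseChangeTensor Kb (Q.rBD E)))
    {β γ : H.root} (hβ : ¬ b.IsPos β) (hγ : b.IsPos γ) :
    killingForm Kb (Kb ⊗[K] g) (φ (E.baseX Kb β)) (E.baseX Kb γ) = 0 := by
  classical
  set T := baseChangeTensor Kb (Q.rBD E) with hT
  have hadj : ∀ a c, killingForm Kb (Kb ⊗[K] g) ((contraction (flip T) - 1) a) c =
      killingForm Kb (Kb ⊗[K] g) a ((contraction T - 1) c) := fun a c ↦ by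
    rw [LinearMap.sub_apply, LinearMap.sub_apply, map_sub, map_sub, LinearMap.sub_apply,
      killingForm_contraction, killingEval_flip, killingForm_comm a, killingForm_contraction]
    rfl
  have hint : ∀ a, (contraction (flip T) - 1) (φ a) = φ ((contraction T - 1) a) := fun a ↦ by
    rw [LinearMap.sub_apply, LinearMap.sub_apply, map_sub, ← hφ, contraction_tensorSq]
    rfl
  have hn : ∃ n : ℕ, ((contraction T - 1) ^ n) (E.baseX Kb β) = 0 := by
    have h1 := exists_pow_apply_eq_zero (ι := {β : H.root // b.IsPos β}) (f := contraction T - 1)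
      (r := fun γ β ↦ Q.Prec β γ) (v := fun β ↦ E.baseX Kb (negRoot β))
      (InvImage.wf _ prec_swap_wellFounded) (fun β ↦ ?_) ⟨negRoot β, (isPos_negRoot β).2 hβ⟩
    · simpa only [negRoot_negRoot] using h1
    rw [hT, LinearMap.sub_apply, E.contraction_rBD_negRoot_of_isPos β.2, Module.End.one_apply,
      add_sub_cancel_left]
    refine sum_mem fun γ hγ ↦ Submodule.subset_span ?_
    rw [Finset.mem_filter_univ] at hγ
    exact ⟨⟨γ, hγ.isPos_iff.2 β.2⟩, hγ, rfl⟩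
  refine killingForm_eq_zero_of_intertwine hadj hint (map_zero φ) hn
    (span_le_map_of_triangular (ι := {β : H.root // b.IsPos β}) (ε := -1)
      (r := fun γ β ↦ Q.Prec γ β) (v := fun β ↦ E.baseX Kb β)
      (InvImage.wf _ prec_wellFounded) (neg_ne_zero.2 one_ne_zero) fun β ↦ ?_)
    (Submodule.subset_span ⟨⟨γ, hγ⟩, rfl⟩)
  rw [hT, LinearMap.sub_apply, E.contraction_rBD_of_isPos β.2, Module.End.one_apply, neg_one_smul,
    sub_neg_eq_add, sub_add_cancel]
  refine neg_mem (sum_mem fun γ hγ ↦ Submodule.subset_span ?_)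
  rw [Finset.mem_filter_univ] at hγ
  exact ⟨⟨γ, hγ.isPos_iff.1 β.2⟩, hγ, rfl⟩

omit [CharZero K] [FiniteDimensional K g] [IsSimple K g] in
lemma isNilpotent_ad_apply (φ : (Kb ⊗[K] g) ≃ₗ⁅Kb⁆ (Kb ⊗[K] g)) {x : Kb ⊗[K] g}
    (h : IsNilpotent (ad Kb (Kb ⊗[K] g) x)) : IsNilpotent (ad Kb (Kb ⊗[K] g) (φ x)) := by
  obtain ⟨n, hn⟩ := h
  refine ⟨n, LinearMap.ext fun z ↦ ?_⟩
  have h1 : ∀ m : ℕ, ∀ z, ((ad Kb (Kb ⊗[K] g) (φ x)) ^ m) (φ z) =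
      φ (((ad Kb (Kb ⊗[K] g) x) ^ m) z) := by
    intro m
    induction m with
    | zero => simp
    | succ m ih =>
      intro z
      rw [pow_succ, Module.End.mul_apply, ad_apply, ← LieEquiv.map_lie, ih, pow_succ,
        Module.End.mul_apply, ad_apply]
  obtain ⟨z, rfl⟩ := φ.surjective z
  refine (h1 n z).trans ?_
  rw [hn]
  simp

lemma killingForm_apply_baseX_baseDual
    (hφ : tensorSq φ (baseChangeTensor Kb (Q.rBD E)) = flip (baseChangeTensor Kb (Q.rBD E)))
    (β : H.root) (i : b.support) :
    killingForm Kb (Kb ⊗[K] g) (φ (E.baseX Kb β)) (baseDual Kb (i : H.root)) = 0 := by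
  have hnil := isNilpotent_ad_apply φ (E.isNilpotent_ad_baseX (Kb := Kb) β)
  have hi := b.height_one_of_mem_support i.2
  by_cases hβ : b.IsPos β
  · exact E.killingForm_baseDual_eq_zero_of_isNilpotent (ht := b.height)
      (fun β γ δ h ↦ b.height_add h) height_negRoot b.height_ne_zero
      (fun δ hδ ↦ killingForm_apply_baseX_of_isPos hφ hβ hδ.not_gt) hnil hi
  · have h := E.killingForm_baseDual_eq_zero_of_isNilpotent (ht := fun β ↦ -b.height β)
      (fun β γ δ h ↦ by rw [b.height_add h]; ring) (fun β ↦ by rw [height_negRoot])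
      (fun β ↦ neg_ne_zero.2 (b.height_ne_zero β))
      (fun δ hδ ↦ killingForm_apply_baseX_of_not_isPos hφ hβ (neg_lt_zero.1 hδ)) hnil
      (β := negRoot i) (by rw [height_negRoot, hi, neg_neg])
    rwa [baseDual_negRoot, map_neg, neg_eq_zero] at h

omit [CharZero K] [FiniteDimensional K g] [IsSimple K g] in
lemma tensorSq_symm_eq_flip {T : (Kb ⊗[K] g) ⊗[Kb] (Kb ⊗[K] g)} (hφ : tensorSq φ T = flip T) :
    tensorSq φ.symm T = flip T := by
  have h1 : ∀ T, tensorSq φ.symm (tensorSq φ T) = T := fun T ↦ by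
    induction T with
    | zero => simp
    | tmul x y => simp
    | add x y hx hy => rw [map_add, map_add, hx, hy]
  have h2 : ∀ T, tensorSq φ.symm (flip T) = flip (tensorSq φ.symm T) := fun T ↦ by
    induction T with
    | zero => simp
    | tmul x y => simp
    | add x y hx hy => simp only [map_add, hx, hy]
  have h3 : ∀ T : (Kb ⊗[K] g) ⊗[Kb] (Kb ⊗[K] g), flip (flip T) = T := fun T ↦ by
    induction T with
    | zero => simp
    | tmul x y => simp
    | add x y hx hy => simp only [map_add, hx, hy]
  have h4 : flip (tensorSq φ.symm T) = T := by rw [← h2, ← hφ, h1]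
  rw [← h3 (tensorSq φ.symm T), h4]

lemma apply_mem_cartanBase
    (hφ : tensorSq φ (baseChangeTensor Kb (Q.rBD E)) = flip (baseChangeTensor Kb (Q.rBD E)))
    {y : Kb ⊗[K] g} (hy : y ∈ cartanBase H Kb) : φ y ∈ cartanBase H Kb := by
  have h1 : ∀ i : b.support, φ (baseDual Kb (i : H.root)) ∈ cartanBase H Kb := fun i ↦ by
    refine E.mem_cartanBase fun β ↦ ?_
    have := killingForm_apply_baseX_baseDual (tensorSq_symm_eq_flip hφ) β i
    rw [← killingForm_of_equiv_apply φ, LieEquiv.apply_symm_apply] at this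
    rw [killingForm_comm, this]
  have h2 : ∀ h : H, φ (baseEmb Kb (h : g)) ∈ cartanBase H Kb := by
    intro h
    have hh : h ∈ Submodule.span K (Set.range fun i : b.support ↦ rootDual (H := H) i) := by
      rw [span_rootDual]; trivial
    induction hh using Submodule.span_induction with
    | mem h hh => obtain ⟨i, rfl⟩ := hh; exact h1 i
    | zero => simp
    | add x y _ _ hx hy =>
      have := add_mem hx hy
      rwa [← map_add, ← map_add] at this
    | smul c x _ hx =>
      have := Submodule.smul_mem _ (algebraMap K Kb c) hx
      rwa [← map_smul, ← baseEmb_smul] at this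
  induction hy using Submodule.span_induction with
  | mem y hy => obtain ⟨h, rfl⟩ := hy; exact h2 h
  | zero => simp
  | add x y _ _ hx hy => rw [map_add]; exact add_mem hx hy
  | smul c x _ hx => rw [map_smul]; exact Submodule.smul_mem _ _ hx

/-! ### The diagram automorphism -/

namespace ActsByRootPerm

variable {w : H.root → H.root} {c : H.root → Kb} (hu : ActsByRootPerm E Kb φ w c)
include hu

/-- `-w` does not decrease the height, since it maps simple roots to positive roots. -/
lemma height_le (hpos : ∀ β, b.IsPos β → ¬ b.IsPos (w β)) {β : H.root} (hβ : b.IsPos β) :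
    b.height β ≤ -b.height (w β) := by
  obtain ⟨n, hn⟩ := exists_nat_coeff hβ
  have hn' : (rootSystem H).root β = ∑ i : b.support, (n i : ℤ) • (rootSystem H).root i := by
    simpa only [natCast_zsmul] using hn
  have h1 := hu.root_sum (fun i : b.support ↦ (n i : ℤ)) (fun i ↦ (i : H.root)) hn'
  have h2 : ∀ (δ : H.root) (f : b.support → H.root),
      (rootSystem H).root δ = ∑ i, (n i : ℤ) • (rootSystem H).root (f i) →
      b.height δ = ∑ i, (n i : ℤ) * b.height (f i) := by
    intro δ f h
    have := congrArg (heightForm b) h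
    rw [map_sum, heightForm_root] at this
    simp only [map_zsmul, heightForm_root, zsmul_eq_mul] at this
    exact_mod_cast this
  rw [h2 _ _ hn', h2 _ _ h1, ← Finset.sum_neg_distrib]
  refine Finset.sum_le_sum fun i _ ↦ ?_
  rw [← mul_neg]
  refine mul_le_mul_of_nonneg_left ?_ (by positivity)
  have h3 := hpos _ (b.isPos_of_mem_support i.2)
  have h4 := b.height_ne_zero (w i)
  rw [b.height_one_of_mem_support i.2]
  rw [RootPairing.Base.isPos_iff] at h3
  lia

/-- If `w` exchanges the positive and the negative roots, then `-w` permutes the simple roots. -/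
lemma exists_perm (hpos : ∀ β, b.IsPos β → ¬ b.IsPos (w β)) :
    ∃ π : Equiv.Perm b.support, ∀ i : b.support, w i = negRoot (π i) := by
  have hsurj : Function.Surjective w := Finite.surjective_of_injective hu.injective
  have key : ∀ j : b.support, ∃ i : b.support, w i = negRoot j := by
    intro j
    obtain ⟨β, hβ⟩ := hsurj (negRoot j)
    have hβ' : b.IsPos β := by
      by_contra h
      have h1 := hpos (negRoot β) ((isPos_negRoot β).2 h)
      rw [hu.apply_negRoot, hβ, negRoot_negRoot] at h1
      exact h1 (b.isPos_of_mem_support j.2)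
    have h1 := hu.height_le hpos hβ'
    rw [hβ, height_negRoot, b.height_one_of_mem_support j.2, neg_neg] at h1
    have h2 : 0 < b.height β := hβ'
    obtain ⟨i, rfl⟩ := eq_simple_of_height_eq_one (show b.height β = 1 by lia)
    exact ⟨i, hβ⟩
  choose ρ hρ using key
  have hinj : Function.Injective ρ := fun j j' h ↦ by
    have := (hρ j).symm.trans ((congrArg (fun i : b.support ↦ w i) h).trans (hρ j'))
    exact Subtype.ext (negRoot_injective this)
  refine ⟨(Equiv.ofBijective ρ (Finite.injective_iff_bijective.1 hinj)).symm, fun i ↦ ?_⟩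
  obtain ⟨j, rfl⟩ := (Finite.injective_iff_bijective.1 hinj).2 i
  rw [hρ]
  congr 2
  exact (Equiv.ofBijective_symm_apply_apply ρ _ j).symm

end ActsByRootPerm

/-- The diagram automorphism `π` reverses the quadruple `Q`: it reverses the arrows `i → τ i` and
exchanges the two tensor factors of `r_h`. -/
structure AdmissibleQuadruple.IsReversedBy (Q : AdmissibleQuadruple b) (π : Equiv.Perm b.support) :
    Prop where
  isDiagramAut : IsDiagramAut b π
  step : ∀ {i j}, Q.Step i j → Q.Step (π j) (π i)
  dualEval_rh : ∀ i j : b.support,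
    dualEval ((rootSystem H).root (π j)) ((rootSystem H).root (π i)) Q.rh =
      dualEval ((rootSystem H).root i) ((rootSystem H).root j) Q.rh

lemma pairing_coe_eq_cartanMatrix (i j : b.support) :
    (rootSystem H).pairing i j = (b.cartanMatrix i j : K) :=
  ((rootSystem H).algebraMap_pairingIn ℤ i j).symm

variable [CharZero Kb]

/-- An automorphism of `Kb ⊗ g` that exchanges the tensor factors of the Belavin–Drinfeld matrix
acts on the simple roots by the negative of a diagram automorphism that reverses `Q`. -/
theorem exists_isReversedBy
    (hφ : tensorSq φ (baseChangeTensor Kb (Q.rBD E)) = flip (baseChangeTensor Kb (Q.rBD E))) :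
    ∃ π, Q.IsReversedBy π := by
  classical
  obtain ⟨w, c, hu⟩ := exists_actsByRootPerm (E := E) fun y hy ↦ apply_mem_cartanBase hφ hy
  have hpos : ∀ β, b.IsPos β → ¬ b.IsPos (w β) := by
    intro β hβ h
    have h1 := killingForm_apply_baseX_of_isPos hφ hβ (γ := negRoot (w β)) (by simpa using h)
    rw [hu.apply_baseX, map_smul, LinearMap.smul_apply, E.killingForm_baseX_baseX, if_pos rfl,
      smul_eq_mul, mul_one] at h1
    exact hu.factor_ne_zero β h1
  obtain ⟨π, hπ⟩ := hu.exists_perm hpos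
  have hflip : ∀ x y, killingEval (φ y) (φ x) (baseChangeTensor Kb (Q.rBD E)) =
      killingEval x y (baseChangeTensor Kb (Q.rBD E)) := fun x y ↦ by
    rw [← killingEval_flip, ← hφ, killingEval_tensorSq]
  -- the pairing of the matrix with `X (-i) ⊗ X j` tells whether `j` is reached from `i` along `τ`
  have hprec : ∀ i j : b.support, i ≠ j → (Relation.TransGen Q.Step i j ↔
      Relation.TransGen Q.Step (π j) (π i)) := by
    intro i j hij
    have h0 : ∀ i j : b.support, i ≠ j → killingEval (E.X (negRoot i)) (E.X j) (Q.rBD E) =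
        if Relation.TransGen Q.Step i j then 1 else 0 := by
      intro i j hij
      have h1 : (j : H.root) ≠ i := fun h ↦ hij (Subtype.ext h.symm)
      have h2 : b.IsPos j := b.isPos_of_mem_support j.2
      have h3 : b.IsPos i := b.isPos_of_mem_support i.2
      rw [killingEval_rBD_X_X]
      simp [h1, h2, h3, prec_simple_iff]
    have h1 := hflip (E.baseX Kb (negRoot i)) (E.baseX Kb j)
    rw [hu.apply_baseX, hu.apply_baseX, hu.apply_negRoot, hπ, hπ, negRoot_negRoot,
      ← killingForm_contraction, map_smul, map_smul, map_smul, LinearMap.smul_apply,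
      killingForm_contraction] at h1
    simp only [AdmissibleQuadruple.RootVectors.baseX] at h1
    rw [killingEval_baseEmb, killingEval_baseEmb, h0 i j hij,
      h0 _ _ (fun h ↦ hij (π.injective h.symm))] at h1
    have h2 := hu.factor_ne_zero j
    have h3 := hu.factor_ne_zero (negRoot i)
    by_cases h4 : Relation.TransGen Q.Step i j <;>
      by_cases h5 : Relation.TransGen Q.Step (π j) (π i) <;> simp_all
  have hprec' : ∀ i j : b.support, Relation.TransGen Q.Step i j ↔
      Relation.TransGen Q.Step (π j) (π i) := by
    intro i j
    by_cases hij : i = j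
    · subst hij
      exact iff_of_false (not_transGen_step_self _) (not_transGen_step_self _)
    · exact hprec i j hij
  refine ⟨π, ⟨fun i j ↦ ?_, fun {i j} h ↦ ?_, fun i j ↦ ?_⟩⟩
  · apply Int.cast_injective (α := K)
    have h1 := hu.pairing i j
    rw [hπ, hπ, negRoot_eq_reflectionPerm, negRoot_eq_reflectionPerm,
      RootPairing.pairing_reflectionPerm_self_left, RootPairing.pairing_reflectionPerm_self_right,
      neg_neg] at h1
    rw [← pairing_coe_eq_cartanMatrix, ← pairing_coe_eq_cartanMatrix, h1]
  · rw [step_iff] at h ⊢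
    refine ⟨(hprec' i j).1 h.1, fun k h1 h2 ↦ ?_⟩
    obtain ⟨k, rfl⟩ := π.surjective k
    exact h.2 k ((hprec' _ _).2 h2) ((hprec' _ _).2 h1)
  · have h1 := hflip (baseDual Kb (i : H.root)) (baseDual Kb (j : H.root))
    rw [hu.apply_baseDual, hu.apply_baseDual, hπ, hπ, baseDual, baseDual, baseDual, baseDual,
      killingEval_baseEmb, killingEval_baseEmb, killingEval_rBD_coe_coe, killingEval_rBD_coe_coe,
      killingEval_cartanTensor, killingEval_cartanTensor] at h1
    rw [← (algebraMap K Kb).injective h1, root_negRoot, root_negRoot, dualEval_neg_neg]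

end Necessity

/-! ### Orbits of a diagram automorphism -/

section PosDef

variable {V : Type*} [AddCommGroup V]

/-- The positive definite form `F` is evaluated on `p ρ - k s`, where `s = ∑ a t` and where `ρ` and
`s` have the constant pairings `k` and `p` with the coroots of the `m` vectors `a t`. The value is
`p (2 p - k ∑ k' t) / 2` times `F ρ ρ`, with `k' t ≥ 1`. -/
lemma eq_or_lt_of_posDef {F : V →ₗ[ℤ] V →ₗ[ℤ] ℤ} (hsymm : ∀ x y, F x y = F y x)
    (hpos : ∀ x, x ≠ 0 → 0 < F x x) {ρ : V} (hρ : ρ ≠ 0) {m : ℕ} (a : ℕ → V) {k p : ℤ} (k' : ℕ → ℤ)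
    (hk : 0 < k) (hp : 0 < p)
    (h1 : ∀ t < m, 2 * F ρ (a t) = k * F (a t) (a t))
    (h2 : ∀ t < m, 2 * F (a t) ρ = k' t * F ρ ρ) (hk' : ∀ t < m, 1 ≤ k' t)
    (h3 : ∀ u < m, 2 * F (∑ t ∈ Finset.range m, a t) (a u) = p * F (a u) (a u)) :
    p • ρ = k • ∑ t ∈ Finset.range m, a t ∧ k * m ≤ 2 * p ∨ k * m < 2 * p := by
  set s := ∑ t ∈ Finset.range m, a t with hs
  set A := ∑ t ∈ Finset.range m, F (a t) (a t) with hA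
  set S := ∑ t ∈ Finset.range m, k' t with hS
  have e1 : 2 * F ρ s = k * A := by
    rw [hs, map_sum, Finset.mul_sum, hA, Finset.mul_sum]
    exact Finset.sum_congr rfl fun t ht ↦ h1 t (Finset.mem_range.1 ht)
  have e2 : 2 * F ρ s = S * F ρ ρ := by
    rw [hs, map_sum, Finset.mul_sum, hS, Finset.sum_mul]
    exact Finset.sum_congr rfl fun t ht ↦ by rw [hsymm, h2 t (Finset.mem_range.1 ht)]
  have e3 : 2 * F s s = p * A := by
    conv_lhs => rw [hs, map_sum, ← hs]
    rw [Finset.mul_sum, hA, Finset.mul_sum]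
    exact Finset.sum_congr rfl fun t ht ↦ h3 t (Finset.mem_range.1 ht)
  have hR := hpos ρ hρ
  have hmS : (m : ℤ) ≤ S := by
    have := Finset.sum_le_sum (s := Finset.range m) (f := fun _ ↦ (1 : ℤ)) (g := k')
      fun t ht ↦ hk' t (Finset.mem_range.1 ht)
    simpa using this
  have hkm : k * m ≤ k * S := mul_le_mul_of_nonneg_left hmS hk.le
  have hN : 2 * F (p • ρ - k • s) (p • ρ - k • s) = p * F ρ ρ * (2 * p - k * S) := by
    simp only [map_sub, map_smul, LinearMap.sub_apply, LinearMap.smul_apply, smul_eq_mul,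
      hsymm s ρ]
    linear_combination (-2 * p * k) * e2 + k ^ 2 * e3 + k * p * (e2 - e1)
  by_cases hz : p • ρ - k • s = 0
  · left
    rw [hz] at hN
    simp only [map_zero, mul_zero] at hN
    have h4 : 2 * p - k * S = 0 := by
      rcases mul_eq_zero.1 hN.symm with h | h
      · rcases mul_eq_zero.1 h with h | h <;> lia
      · exact h
    exact ⟨sub_eq_zero.1 hz, by lia⟩
  · right
    have h4 := hpos _ hz
    have h5 : 0 < p * F ρ ρ * (2 * p - k * S) := by lia
    have h6 : 0 < 2 * p - k * S := pos_of_mul_pos_right h5 (by positivity)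
    lia

end PosDef

section Orbits

variable {K g : Type*} [Field K] [CharZero K] [LieRing g] [LieAlgebra K g]
  [FiniteDimensional K g] [IsSimple K g]
  {H : LieSubalgebra K g} [H.IsCartanSubalgebra] [IsTriangularizable K H g]
  {b : (rootSystem H).Base}

lemma coe_pairingIn (β γ : H.root) : (((rootSystem H).pairingIn ℤ β γ : ℤ) : K) =
    (rootSystem H).root β ((rootSystem H).coroot γ) :=
  (rootSystem H).algebraMap_pairingIn ℤ β γ

lemma pairingIn_sum {ι : Type*} (S : Finset ι) {β : H.root} (n : ι → ℤ) (f : ι → H.root)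
    (h : (rootSystem H).root β = ∑ i ∈ S, n i • (rootSystem H).root (f i)) (γ : H.root) :
    (rootSystem H).pairingIn ℤ β γ = ∑ i ∈ S, n i * (rootSystem H).pairingIn ℤ (f i) γ := by
  apply Int.cast_injective (α := K)
  push_cast
  simp only [coe_pairingIn]
  rw [h, LinearMap.sum_apply]
  simp [-rootSystem_root_apply]

/-- A root of maximal height pairs non-negatively with the simple coroots. -/
lemma pairingIn_nonneg_of_height_max {θ : H.root} (hθ : ∀ δ : H.root, b.height δ ≤ b.height θ)
    (hpos : b.IsPos θ) (j : b.support) : 0 ≤ (rootSystem H).pairingIn ℤ θ j := by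
  by_contra! h
  have hne : (rootSystem H).root θ ≠ -(rootSystem H).root (j : H.root) := by
    intro h1
    rw [← root_negRoot] at h1
    have h2 := (rootSystem H).root.injective h1
    rw [h2, isPos_negRoot] at hpos
    exact hpos (b.isPos_of_mem_support j.2)
  obtain ⟨δ, hδ⟩ := RootPairing.root_add_root_mem_of_pairingIn_neg _ h hne
  have h1 := b.height_add hδ
  rw [b.height_one_of_mem_support j.2] at h1
  have := hθ δ
  lia

/-- The highest root has full support. -/
lemma coeff_ne_zero_of_height_max {θ : H.root} (hθ : ∀ δ : H.root, b.height δ ≤ b.height θ)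
    (hpos : b.IsPos θ) {n : b.support → ℕ}
    (hn : (rootSystem H).root θ = ∑ i, n i • (rootSystem H).root i) (i : b.support) : n i ≠ 0 := by
  have hn' : (rootSystem H).root θ = ∑ i : b.support, (n i : ℤ) • (rootSystem H).root i := by
    simpa only [natCast_zsmul] using hn
  obtain ⟨i₀, hi₀⟩ : ∃ i, n i ≠ 0 := by
    by_contra! h
    simp only [h, zero_smul, Finset.sum_const_zero] at hn
    exact (rootSystem H).ne_zero θ hn
  refine RootPairing.Base.induction_on_cartanMatrix (b := b) (fun i ↦ n i ≠ 0) hi₀ ?_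
  intro i j hi hij hj
  have hne : i ≠ j := by rintro rfl; exact hi hj
  have h1 := pairingIn_nonneg_of_height_max hθ hpos j
  rw [pairingIn_sum Finset.univ _ _ hn'] at h1
  have h2 : ∀ l ∈ Finset.univ, (n l : ℤ) * (rootSystem H).pairingIn ℤ l j ≤ 0 := by
    intro l _
    by_cases hl : l = j
    · subst hl; simp [hj]
    · exact mul_nonpos_of_nonneg_of_nonpos (by positivity)
        (b.pairingIn_le_zero_of_ne (fun h ↦ hl (Subtype.ext h)) l.2 j.2)
  have h3 : (n i : ℤ) * (rootSystem H).pairingIn ℤ i j < 0 := by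
    refine mul_neg_of_pos_of_neg (by positivity) (lt_of_le_of_ne
      (b.pairingIn_le_zero_of_ne (fun h ↦ hne (Subtype.ext h)) i.2 j.2) fun h ↦ hij ?_)
    exact ((rootSystem H).pairingIn_eq_zero_iff (S := ℤ)).1 h
  have h4 := Finset.sum_lt_sum h2 ⟨i, Finset.mem_univ _, h3⟩
  rw [Finset.sum_const_zero] at h4
  lia

/-- The highest root is unique. -/
lemma eq_of_height_max {θ δ : H.root} (hθ : ∀ γ : H.root, b.height γ ≤ b.height θ)
    (hpos : b.IsPos θ) (h : b.height δ = b.height θ) : δ = θ := by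
  have hδ : b.IsPos δ := by rw [RootPairing.Base.isPos_iff, h]; exact hpos
  obtain ⟨n, hn⟩ := exists_nat_coeff hδ
  have hn' : (rootSystem H).root δ = ∑ i : b.support, (n i : ℤ) • (rootSystem H).root i := by
    simpa only [natCast_zsmul] using hn
  have h0 : ∀ i, n i ≠ 0 := coeff_ne_zero_of_height_max (h ▸ hθ) hδ hn
  have h1 : ∀ i : b.support, 0 ≤ (rootSystem H).pairingIn ℤ i θ := fun i ↦ by
    have := pairingIn_nonneg_of_height_max hθ hpos i
    by_contra! h2
    rw [RootPairing.pairingIn_lt_zero_iff] at h2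
    lia
  have h2 : 0 < (rootSystem H).pairingIn ℤ δ θ := by
    rw [pairingIn_sum Finset.univ _ _ hn']
    obtain ⟨j, hj, hjθ⟩ := hpos.exists_mem_support_pos_pairingIn
    refine Finset.sum_pos' (fun i _ ↦ mul_nonneg (by positivity) (h1 i))
      ⟨⟨j, hj⟩, Finset.mem_univ _, mul_pos ?_ hjθ⟩
    have := h0 ⟨j, hj⟩
    positivity
  by_contra hne
  obtain ⟨ε, hε⟩ := RootPairing.root_sub_root_mem_of_pairingIn_pos _ h2 hne
  have h3 := b.height_sub hε
  rw [h, sub_self] at h3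
  exact b.height_ne_zero ε h3

variable (b) in
/-- The linear map on the dual of `H` that permutes the simple roots by `σ`. -/
def diagramMap (σ : Equiv.Perm b.support) : Module.Dual K H ≃ₗ[K] Module.Dual K H :=
  b.toWeightBasis.equiv b.toWeightBasis σ

lemma diagramMap_root (σ : Equiv.Perm b.support) (i : b.support) :
    diagramMap b σ ((rootSystem H).root i) = (rootSystem H).root (σ i) := by
  rw [← b.toWeightBasis_apply, diagramMap, Module.Basis.equiv_apply, b.toWeightBasis_apply]

variable {σ : Equiv.Perm b.support} (hσ : IsDiagramAut b σ)
include hσ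

lemma diagramMap_apply_coroot (x : Module.Dual K H) (j : b.support) :
    diagramMap b σ x ((rootSystem H).coroot (σ j)) = x ((rootSystem H).coroot j) := by
  have h : (LinearMap.applyₗ ((rootSystem H).coroot (σ j))).comp (diagramMap b σ).toLinearMap =
      LinearMap.applyₗ ((rootSystem H).coroot (j : H.root)) := by
    apply b.toWeightBasis.ext
    intro i
    rw [b.toWeightBasis_apply, LinearMap.comp_apply, LinearEquiv.coe_coe, diagramMap_root,
      LinearMap.applyₗ_apply_apply, LinearMap.applyₗ_apply_apply, ← coe_pairingIn, ← coe_pairingIn]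
    exact congrArg _ (hσ i j)
  exact LinearMap.congr_fun h x

lemma exists_root_eq_diagramMap (β : H.root) :
    ∃ δ, (rootSystem H).root δ = diagramMap b σ ((rootSystem H).root β) :=
  RootPairing.Base.apply_mem_range_root_of_cartanMatrixEq b b σ (diagramMap b σ)
    (diagramMap_root σ) _ ⟨β, rfl⟩ hσ

omit hσ in
lemma heightForm_diagramMap (x : Module.Dual K H) :
    heightForm b (diagramMap b σ x) = heightForm b x := by
  have h : (heightForm b).comp (diagramMap b σ).toLinearMap = heightForm b := by
    apply b.toWeightBasis.ext
    intro i
    rw [b.toWeightBasis_apply, LinearMap.comp_apply, LinearEquiv.coe_coe, diagramMap_root,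
      heightForm_simple, heightForm_simple]
  exact LinearMap.congr_fun h x

omit hσ in
lemma two_mul_posForm (B : (rootSystem H).RootPositiveForm ℤ) (β γ : H.root) :
    2 * B.posForm ((rootSystem H).rootSpanMem ℤ β) ((rootSystem H).rootSpanMem ℤ γ) =
      (rootSystem H).pairingIn ℤ β γ * B.posForm
        ((rootSystem H).rootSpanMem ℤ γ) ((rootSystem H).rootSpanMem ℤ γ) := by
  apply FaithfulSMul.algebraMap_injective ℤ K
  rw [map_mul, map_mul, B.algebraMap_posForm, B.algebraMap_posForm, map_ofNat,
    RootPairing.algebraMap_pairingIn]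
  exact B.toInvariantForm.two_mul_apply_root_root β γ

set_option maxHeartbeats 1000000 in
/-- The orbits of a diagram automorphism on the simple roots involved in an invariant positive root
have at most three elements. This is proved by descent on the root: an orbit on which the root
pairs positively is small by positive definiteness, and either it carries the root or it can be
removed from the root by reflections. -/
lemma iterate_six_of_coeff_ne_zero {N : ℕ} {ρ : H.root} (hρ : b.IsPos ρ) (hN : b.height ρ ≤ N)
    (hinv : diagramMap b σ ((rootSystem H).root ρ) = (rootSystem H).root ρ) {i : b.support}
    (hi : b.toWeightBasis.repr ((rootSystem H).root ρ) i ≠ 0) : σ^[6] i = i := by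
  classical
  induction N generalizing ρ with
  | zero =>
    have : 0 < b.height ρ := hρ
    lia
  | succ N ih =>
  obtain ⟨j, hj, hjρ⟩ := hρ.exists_mem_support_pos_pairingIn
  lift j to b.support using hj
  set m := Function.minimalPeriod σ j with hm
  have hm0 : 0 < m := Function.minimalPeriod_pos_of_mem_periodicPts
    (Function.Injective.mem_periodicPts σ.injective j)
  set k := (rootSystem H).pairingIn ℤ ρ j with hk
  have hk0 : 0 < k := (RootPairing.zero_lt_pairingIn_iff' _ ℤ).1 hjρ
  set a : ℕ → b.support := fun t ↦ σ^[t] j with ha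
  have ha_succ : ∀ t, a (t + 1) = σ (a t) := fun t ↦ Function.iterate_succ_apply' σ t j
  have ha_inj : ∀ t < m, ∀ u < m, a t = a u → t = u := fun t ht u hu h ↦
    Function.iterate_injOn_Iio_minimalPeriod ht hu h
  have hka : ∀ t, (rootSystem H).pairingIn ℤ ρ (a t) = k := by
    intro t
    induction t with
    | zero => rfl
    | succ t iht =>
      rw [← iht]
      apply Int.cast_injective (α := K)
      have h1 := diagramMap_apply_coroot hσ ((rootSystem H).root ρ) (a t)
      rw [hinv] at h1
      rw [coe_pairingIn, coe_pairingIn, ha_succ, h1]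
  set p := ∑ t ∈ Finset.range m, (rootSystem H).pairingIn ℤ (a t) j with hp
  -- `s` is the sum of the orbit of `j`, and `p` is its pairing with the coroots of the orbit
  set s : Module.Dual K H := ∑ t ∈ Finset.range m, (rootSystem H).root (a t) with hs
  have hsinv : diagramMap b σ s = s := by
    rw [hs, map_sum]
    simp only [diagramMap_root]
    have h1 := Finset.sum_range_succ (fun t ↦ (rootSystem H).root (a t)) m
    rw [Finset.sum_range_succ'] at h1
    have h2 : a m = a 0 := Function.iterate_minimalPeriod
    rw [h2] at h1
    have h3 := add_right_cancel h1
    rw [← h3]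
    simp only [ha_succ]
  have hpu : ∀ u, ∑ t ∈ Finset.range m, (rootSystem H).pairingIn ℤ (a t) (a u) = p := by
    have key : ∀ j' : b.support, ((∑ t ∈ Finset.range m,
        (rootSystem H).pairingIn ℤ (a t) j' : ℤ) : K) = s ((rootSystem H).coroot j') := by
      intro j'
      push_cast
      rw [hs, LinearMap.sum_apply]
      simp only [coe_pairingIn]
    intro u
    apply Int.cast_injective (α := K)
    induction u with
    | zero => rfl
    | succ u ihu =>
      have h1 := diagramMap_apply_coroot hσ s (a u)
      rw [hsinv] at h1
      rw [← ihu, key, key, ha_succ, h1]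
  have hnonpos : ∀ t < m, ∀ u < m, t ≠ u → (rootSystem H).pairingIn ℤ (a t) (a u) ≤ 0 :=
    fun t ht u hu htu ↦ b.pairingIn_le_zero_of_ne
      (fun h ↦ htu (ha_inj t ht u hu (Subtype.ext h))) (a t).2 (a u).2
  have hsplit : ∀ u < m, p = 2 + ∑ t ∈ (Finset.range m).erase u,
      (rootSystem H).pairingIn ℤ (a t) (a u) := by
    intro u hu
    rw [← hpu u, ← Finset.add_sum_erase _ _ (Finset.mem_range.2 hu)]
    simp
  have hp2 : p ≤ 2 := by
    rw [hsplit 0 hm0]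
    have : ∑ t ∈ (Finset.range m).erase 0, (rootSystem H).pairingIn ℤ (a t) (a 0) ≤ 0 :=
      Finset.sum_nonpos fun t ht ↦ hnonpos t (Finset.mem_range.1 (Finset.mem_of_mem_erase ht)) 0 hm0
        (Finset.ne_of_mem_erase ht)
    lia
  have hs_ht : heightForm b s = m := by
    rw [hs, map_sum]
    simp only [heightForm_simple, Finset.sum_const, Finset.card_range, nsmul_eq_mul, mul_one]
  have hs_repr : ∀ i, (∀ t < m, a t ≠ i) → b.toWeightBasis.repr s i = 0 := by
    intro i hi
    rw [hs, map_sum, Finset.sum_apply', Finset.sum_eq_zero]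
    intro t ht
    rw [b.toWeightBasis_repr_root, Finsupp.single_apply, if_neg (hi t (Finset.mem_range.1 ht))]
  have hs_repr_j : b.toWeightBasis.repr s j = 1 := by
    rw [hs, map_sum, Finset.sum_apply', Finset.sum_eq_single 0]
    · exact (congrFun (congrArg _ (b.toWeightBasis_repr_root j)) j).trans
        (Finsupp.single_eq_same)
    · intro t ht h0
      rw [b.toWeightBasis_repr_root, Finsupp.single_apply, if_neg]
      intro h
      exact h0 (ha_inj t (Finset.mem_range.1 ht) 0 hm0 h)
    · intro h
      exact absurd (Finset.mem_range.2 hm0) h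
  have ha0 : a 0 = j := rfl
  clear_value m k a p s
  set F := ((rootSystem H).posRootForm ℤ).posForm with hF
  set r : H.root → (rootSystem H).rootSpan ℤ := (rootSystem H).rootSpanMem ℤ with hr
  have hFsymm : ∀ x y, F x y = F y x := fun x y ↦
    ((rootSystem H).posRootForm ℤ).isSymm_posForm.eq x y
  have hFpos : ∀ x, x ≠ 0 → 0 < F x x := fun x hx ↦
    (rootSystem H).posRootForm_posForm_pos_of_ne_zero ℤ hx
  have hr0 : ∀ β, r β ≠ 0 := fun β h ↦ (rootSystem H).ne_zero β (congrArg Subtype.val h)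
  have hsum : ((∑ t ∈ Finset.range m, r (a t) : (rootSystem H).rootSpan ℤ) :
      Module.Dual K H) = s := by
    rw [AddSubmonoidClass.coe_finsetSum, hs]
  have h3 : ∀ u < m, 2 * F (∑ t ∈ Finset.range m, r (a t)) (r (a u)) =
      p * F (r (a u)) (r (a u)) := by
    intro u _
    rw [map_sum, LinearMap.sum_apply, Finset.mul_sum, ← hpu u, Finset.sum_mul]
    exact Finset.sum_congr rfl fun t _ ↦ two_mul_posForm _ _ _
  have hp0 : 0 < p := by
    have h4 : 0 < F (∑ t ∈ Finset.range m, r (a t)) (∑ t ∈ Finset.range m, r (a t)) := by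
      apply hFpos
      intro h
      rw [h] at hsum
      rw [← hsum] at hs_repr_j
      simp at hs_repr_j
    have h5 : 2 * F (∑ t ∈ Finset.range m, r (a t)) (∑ t ∈ Finset.range m, r (a t)) =
        p * ∑ u ∈ Finset.range m, F (r (a u)) (r (a u)) := by
      conv_lhs => rw [map_sum]
      rw [Finset.mul_sum, Finset.mul_sum]
      exact Finset.sum_congr rfl fun u hu ↦ h3 u (Finset.mem_range.1 hu)
    refine pos_of_mul_pos_left (b := ∑ u ∈ Finset.range m, F (r (a u)) (r (a u)))
      (h5 ▸ mul_pos two_pos h4) ?_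
    exact Finset.sum_nonneg fun u _ ↦ (hFpos _ (hr0 _)).le
  have hmain := eq_or_lt_of_posDef hFsymm hFpos (hr0 ρ) (fun t ↦ r (a t))
    (fun t ↦ (rootSystem H).pairingIn ℤ (a t) ρ) hk0 hp0
    (fun t _ ↦ by rw [← hka t]; exact two_mul_posForm _ _ _) (fun t _ ↦ two_mul_posForm _ _ _)
    (fun t _ ↦ by
      have : 0 < (rootSystem H).pairingIn ℤ (a t) ρ :=
        (RootPairing.zero_lt_pairingIn_iff' _ ℤ).1 (hka t ▸ hk0)
      lia) h3
  have heq : (p • r ρ = k • ∑ t ∈ Finset.range m, r (a t)) →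
      (p : K) • (rootSystem H).root ρ = (k : K) • s := by
    intro h
    have := congrArg Subtype.val h
    rw [SetLike.val_smul, SetLike.val_smul, hsum] at this
    exact (Int.cast_smul_eq_zsmul K p _).trans (this.trans (Int.cast_smul_eq_zsmul K k s).symm)
  -- four elements are only possible for `k = 1`, `p = 2` and `2 ρ = s`, but the coefficients of `s`
  -- are equal to `1`
  have hm3 : m ≤ 3 := by
    by_contra! hm4
    have hkm : k * 4 ≤ k * m := mul_le_mul_of_nonneg_left (by exact_mod_cast hm4) hk0.le
    rcases hmain with ⟨h4, h5⟩ | h5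
    · have h7 : k = 1 := by lia
      have h8 : p = 2 := by lia
      have h9 := congrArg (fun x ↦ b.toWeightBasis.repr x j) (heq h4)
      simp only [map_smul, Finsupp.smul_apply, hs_repr_j, h7, h8] at h9
      obtain ⟨n, hn⟩ := exists_nat_coeff hρ
      have h10 := repr_sum_zsmul (fun i ↦ (n i : ℤ)) j
      simp only [natCast_zsmul] at h10
      rw [← hn] at h10
      rw [h10] at h9
      simp only [smul_eq_mul, mul_one] at h9
      have h11 : (2 : ℤ) * n j = 1 := by exact_mod_cast h9
      lia
    · lia
  have hper : ∀ t, σ^[6] (a t) = a t := by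
    intro t
    have h4 : m ∣ 6 := by
      interval_cases m <;> decide
    have h5 : σ^[6] j = j :=
      (Function.isPeriodicPt_iff_minimalPeriod_dvd (f := σ) (x := j)).2 (hm ▸ h4)
    simp only [ha]
    rw [← Function.iterate_add_apply, add_comm, Function.iterate_add_apply, h5]
  by_cases hia : ∃ t < m, a t = i
  · obtain ⟨t, -, rfl⟩ := hia
    exact hper t
  push Not at hia
  rcases hmain with ⟨h4, -⟩ | h4
  · exfalso
    have h5 := congrArg (fun x ↦ b.toWeightBasis.repr x i) (heq h4)
    simp only [map_smul, Finsupp.smul_apply, hs_repr i hia, smul_zero] at h5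
    rcases smul_eq_zero.1 h5 with h6 | h6
    · exact hp0.ne' (by exact_mod_cast h6)
    · exact hi h6
  -- now `k m < 2 p`, and `p = 1` would give `m = 1` and then `p = 2`; so `p = 2`, the orbit is
  -- orthogonal, and the reflections in its elements remove it from `ρ`
  have hp2' : p = 2 := by
    by_contra hne
    have hp1 : p = 1 := by lia
    have hkm : (1 : ℤ) * m ≤ k * m := mul_le_mul_of_nonneg_right hk0 (by positivity)
    have hm1 : m = 1 := by lia
    rw [hp, hm1, Finset.sum_range_one, ha0, RootPairing.pairingIn_same] at hp1
    lia
  have horth : ∀ u < m, ∀ t < m, t ≠ u → (rootSystem H).pairingIn ℤ (a t) (a u) = 0 := by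
    intro u hu t ht htu
    have h5 := hsplit u hu
    rw [hp2', left_eq_add] at h5
    exact (Finset.sum_eq_zero_iff_of_nonpos fun t ht ↦ hnonpos t
      (Finset.mem_range.1 (Finset.mem_of_mem_erase ht)) u hu (Finset.ne_of_mem_erase ht)).1 h5 t
      (Finset.mem_erase.2 ⟨htu, Finset.mem_range.2 ht⟩)
  have hroot : ∀ T ≤ m, ∃ δ, (rootSystem H).root δ = (rootSystem H).root ρ -
      (k : K) • ∑ t ∈ Finset.range T, (rootSystem H).root (a t) := by
    intro T hT
    induction T with
    | zero => exact ⟨ρ, by simp⟩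
    | succ T ihT =>
      obtain ⟨δ, hδ⟩ := ihT (by lia)
      refine ⟨(rootSystem H).reflectionPerm (a T) δ, ?_⟩
      have h5 : (rootSystem H).pairingIn ℤ δ (a T) = k := by
        apply Int.cast_injective (α := K)
        rw [coe_pairingIn, hδ, LinearMap.sub_apply, ← coe_pairingIn, hka, LinearMap.smul_apply,
          LinearMap.sum_apply, Finset.sum_eq_zero, smul_zero, sub_zero]
        intro t ht
        have ht' := Finset.mem_range.1 ht
        rw [← coe_pairingIn, horth T (by lia) t (by lia) (by lia), Int.cast_zero]
      have h6 : (k : K) • (rootSystem H).root (a T) = k • (rootSystem H).root (a T) :=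
        Int.cast_smul_eq_zsmul (M := Module.Dual K H) K k _
      rw [root_reflectionPerm_eq, h5, hδ, Finset.sum_range_succ, smul_add, neg_smul, h6]
      abel
  obtain ⟨δ, hδ⟩ := hroot m le_rfl
  rw [← hs] at hδ
  have hδi : b.toWeightBasis.repr ((rootSystem H).root δ) i =
      b.toWeightBasis.repr ((rootSystem H).root ρ) i := by
    rw [hδ, map_sub, map_smul, Finsupp.sub_apply, Finsupp.smul_apply, hs_repr i hia, smul_zero,
      sub_zero]
  have hδht : b.height δ = b.height ρ - k * m := by
    apply Int.cast_injective (α := K)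
    rw [← heightForm_root, hδ, map_sub, map_smul, hs_ht, heightForm_root]
    push_cast
    rw [smul_eq_mul]
  by_cases hδpos : b.IsPos δ
  · have hkm : 0 < k * m := by positivity
    refine ih hδpos (by push_cast at hN; linarith) ?_ (hδi ▸ hi)
    rw [hδ, map_sub, map_smul, hsinv, hinv]
  · exfalso
    obtain ⟨n, hn⟩ := exists_nat_coeff hρ
    obtain ⟨n', hn'⟩ := exists_nat_coeff ((isPos_negRoot δ).2 hδpos)
    have h10 := repr_sum_zsmul (fun i ↦ (n i : ℤ)) i
    have h11 := repr_sum_zsmul (fun i ↦ (n' i : ℤ)) i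
    simp only [natCast_zsmul] at h10 h11
    rw [← hn] at h10
    rw [← hn', root_negRoot, map_neg, Finsupp.neg_apply, hδi, h10] at h11
    have h12 : -(n i : ℤ) = n' i := by exact_mod_cast h11
    have h13 : n i = 0 := by lia
    rw [h13] at h10
    exact hi (by rw [h10]; simp)

/-- The orbits of a diagram automorphism have at most three elements, so their lengths divide `6`.
The descent starts from the highest root, which is invariant and involves all simple roots. -/
theorem pow_six_eq_one : σ ^ 6 = 1 := by
  ext i
  have : Nonempty H.root := ⟨i⟩
  obtain ⟨θ, hθ⟩ := Finite.exists_max fun β : H.root ↦ b.height β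
  have hpos : b.IsPos θ := lt_of_lt_of_le (b.isPos_of_mem_support i.2) (hθ i)
  obtain ⟨n, hn⟩ := exists_nat_coeff hpos
  have h1 := repr_sum_zsmul (fun i ↦ (n i : ℤ)) i
  simp only [natCast_zsmul] at h1
  rw [← hn] at h1
  obtain ⟨δ, hδ⟩ := exists_root_eq_diagramMap hσ θ
  have h2 : b.height δ = b.height θ := by
    apply Int.cast_injective (α := K)
    rw [← heightForm_root, ← heightForm_root, hδ, heightForm_diagramMap]
  have h3 := eq_of_height_max hθ hpos h2
  rw [h3] at hδ
  have h4 := iterate_six_of_coeff_ne_zero hσ hpos (Int.self_le_toNat _) hδ.symm (i := i) (by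
    rw [h1]
    exact_mod_cast coeff_ne_zero_of_height_max hθ hpos hn i)
  rw [← Equiv.Perm.iterate_eq_pow, h4]
  rfl

end Orbits

/-! ### The automorphism attached to a diagram automorphism -/

section Isomorphism

variable {K g : Type*} [Field K] [CharZero K] [LieRing g] [LieAlgebra K g]
  [FiniteDimensional K g] [IsSimple K g]
  {H : LieSubalgebra K g} [H.IsCartanSubalgebra] [IsTriangularizable K H g]
  {b : (rootSystem H).Base} {Q : AdmissibleQuadruple b} (E : Q.RootVectors)

namespace AdmissibleQuadruple.RootVectors

lemma coroot_smul_rootDual (i : b.support) :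
    ((2 * ((rootSystem H).root i (rootDual (i : H.root)))⁻¹) • (rootDual (i : H.root)) : g) =
      ((rootSystem H).coroot i : H) := by
  rw [coroot_eq_smul_rootDual]
  rfl

/-- `g` is generated by the root vectors of the simple roots and their negatives. -/
lemma eq_top_of_simple_mem (S : LieSubalgebra K g) (h : ∀ i : b.support, E.X i ∈ S)
    (h' : ∀ i : b.support, E.X (negRoot i) ∈ S) : S = ⊤ := by
  have hpos : ∀ β, b.IsPos β → E.X β ∈ S ∧ E.X (negRoot β) ∈ S := by
    intro β hβ
    refine hβ.induction_on_add (p := fun β ↦ E.X β ∈ S ∧ E.X (negRoot β) ∈ S)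
      (fun i hi ↦ ⟨h ⟨i, hi⟩, h' ⟨i, hi⟩⟩) (fun i j k hk hi hj ↦ ?_)
    have hk' : (rootSystem H).root (negRoot k) = (rootSystem H).root (negRoot i) +
        (rootSystem H).root (negRoot j) := by
      rw [root_negRoot, root_negRoot, root_negRoot, hk, neg_add]
    obtain ⟨c, hc, h1⟩ := E.lie_X_X hk
    obtain ⟨c', hc', h2⟩ := E.lie_X_X hk'
    constructor
    · rw [← inv_smul_smul₀ hc (E.X k), ← h1]
      exact S.smul_mem _ (S.lie_mem hi.1 (h ⟨j, hj⟩))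
    · rw [← inv_smul_smul₀ hc' (E.X (negRoot k)), ← h2]
      exact S.smul_mem _ (S.lie_mem hi.2 (h' ⟨j, hj⟩))
  have hX : ∀ β, E.X β ∈ S := by
    intro β
    by_cases hβ : b.IsPos β
    · exact (hpos β hβ).1
    · simpa using (hpos (negRoot β) ((isPos_negRoot β).2 hβ)).2
  have hH : ∀ x : H, (x : g) ∈ S := by
    intro x
    have hx : x ∈ Submodule.span K (Set.range fun i : b.support ↦ rootDual (H := H) i) := by
      rw [span_rootDual]; trivial
    induction hx using Submodule.span_induction with
    | mem x hx =>
      obtain ⟨i, rfl⟩ := hx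
      change (rootDual (i : H.root) : g) ∈ S
      rw [← E.lie_X_negRoot]
      exact S.lie_mem (hX _) (hX _)
    | zero => exact S.zero_mem
    | add x y _ _ hx hy => exact S.add_mem hx hy
    | smul c x _ hx => exact S.smul_mem c hx
  rw [← LieSubalgebra.toSubmodule_inj, LieSubalgebra.top_toSubmodule, eq_top_iff,
    ← E.span_eq_top, Submodule.span_le]
  rintro _ (hx | ⟨β, rfl⟩)
  · exact hH ⟨_, hx⟩
  · exact hX β

/-- The Chevalley generators of `g` given by the simple root vectors, with scale factors `c`. The
vectors `f i` are scaled so that `[e i, f i]` is the coroot. -/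
def lieBasis (c : b.support → K) (hc : ∀ i, c i ≠ 0) : LieAlgebra.Basis b.support H where
  A := b.cartanMatrix
  h i := ((rootSystem H).coroot i : H)
  e i := c i • E.X i
  f i := ((c i)⁻¹ * (2 * ((rootSystem H).root i (rootDual (i : H.root)))⁻¹)) • E.X (negRoot i)
  cartan_eq_lieSpan := by
    apply le_antisymm
    · intro x hx
      have h1 : (⟨x, hx⟩ : H) ∈ Submodule.span K (Set.range b.toCoweightBasis) := by
        rw [b.toCoweightBasis.span_eq]; trivial
      have key : ∀ y : H, y ∈ Submodule.span K (Set.range b.toCoweightBasis) →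
          (y : g) ∈ LieSubalgebra.lieSpan K g
            (Set.range fun i : b.support ↦ (((rootSystem H).coroot i : H) : g)) := by
        intro y hy
        induction hy using Submodule.span_induction with
        | mem y hy =>
          obtain ⟨i, rfl⟩ := hy
          rw [b.toCoweightBasis_apply]
          exact LieSubalgebra.subset_lieSpan ⟨i, rfl⟩
        | zero => exact LieSubalgebra.zero_mem _
        | add x y _ _ hx hy => exact LieSubalgebra.add_mem _ hx hy
        | smul c x _ hx => exact LieSubalgebra.smul_mem _ c hx
      exact key _ h1
    · rw [LieSubalgebra.lieSpan_le]
      rintro _ ⟨i, rfl⟩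
      exact SetLike.coe_mem _
  span_ef := by
    apply E.eq_top_of_simple_mem
    · intro i
      have h1 := LieSubalgebra.subset_lieSpan (R := K) (L := g)
        (s := Set.range (fun i : b.support ↦ c i • E.X i) ∪ Set.range (fun i : b.support ↦
          ((c i)⁻¹ * (2 * ((rootSystem H).root i (rootDual (i : H.root)))⁻¹)) • E.X (negRoot i)))
        (Or.inl ⟨i, rfl⟩)
      have h2 := LieSubalgebra.smul_mem _ (c i)⁻¹ h1
      rwa [inv_smul_smul₀ (hc i)] at h2
    · intro i
      have h1 := LieSubalgebra.subset_lieSpan (R := K) (L := g)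
        (s := Set.range (fun i : b.support ↦ c i • E.X i) ∪ Set.range (fun i : b.support ↦
          ((c i)⁻¹ * (2 * ((rootSystem H).root i (rootDual (i : H.root)))⁻¹)) • E.X (negRoot i)))
        (Or.inr ⟨i, rfl⟩)
      have h2 := LieSubalgebra.smul_mem _
        ((c i)⁻¹ * (2 * ((rootSystem H).root i (rootDual (i : H.root)))⁻¹))⁻¹ h1
      rwa [inv_smul_smul₀] at h2
      exact mul_ne_zero (inv_ne_zero (hc i)) (mul_ne_zero two_ne_zero
        (inv_ne_zero (root_rootDual_self_ne_zero _)))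
  linInd := by
    have h1 := b.toCoweightBasis.linearIndependent.map' H.toSubmodule.subtype
      (Submodule.ker_subtype _)
    have h2 : (H.toSubmodule.subtype ∘ b.toCoweightBasis) =
        fun i : b.support ↦ (((rootSystem H).coroot i : H) : g) := by
      ext i
      rw [Function.comp_apply, b.toCoweightBasis_apply]
      rfl
    rwa [h2] at h1
  nondegen := b.cartanMatrix_nondegenerate
  sl2 i := by
    have h1 : (rootSystem H).root i ((rootSystem H).coroot i) = 2 :=
      (rootSystem H).root_coroot_two i
    refine ⟨?_, ?_, ?_, ?_⟩
    · intro h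
      have h2 : ((rootSystem H).coroot i : H) = 0 := Subtype.ext h
      rw [h2, map_zero] at h1
      exact two_ne_zero h1.symm
    · rw [smul_lie, lie_smul, E.lie_X_negRoot, ← coroot_smul_rootDual, smul_smul, ← mul_assoc,
        mul_inv_cancel₀ (hc i), one_mul]
    · rw [lie_smul, E.lie_coe_X, h1, smul_comm, ofNat_smul_eq_nsmul]
    · rw [lie_smul, E.lie_coe_X, root_negRoot, LinearMap.neg_apply, h1, smul_comm, neg_smul,
        ofNat_smul_eq_nsmul]
  lie_h_h i j := by
    rw [← LieSubalgebra.coe_bracket, trivial_lie_zero]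
    rfl
  lie_h_e i j := by
    rw [lie_smul, E.lie_coe_X, ← Int.cast_smul_eq_zsmul K, ← pairing_coe_eq_cartanMatrix, smul_comm]
    rfl
  lie_h_f i j := by
    rw [lie_smul, E.lie_coe_X, root_negRoot, LinearMap.neg_apply, neg_smul, neg_smul,
      ← Int.cast_smul_eq_zsmul K, ← pairing_coe_eq_cartanMatrix, smul_neg, smul_comm]
    rfl
  lie_e_f_ne i j hij := by
    have hne : (i : H.root) ≠ j := fun h ↦ hij (Subtype.ext h)
    rw [smul_lie, lie_smul, E.lie_X_X_eq_zero (fun h ↦ hne (negRoot_injective h.symm)), smul_zero,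
      smul_zero]
    intro δ h
    rw [root_negRoot, ← sub_eq_add_neg] at h
    exact b.sub_notMem_range_root i.2 j.2 ⟨δ, h⟩

end AdmissibleQuadruple.RootVectors

omit [CharZero K] [FiniteDimensional K g] [IsSimple K g] [H.IsCartanSubalgebra]
  [IsTriangularizable K H g] in
lemma symm_trans_apply {P L₁ L₂ : Type*} [LieRing P] [LieAlgebra K P] [LieRing L₁]
    [LieAlgebra K L₁] [LieRing L₂] [LieAlgebra K L₂] (A : P ≃ₗ⁅K⁆ L₁) (B : P ≃ₗ⁅K⁆ L₂) (z : P)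
    {x : L₁} {y : L₂} (hA : A z = x) (hB : B z = y) : (A.symm.trans B) x = y := by
  subst hA hB
  simp

omit [H.IsCartanSubalgebra] [IsTriangularizable K H g] in
lemma equivOfReindex_e {ι : Type*} [Finite ι] (π : ι ≃ ι) (B₁ B₂ : LieAlgebra.Basis ι H)
    (hA : B₁.A.reindex π π = B₂.A) (i : ι) :
    LieAlgebra.Basis.equivOfReindex π B₁ B₂ hA (B₁.e i) = B₂.e (π i) := by
  unfold LieAlgebra.Basis.equivOfReindex
  exact symm_trans_apply _ _ ⟨(B₁.e i, B₂.e (π i)),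
    LieSubalgebra.subset_lieSpan (Or.inl (Or.inr ⟨i, rfl⟩))⟩ rfl rfl

omit [H.IsCartanSubalgebra] [IsTriangularizable K H g] in
lemma equivOfReindex_f {ι : Type*} [Finite ι] (π : ι ≃ ι) (B₁ B₂ : LieAlgebra.Basis ι H)
    (hA : B₁.A.reindex π π = B₂.A) (i : ι) :
    LieAlgebra.Basis.equivOfReindex π B₁ B₂ hA (B₁.f i) = B₂.f (π i) := by
  unfold LieAlgebra.Basis.equivOfReindex
  exact symm_trans_apply _ _ ⟨(B₁.f i, B₂.f (π i)),
    LieSubalgebra.subset_lieSpan (Or.inr ⟨i, rfl⟩)⟩ rfl rfl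

/-- A diagram automorphism `π` extends to the automorphism `X i ↦ X (-π i)`, `X (-i) ↦ X (π i)`. -/
lemma exists_lieEquiv {π : Equiv.Perm b.support} (hπ : IsDiagramAut b π) :
    ∃ u : g ≃ₗ⁅K⁆ g, (∀ i : b.support, u (E.X i) = E.X (negRoot (π i))) ∧
      ∀ i : b.support, u (E.X (negRoot i)) = E.X (π i) := by
  classical
  -- `B₁` has the generators `X i` and `s i • X (-i)`, and `B₂` has `X (-i)` and `s i • X i`
  set s : b.support → K := fun i ↦ 2 * ((rootSystem H).root i (rootDual (i : H.root)))⁻¹ with hs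
  have hs0 : ∀ i, s i ≠ 0 := fun i ↦ mul_ne_zero two_ne_zero
    (inv_ne_zero (root_rootDual_self_ne_zero _))
  set B₁ := E.lieBasis (fun _ ↦ 1) (fun _ ↦ one_ne_zero) with hB₁
  set B₂ := (E.lieBasis s hs0).symm with hB₂
  have hA : B₁.A.reindex π π = B₂.A := by
    ext i j
    change b.cartanMatrix (π.symm i) (π.symm j) = b.cartanMatrix i j
    rw [← hπ, Equiv.apply_symm_apply, Equiv.apply_symm_apply]
  set u := LieAlgebra.Basis.equivOfReindex π B₁ B₂ hA with hu
  have h1 : ∀ i : b.support, u (E.X i) = E.X (negRoot (π i)) := by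
    intro i
    have h := equivOfReindex_e π B₁ B₂ hA i
    have h2 : B₁.e i = E.X i := one_smul K _
    have h3 : B₂.e (π i) = E.X (negRoot (π i)) := by
      change ((s (π i))⁻¹ * s (π i)) • E.X (negRoot (π i)) = _
      rw [inv_mul_cancel₀ (hs0 _), one_smul]
    rwa [h2, h3] at h
  refine ⟨u, h1, fun i ↦ ?_⟩
  have h : u (((1 : K)⁻¹ * s i) • E.X (negRoot i)) = s (π i) • E.X (π i) :=
    equivOfReindex_f π B₁ B₂ hA i
  rw [inv_one, one_mul, map_smul] at h
  have h2 : u (E.X (negRoot i)) = ((s i)⁻¹ * s (π i)) • E.X (π i) := by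
    rw [mul_smul, ← h, inv_smul_smul₀ (hs0 i)]
  -- the factor is `1`, as `u` preserves the Killing form
  have h3 := killingForm_of_equiv_apply u (E.X i) (E.X (negRoot i))
  rw [h1, h2, map_smul, E.killingForm_X_X, E.killingForm_X_X, if_pos rfl, negRoot_negRoot,
    if_pos rfl, smul_eq_mul, mul_one] at h3
  rw [h2, h3, one_smul]

lemma apply_apply_of_involutive {π : Equiv.Perm b.support} (hπ : ∀ i, π (π i) = i)
    {u : g ≃ₗ⁅K⁆ g} (hu : ∀ i : b.support, u (E.X i) = E.X (negRoot (π i)))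
    (hu' : ∀ i : b.support, u (E.X (negRoot i)) = E.X (π i)) (x : g) : u (u x) = x := by
  let S : LieSubalgebra K g :=
    { LinearMap.eqLocus ((u.trans u : g ≃ₗ⁅K⁆ g) : g →ₗ[K] g) LinearMap.id with
      lie_mem' := fun {x y} hx hy ↦ by
        have hx' : u (u x) = x := hx
        have hy' : u (u y) = y := hy
        change u (u ⁅x, y⁆) = ⁅x, y⁆
        rw [LieEquiv.map_lie, LieEquiv.map_lie, hx', hy'] }
  have hS : S = ⊤ := E.eq_top_of_simple_mem S
    (fun i ↦ by change u (u (E.X i)) = E.X i; rw [hu, hu', hπ])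
    (fun i ↦ by change u (u (E.X (negRoot i))) = E.X (negRoot i); rw [hu', hu, hπ])
  have hx : x ∈ S := hS ▸ LieSubalgebra.mem_top x
  exact hx

end Isomorphism

/-! ### An automorphism that exchanges the tensor factors -/

section Sufficiency

section BaseEquiv

variable {K g : Type*} [Field K] [LieRing g] [LieAlgebra K g] (Kb : Type*) [Field Kb] [Algebra K Kb]

/-- The automorphism `c ⊗ x ↦ c ⊗ u x` of `Kb ⊗ g`. -/
def baseEquiv (u : g ≃ₗ⁅K⁆ g) : (Kb ⊗[K] g) ≃ₗ⁅Kb⁆ (Kb ⊗[K] g) where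
  __ := LinearEquiv.baseChange K Kb g g u.toLinearEquiv
  map_lie' {x y} := by
    change LinearEquiv.baseChange K Kb g g u.toLinearEquiv ⁅x, y⁆ =
      ⁅LinearEquiv.baseChange K Kb g g u.toLinearEquiv x,
        LinearEquiv.baseChange K Kb g g u.toLinearEquiv y⁆
    induction x with
    | zero => simp
    | add x x' hx hx' => rw [add_lie, map_add, map_add, hx, hx', add_lie]
    | tmul c x =>
      induction y with
      | zero => simp
      | add y y' hy hy' => rw [lie_add, map_add, map_add, hy, hy', lie_add]
      | tmul d y => simp [LieAlgebra.ExtendScalars.bracket_tmul, LieEquiv.map_lie]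

lemma baseEquiv_tmul (u : g ≃ₗ⁅K⁆ g) (c : Kb) (x : g) :
    baseEquiv Kb u (c ⊗ₜ[K] x) = c ⊗ₜ[K] u x := rfl

lemma baseEquiv_baseEmb (u : g ≃ₗ⁅K⁆ g) (x : g) :
    baseEquiv Kb u (baseEmb (K := K) Kb x) = baseEmb (K := K) Kb (u x) := rfl

lemma baseEquiv_baseEquiv {u : g ≃ₗ⁅K⁆ g} (hu : ∀ x, u (u x) = x) (z : Kb ⊗[K] g) :
    baseEquiv Kb u (baseEquiv Kb u z) = z := by
  induction z with
  | zero => simp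
  | add x y hx hy => rw [map_add, map_add, hx, hy]
  | tmul c x => rw [baseEquiv_tmul, baseEquiv_tmul, hu]

lemma galConj_baseEquiv (u : g ≃ₗ⁅K⁆ g) (γ : Gal(Kb/K)) (z : Kb ⊗[K] g) :
    galConj γ (baseEquiv Kb u) z = baseEquiv Kb u z := by
  rw [galConj_apply]
  induction z with
  | zero => simp
  | add x y hx hy => simp only [map_add, hx, hy]
  | tmul c x => simp [galAct_tmul, baseEquiv_tmul]

end BaseEquiv

variable {K g : Type*} [Field K] [CharZero K] [LieRing g] [LieAlgebra K g]
  [FiniteDimensional K g] [IsSimple K g]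
  {H : LieSubalgebra K g} [H.IsCartanSubalgebra] [IsTriangularizable K H g]
  {b : (rootSystem H).Base} {Q : AdmissibleQuadruple b} {E : Q.RootVectors}

lemma AdmissibleQuadruple.IsReversedBy.pow_three {π : Equiv.Perm b.support}
    (h : Q.IsReversedBy π) : Q.IsReversedBy (π ^ 3) where
  isDiagramAut i j := by
    simp only [pow_succ, pow_zero, one_mul, Equiv.Perm.mul_apply]
    rw [h.isDiagramAut, h.isDiagramAut, h.isDiagramAut]
  step hij := by
    simp only [pow_succ, pow_zero, one_mul, Equiv.Perm.mul_apply]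
    exact h.step (h.step (h.step hij))
  dualEval_rh i j := by
    simp only [pow_succ, pow_zero, one_mul, Equiv.Perm.mul_apply]
    rw [h.dualEval_rh, h.dualEval_rh, h.dualEval_rh]

variable {Kb : Type*} [Field Kb] [Algebra K Kb] {w : H.root → H.root} {c : H.root → Kb}
  {u : (Kb ⊗[K] g) ≃ₗ⁅Kb⁆ (Kb ⊗[K] g)} {π : Equiv.Perm b.support}

lemma AdmissibleQuadruple.RootVectors.eq_of_smul_baseX_eq (E : Q.RootVectors) {x y : Kb}
    {β : H.root} (h : x • E.baseX Kb β = y • E.baseX Kb β) : x = y := by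
  rw [← sub_eq_zero, ← sub_smul, smul_eq_zero] at h
  refine sub_eq_zero.1 (h.resolve_right fun h0 ↦ ?_)
  exact E.X_ne_zero β (baseEmb_injective (K := K) Kb (h0.trans (map_zero _).symm))

namespace ActsByRootPerm

variable (hu : ActsByRootPerm E Kb u w c) (hπ : Q.IsReversedBy π)
  (hw : ∀ i : b.support, w i = negRoot (π i))
include hu hπ hw

/-- `w` reverses the action of `τ` on the roots in the span of `Γ₁`. -/
lemma maps_of_maps {β β' : H.root} (h : Q.Maps β β') : Q.Maps (w β') (w β) := by
  obtain ⟨n, h1, h2⟩ := h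
  have hmem : ∀ i : Q.Γ₁, Q.Step (π (Q.τ i)) (π i) := fun i ↦ hπ.step (step_coe i)
  let e : Q.Γ₁ → Q.Γ₁ := fun i ↦ ⟨π (Q.τ i), (hmem i).choose⟩
  have he : Function.Injective e := fun i j h ↦
    Q.τ.injective (Subtype.ext (π.injective (Subtype.ext_iff.1 h)))
  let e' : Q.Γ₁ ≃ Q.Γ₁ := Equiv.ofBijective e (Finite.injective_iff_bijective.1 he)
  have he1 : ∀ i, ((e' i : Q.Γ₁) : b.support) = π (Q.τ i) := fun i ↦ rfl
  have he2 : ∀ i, (Q.τ (e' i) : b.support) = π i := fun i ↦ (hmem i).choose_spec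
  refine ⟨fun i ↦ -n (e'.symm i), ?_, ?_⟩
  · rw [hu.root_sum n _ h2]
    refine (Finset.sum_congr rfl fun i _ ↦ ?_).trans (e'.sum_comp fun i ↦
      -n (e'.symm i) • (rootSystem H).root ((i : b.support) : H.root))
    rw [hw, root_negRoot, he1, Equiv.symm_apply_apply, smul_neg, neg_smul]
  · rw [hu.root_sum n _ h1]
    refine (Finset.sum_congr rfl fun i _ ↦ ?_).trans (e'.sum_comp fun i ↦
      -n (e'.symm i) • (rootSystem H).root ((Q.τ i : b.support) : H.root))
    rw [hw, root_negRoot, he2, Equiv.symm_apply_apply, smul_neg, neg_smul]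

omit hπ in
lemma not_isPos_apply {β : H.root} (hβ : b.IsPos β) : ¬ b.IsPos (w β) := by
  obtain ⟨n, hn⟩ := exists_nat_coeff hβ
  have h1 : (rootSystem H).root (w β) = ∑ i : b.support, (n i : ℤ) • (rootSystem H).root (w i) :=
    hu.root_sum (fun i ↦ (n i : ℤ)) (fun i : b.support ↦ (i : H.root))
      (by simpa only [natCast_zsmul] using hn)
  have h2 : b.height (w β) = - b.height β := by
    apply Int.cast_injective (α := K)
    rw [Int.cast_neg, ← heightForm_root, ← heightForm_root, h1, hn, map_sum, map_sum,
      ← Finset.sum_neg_distrib]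
    refine Finset.sum_congr rfl fun i _ ↦ ?_
    rw [hw, root_negRoot, smul_neg, map_neg, natCast_zsmul, map_nsmul, map_nsmul,
      heightForm_simple, heightForm_simple]
  rw [RootPairing.Base.isPos_iff] at hβ ⊢
  lia

omit hπ in
lemma isPos_apply_iff (β : H.root) : b.IsPos (w β) ↔ ¬ b.IsPos β := by
  refine ⟨fun h hβ ↦ hu.not_isPos_apply hw hβ h, fun h ↦ ?_⟩
  by_contra h'
  rw [← isPos_negRoot, ← hu.apply_negRoot] at h'
  exact hu.not_isPos_apply hw ((isPos_negRoot β).2 h) h'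

variable (hww : ∀ β, w (w β) = β)

include hww in
lemma prec_apply_iff {β β' : H.root} : Q.Prec (w β) (w β') ↔ Q.Prec β' β := by
  have key : ∀ {β β' : H.root}, Q.Prec β β' → Q.Prec (w β') (w β) := by
    intro β β' h
    induction h with
    | single h => exact .single (hu.maps_of_maps hπ hw h)
    | tail _ h ih => exact .head (hu.maps_of_maps hπ hw h) ih
  exact ⟨fun h ↦ by simpa only [hww] using key h, key⟩

variable (hc : ∀ i : b.support, c i = 1)
include hc

/-- The scale factors of `u` are constant along `τ`. For positive roots this follows by induction on
the height: if `β = γ + α` with `α ∈ Γ₁`, then both brackets `[X γ, X α]` and `[X (w γ), X (w α)]`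
have the same structure constants as their images under `τ`. -/
lemma factor_eq_of_maps {β β' : H.root} (h : Q.Maps β β') : c β = c β' := by
  have hpos : ∀ N : ℕ, ∀ β β' : H.root, b.IsPos β → b.height β ≤ N → Q.Maps β β' →
      c β = c β' := by
    intro N
    induction N with
    | zero =>
      intro β β' hβ hN _
      have : 0 < b.height β := hβ
      lia
    | succ N ih =>
      intro β β' hβ hN h
      by_cases h1 : b.height β = 1
      · obtain ⟨i, rfl⟩ := eq_simple_of_height_eq_one h1
        obtain ⟨j, -, rfl⟩ := maps_simple_iff.1 h
        rw [hc, hc]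
      have hβ0 : 0 < b.height β := hβ
      obtain ⟨j, hj⟩ := h.inSpan.exists_pos_pairing hβ
      have hj' : 0 < (rootSystem H).pairingIn ℤ β' (Q.τ j : b.support) := by
        have h2 : (rootSystem H).pairingIn ℤ β' (Q.τ j : b.support) =
            (rootSystem H).pairingIn ℤ β (j : b.support) := by
          apply Int.cast_injective (α := K)
          rw [coe_pairingIn, coe_pairingIn]
          exact h.pairing (maps_coe j)
        rwa [h2]
      have hne : β ≠ (j : b.support) := by
        rintro rfl
        exact h1 (b.height_one_of_mem_support (j : b.support).2)
      have hne' : β' ≠ (Q.τ j : b.support) := by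
        intro h2
        apply h1
        rw [← h.height_eq, h2]
        exact b.height_one_of_mem_support (Q.τ j : b.support).2
      obtain ⟨γ, hγ⟩ := RootPairing.root_sub_root_mem_of_pairingIn_pos _ hj hne
      obtain ⟨γ', hγ'⟩ := RootPairing.root_sub_root_mem_of_pairingIn_pos _ hj' hne'
      have hm : Q.Maps γ γ' := h.add_zsmul (maps_coe j) (-1)
        (by rw [hγ, neg_one_smul, sub_eq_add_neg]) (by rw [hγ', neg_one_smul, sub_eq_add_neg])
      have hβγ : (rootSystem H).root β =
          (rootSystem H).root γ + (rootSystem H).root (j : b.support) := by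
        rw [hγ, sub_add_cancel]
      have hβγ' : (rootSystem H).root β' =
          (rootSystem H).root γ' + (rootSystem H).root (Q.τ j : b.support) := by
        rw [hγ', sub_add_cancel]
      have hht : b.height β = b.height γ + 1 := by
        apply Int.cast_injective (α := K)
        rw [← heightForm_root, hβγ, map_add, heightForm_root, heightForm_simple, Int.cast_add,
          Int.cast_one]
      have hγc : c γ = c γ' := by
        refine ih γ γ' ?_ (by push_cast at hN; lia) hm
        rw [RootPairing.Base.isPos_iff]
        lia
      -- compare `u [X γ, X j] = a u (X β)` with its image under `τ`
      obtain ⟨a, ha, hlie⟩ := E.lie_X_X hβγ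
      have hlie' := E.adapted hm (maps_coe j) h a hlie
      obtain ⟨d, -, hd'⟩ := E.lie_X_X (hu.root_add hβγ')
      have hd := E.adapted (hu.maps_of_maps hπ hw hm) (hu.maps_of_maps hπ hw (maps_coe j))
        (hu.maps_of_maps hπ hw h) d hd'
      have key : ∀ {β γ δ : H.root}, ⁅E.X γ, E.X δ⁆ = a • E.X β → c δ = 1 →
          ⁅E.X (w γ), E.X (w δ)⁆ = d • E.X (w β) →
          c γ * algebraMap K Kb d = algebraMap K Kb a * c β := by
        intro β γ δ h1 h2 h3
        have h4 := congrArg (fun x ↦ u (baseEmb (K := K) Kb x)) h1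
        simp only [← lie_baseEmb, LieEquiv.map_lie] at h4
        rw [baseEmb_smul, map_smul] at h4
        change ⁅u (E.baseX Kb γ), u (E.baseX Kb δ)⁆ = _ • u (E.baseX Kb β) at h4
        rw [hu.apply_baseX, hu.apply_baseX, hu.apply_baseX, h2, one_smul, smul_lie] at h4
        simp only [RootVectors.baseX] at h4
        rw [lie_baseEmb, h3, baseEmb_smul, smul_smul, smul_smul] at h4
        exact E.eq_of_smul_baseX_eq h4
      have k1 := key hlie (hc _) hd
      have k2 := key hlie' (hc _) hd'
      rw [hγc, k2] at k1
      exact (mul_left_cancel₀ (by simpa using ha) k1).symm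
  by_cases hβ : b.IsPos β
  · exact hpos (b.height β).toNat β β' hβ (Int.self_le_toNat _) h
  · have h1 := hpos _ _ _ ((isPos_negRoot β).2 hβ) (Int.self_le_toNat _) h.neg
    have h2 := hu.mul_negRoot β
    rw [h1, ← hu.mul_negRoot β'] at h2
    exact mul_right_cancel₀ (hu.factor_ne_zero _) h2

lemma factor_eq_of_prec {β β' : H.root} (h : Q.Prec β β') : c β = c β' := by
  induction h with
  | single h => exact hu.factor_eq_of_maps hπ hw hc h
  | tail _ h ih => exact ih.trans (hu.factor_eq_of_maps hπ hw hc h)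

include hww in
/-- `u` exchanges the tensor factors of the Belavin–Drinfeld matrix. -/
lemma tensorSq_rBD : tensorSq u (baseChangeTensor Kb (Q.rBD E)) =
    flip (baseChangeTensor Kb (Q.rBD E)) := by
  classical
  have hspan : Submodule.span K (Set.range (fun i : b.support ↦ (rootDual (i : H.root) : g)) ∪
      Set.range E.X) = ⊤ := by
    rw [eq_top_iff, ← E.span_eq_top, Submodule.span_le]
    rintro _ (hx | ⟨β, rfl⟩)
    · have h1 : H.toSubmodule ≤ Submodule.span K
          (Set.range (fun i : b.support ↦ (rootDual (i : H.root) : g))) := by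
        have h2 := congrArg (Submodule.map H.toSubmodule.subtype) (span_rootDual b)
        rw [Submodule.map_span, ← Set.range_comp, Submodule.map_top, Submodule.range_subtype] at h2
        exact h2.ge
      exact Submodule.span_mono Set.subset_union_left (h1 hx)
    · exact Submodule.subset_span (Or.inr ⟨β, rfl⟩)
  have hspan' : Submodule.span Kb (u '' (baseEmb (K := K) Kb '' (Set.range
      (fun i : b.support ↦ (rootDual (i : H.root) : g)) ∪ Set.range E.X))) = ⊤ := by
    have h1 := congrArg (Submodule.map (u : (Kb ⊗[K] g) →ₗ[Kb] (Kb ⊗[K] g)))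
      (span_baseEmb Kb hspan)
    rw [Submodule.map_span, Submodule.map_top] at h1
    exact h1.trans (LinearMap.range_eq_top.2 u.surjective)
  refine eq_of_killingEval_eq (fun x ↦ killingForm_baseChange_nondegenerate Kb) hspan' ?_
  have hX : ∀ β, u (baseEmb (K := K) Kb (E.X β)) = c β • baseEmb (K := K) Kb (E.X (w β)) :=
    hu.apply_baseX
  have ht : ∀ β, u (baseEmb (K := K) Kb (rootDual β : g)) =
    baseEmb (K := K) Kb (rootDual (w β) : g) := hu.apply_baseDual
  have smul_left : ∀ (a : Kb) (x y : Kb ⊗[K] g) (t), killingEval (a • x) y t =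
      a * killingEval x y t := fun a x y t ↦ by
    rw [← killingForm_contraction, ← killingForm_contraction, map_smul, map_smul,
      LinearMap.smul_apply, smul_eq_mul]
  have smul_right : ∀ (a : Kb) (x y : Kb ⊗[K] g) (t), killingEval x (a • y) t =
      a * killingEval x y t := fun a x y t ↦ by
    rw [← killingForm_contraction, ← killingForm_contraction, map_smul, smul_eq_mul]
  rintro _ ⟨_, ⟨_, (⟨i, rfl⟩ | ⟨β, rfl⟩), rfl⟩, rfl⟩ _ ⟨_, ⟨_, (⟨j, rfl⟩ | ⟨γ, rfl⟩), rfl⟩, rfl⟩ <;>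
    rw [killingEval_tensorSq, killingEval_flip, killingEval_baseEmb]
  · rw [ht, ht, killingEval_baseEmb, killingEval_rBD_coe_coe E, killingEval_rBD_coe_coe E,
      killingEval_cartanTensor, killingEval_cartanTensor, hw, hw, root_negRoot, root_negRoot,
      dualEval_neg_neg, hπ.dualEval_rh]
  · rw [ht, hX, smul_left, killingEval_baseEmb, killingEval_rBD_coe_X E, killingEval_rBD_X_coe E,
      map_zero, mul_zero]
  · rw [ht, hX, smul_right, killingEval_baseEmb, killingEval_rBD_coe_X E, killingEval_rBD_X_coe E,
      map_zero, mul_zero]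
  · rw [hX, hX, smul_left, smul_right, killingEval_baseEmb, killingEval_rBD_X_X E,
      killingEval_rBD_X_X E]
    have hcc : ∀ β γ, c (negRoot β) = c γ → c γ * c β = 1 := fun β γ h ↦ by
      rw [← h, mul_comm, hu.mul_negRoot]
    have hpr : ∀ β γ, Q.Prec (negRoot (w γ)) (w β) ↔ Q.Prec (negRoot β) γ := fun β γ ↦ by
      rw [← hu.apply_negRoot, hu.prec_apply_iff hπ hw hww, ← prec_negRoot_iff, negRoot_negRoot]
    have e1 : (w β = negRoot (w γ) ∧ ¬ b.IsPos (w γ)) ↔ (γ = negRoot β ∧ ¬ b.IsPos β) := by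
      rw [← hu.apply_negRoot, hu.injective.eq_iff, hu.isPos_apply_iff hw, not_not,
        ← negRoot_eq_iff (β := β), eq_comm (a := γ)]
      exact and_congr_right fun h ↦ by rw [← h, isPos_negRoot]
    have e2 : ∀ β γ, (¬ b.IsPos (w γ) ∧ Q.Prec (negRoot (w γ)) (w β)) ↔
        (¬ b.IsPos β ∧ Q.Prec (negRoot β) γ) := fun β γ ↦ by
      rw [hpr, hu.isPos_apply_iff hw, not_not]
      exact and_congr_left fun h ↦ by rw [h.isPos_iff, isPos_negRoot]
    have k1 : γ = negRoot β ∧ ¬ b.IsPos β → c γ * c β = 1 := fun h ↦ hcc β γ (by rw [h.1])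
    have k2 : ∀ β γ, ¬ b.IsPos β ∧ Q.Prec (negRoot β) γ → c γ * c β = 1 := fun β γ h ↦
      hcc β γ (hu.factor_eq_of_prec hπ hw hc h.2)
    simp only [e1, e2, map_add, map_sub, apply_ite (algebraMap K Kb), map_one, map_zero,
      ← mul_assoc, mul_add, mul_sub]
    have ite_eq : ∀ (p : Prop) [Decidable p] (a : Kb), (p → a = 1) →
        a * (if p then 1 else 0) = if p then 1 else 0 := fun p _ a h ↦ by
      split_ifs with hp
      · rw [h hp, one_mul]
      · rw [mul_zero]
    rw [ite_eq _ _ k1, ite_eq _ _ (k2 β γ), ite_eq _ _ fun h ↦ by rw [mul_comm]; exact k2 γ β h]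

end ActsByRootPerm

variable (E) (Kb) in
/-- A diagram automorphism that reverses `Q` gives an involution of `g` whose extension to `Kb ⊗ g`
exchanges the tensor factors of the Belavin–Drinfeld matrix. The cube of a diagram automorphism that
reverses `Q` is an involution that reverses `Q`. -/
theorem exists_involution (hπ : Q.IsReversedBy π) :
    ∃ u : g ≃ₗ⁅K⁆ g, (∀ x, u (u x) = x) ∧
      tensorSq (baseEquiv Kb u) (baseChangeTensor Kb (Q.rBD E)) =
        flip (baseChangeTensor Kb (Q.rBD E)) := by
  have hinv : ∀ i, (π ^ 3) ((π ^ 3) i) = i := fun i ↦ by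
    rw [← Equiv.Perm.mul_apply, ← pow_add, pow_six_eq_one hπ.isDiagramAut, Equiv.Perm.one_apply]
  have hπ := hπ.pow_three
  obtain ⟨u, hu1, hu2⟩ := exists_lieEquiv E hπ.isDiagramAut
  have huu := apply_apply_of_involutive E hinv hu1 hu2
  refine ⟨u, huu, ?_⟩
  have hdual : ∀ i : b.support, baseEquiv Kb u (baseDual Kb (i : H.root)) =
      baseDual Kb (negRoot (((π ^ 3) i : b.support) : H.root)) := by
    intro i
    have h1 := E.lie_X_negRoot (negRoot (((π ^ 3) i : b.support) : H.root))
    rw [negRoot_negRoot] at h1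
    rw [baseDual, baseEquiv_baseEmb, ← E.lie_X_negRoot, LieEquiv.map_lie, hu1, hu2, h1, baseDual]
  have huH : ∀ h : H, u (h : g) ∈ H := by
    intro h
    have hh : h ∈ Submodule.span K (Set.range fun i : b.support ↦ rootDual (H := H) i) := by
      rw [span_rootDual]; trivial
    induction hh using Submodule.span_induction with
    | mem x hx =>
      obtain ⟨i, rfl⟩ := hx
      change u (rootDual (i : H.root) : g) ∈ H
      have h1 := E.lie_X_negRoot (negRoot (((π ^ 3) i : b.support) : H.root))
      rw [negRoot_negRoot] at h1
      rw [← E.lie_X_negRoot, LieEquiv.map_lie, hu1, hu2, h1]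
      exact SetLike.coe_mem _
    | zero => simp
    | add x y _ _ hx hy =>
      rw [AddMemClass.coe_add, map_add]
      exact H.add_mem hx hy
    | smul c x _ hx =>
      have h1 : ((c • x : H) : g) = c • (x : g) := rfl
      rw [h1, map_smul]
      exact H.smul_mem c hx
  obtain ⟨w, c, hw⟩ := exists_actsByRootPerm (E := E) (Kb := Kb) (u := baseEquiv Kb u) (by
    have h1 : cartanBase H Kb ≤ (cartanBase H Kb).comap
        (baseEquiv Kb u : (Kb ⊗[K] g) →ₗ[Kb] (Kb ⊗[K] g)) := by
      conv_lhs => rw [cartanBase]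
      rw [Submodule.span_le]
      rintro _ ⟨h, rfl⟩
      exact Submodule.subset_span ⟨⟨u h, huH h⟩, rfl⟩
    exact fun y hy ↦ h1 hy)
  have hwi : ∀ i : b.support, w i = negRoot (((π ^ 3) i : b.support) : H.root) := fun i ↦ by
    apply baseDual_injective Kb
    rw [← hw.apply_baseDual, hdual]
  have hww : ∀ β, w (w β) = β := fun β ↦ by
    apply baseDual_injective Kb
    rw [← hw.apply_baseDual, ← hw.apply_baseDual, baseEquiv_baseEquiv Kb huu]
  have hc : ∀ i : b.support, c i = 1 := fun i ↦ by
    have h1 := hw.apply_baseX i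
    rw [hwi, RootVectors.baseX, baseEquiv_baseEmb, hu1] at h1
    exact E.eq_of_smul_baseX_eq (h1.symm.trans (one_smul _ _).symm)
  exact hw.tensorSq_rBD hπ hwi hww hc

end Sufficiency

/-! ### Diagram automorphisms that reverse a quadruple -/

section Reversal

variable {K g : Type*} [Field K] [CharZero K] [LieRing g] [LieAlgebra K g]
  [FiniteDimensional K g] [IsSimple K g]
  {H : LieSubalgebra K g} [H.IsCartanSubalgebra] [IsTriangularizable K H g]
  {b : (rootSystem H).Base} {Q : AdmissibleQuadruple b} {E : Q.RootVectors}
  {π : Equiv.Perm b.support}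

/-- The action of `π` on `H` is the transpose of the inverse permutation of the simple roots. -/
lemma root_comp_cartanAct (hπ : IsDiagramAut b π) (i : b.support) :
    (rootSystem H).root i ∘ₗ (cartanAct b π).toLinearMap = (rootSystem H).root (π.symm i) := by
  apply b.toCoweightBasis.ext
  intro j
  have h1 : cartanAct b π (b.toCoweightBasis j) = b.toCoweightBasis (π j) :=
    Module.Basis.equiv_apply ..
  rw [LinearMap.comp_apply, LinearEquiv.coe_coe, h1, b.toCoweightBasis_apply,
    b.toCoweightBasis_apply]
  change (rootSystem H).pairing i (π j) = (rootSystem H).pairing (π.symm i) j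
  rw [pairing_coe_eq_cartanMatrix, pairing_coe_eq_cartanMatrix, ← hπ (π.symm i),
    Equiv.apply_symm_apply]

lemma map_cartanAct_rh_iff (hπ : IsDiagramAut b π) :
    TensorProduct.map (cartanAct b π).toLinearMap (cartanAct b π).toLinearMap Q.rh = flip Q.rh ↔
      ∀ i j : b.support, dualEval ((rootSystem H).root (π j)) ((rootSystem H).root (π i)) Q.rh =
        dualEval ((rootSystem H).root i) ((rootSystem H).root j) Q.rh := by
  have key : ∀ i j : b.support, dualEval ((rootSystem H).root i) ((rootSystem H).root j)
      (TensorProduct.map (cartanAct b π).toLinearMap (cartanAct b π).toLinearMap Q.rh) =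
        dualEval ((rootSystem H).root (π.symm i)) ((rootSystem H).root (π.symm j)) Q.rh := by
    intro i j
    rw [dualEval_map, root_comp_cartanAct hπ, root_comp_cartanAct hπ]
  constructor
  · intro h i j
    have h1 := key (π i) (π j)
    rw [h, dualEval_flip, Equiv.symm_apply_apply, Equiv.symm_apply_apply] at h1
    exact h1
  · intro h
    apply eq_of_dualEval_eq
    intro i j
    rw [key, dualEval_flip, ← h, Equiv.apply_symm_apply, Equiv.apply_symm_apply]

/-- The conditions on `π` amount to `Q.IsReversedBy π`; the equations `π Γ₁ = Γ₂` and `π Γ₂ = Γ₁`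
follow from `π τ π⁻¹ = τ⁻¹` by counting. -/
lemma isReversedBy_iff : Q.IsReversedBy π ↔ IsDiagramAut b π ∧
    Q.Γ₁.map π.toEmbedding = Q.Γ₂ ∧ Q.Γ₂.map π.toEmbedding = Q.Γ₁ ∧
    (∀ i : Q.Γ₂, ∃ h : π.symm i ∈ Q.Γ₁, π (Q.τ ⟨π.symm i, h⟩) = Q.τ.symm i) ∧
    TensorProduct.map (cartanAct b π).toLinearMap (cartanAct b π).toLinearMap Q.rh =
      flip Q.rh := by
  have hstep : ∀ i : Q.Γ₂, Q.Step (Q.τ.symm i) i := fun i ↦ by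
    simpa using step_coe (Q.τ.symm i)
  constructor
  · intro h
    have hcard : Q.Γ₁.card = Q.Γ₂.card := by simpa using Fintype.card_congr Q.τ
    have h1 : Q.Γ₁.map π.toEmbedding = Q.Γ₂ := by
      refine Finset.eq_of_subset_of_card_le ?_ (by rw [Finset.card_map, hcard])
      intro j hj
      obtain ⟨i, hi, rfl⟩ := Finset.mem_map.1 hj
      exact mem_Γ₂_iff.2 ⟨_, h.step (step_coe ⟨i, hi⟩)⟩
    have h2 : Q.Γ₂.map π.toEmbedding = Q.Γ₁ := by
      refine Finset.eq_of_subset_of_card_le ?_ (by rw [Finset.card_map, hcard])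
      intro j hj
      obtain ⟨i, hi, rfl⟩ := Finset.mem_map.1 hj
      exact mem_Γ₁_iff.2 ⟨_, h.step (hstep ⟨i, hi⟩)⟩
    refine ⟨h.isDiagramAut, h1, h2, fun i ↦ ?_,
      (map_cartanAct_rh_iff h.isDiagramAut).2 h.dualEval_rh⟩
    have hi : π.symm i ∈ Q.Γ₁ := by
      have hi : (i : b.support) ∈ Q.Γ₁.map π.toEmbedding := by rw [h1]; exact i.2
      obtain ⟨k, hk, hki⟩ := Finset.mem_map.1 hi
      rw [← hki]
      simpa using hk
    refine ⟨hi, ?_⟩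
    have h3 := h.step (step_coe ⟨π.symm i, hi⟩)
    rw [Equiv.apply_symm_apply] at h3
    exact h3.left_unique (hstep i)
  · rintro ⟨h0, h1, -, h3, h4⟩
    refine ⟨h0, ?_, (map_cartanAct_rh_iff h0).1 h4⟩
    rintro i j ⟨hi, hij⟩
    have hi2 : π i ∈ Q.Γ₂ := by
      rw [← h1]
      exact Finset.mem_map_of_mem _ hi
    obtain ⟨h, h5⟩ := h3 ⟨π i, hi2⟩
    have h6 : (⟨π.symm (π i), h⟩ : Q.Γ₁) = ⟨i, hi⟩ := Subtype.ext (π.symm_apply_apply i)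
    have h7 : (Q.τ ⟨π.symm (π i), h⟩ : b.support) = j := by rw [← hij, h6]
    rw [← h7]
    have h8 := hstep ⟨π i, hi2⟩
    rwa [← h5] at h8

end Reversal

/-! ### Quadratic extensions and cocycles -/

section Cocycles

variable {K Kb : Type*} [Field K] [Field Kb] [Algebra K Kb] {α : Kb} {d : K}

lemma gal_apply_eq_or_eq_neg (hα : α ^ 2 = algebraMap K Kb d) (γ : Gal(Kb/K)) :
    γ α = α ∨ γ α = -α := by
  apply sq_eq_sq_iff_eq_or_eq_neg.1
  rw [← map_pow, hα, AlgEquiv.commutes]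

lemma exists_gal_apply_eq_neg [IsGalois K Kb] (hα : α ^ 2 = algebraMap K Kb d)
    (hd : ¬ IsSquare d) : ∃ γ : Gal(Kb/K), γ α = -α := by
  by_contra! h
  obtain ⟨a, rfl⟩ := (InfiniteGalois.mem_range_algebraMap_iff_fixed α).2 fun γ ↦
    (gal_apply_eq_or_eq_neg hα γ).resolve_right (h γ)
  rw [← map_pow] at hα
  exact hd ⟨a, by rw [← pow_two]; exact (FaithfulSMul.algebraMap_injective K Kb hα).symm⟩

/-- The Galois group acts continuously on the discrete set `Kb`. -/
lemma isLocallyConstant_gal_apply [Algebra.IsAlgebraic K Kb] (α : Kb) :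
    IsLocallyConstant fun γ : Gal(Kb/K) ↦ γ α := by
  rw [IsLocallyConstant.iff_exists_open]
  intro γ
  have : FiniteDimensional K (IntermediateField.adjoin K {α}) :=
    IntermediateField.adjoin.finiteDimensional (Algebra.IsIntegral.isIntegral α)
  refine ⟨(fun σ ↦ γ⁻¹ * σ) ⁻¹' (IntermediateField.adjoin K {α}).fixingSubgroup,
    (IntermediateField.fixingSubgroup_isOpen _).preimage (continuous_const_mul γ⁻¹), ?_, ?_⟩
  · simp
  · intro σ hσ
    have h1 := (IntermediateField.mem_fixingSubgroup_iff _ _).1 hσ α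
      (IntermediateField.mem_adjoin_simple_self K α)
    have h2 := congrArg γ h1
    rwa [AlgEquiv.mul_apply, ← AlgEquiv.mul_apply γ, mul_inv_cancel, AlgEquiv.one_apply] at h2

variable {g : Type*} [LieRing g] [LieAlgebra K g]

open Classical in
/-- The cocycle of the quadratic extension `K(α)` with values in the group generated by an
involution `u` of `g` that exchanges the tensor factors of `r`. -/
def involutionCocycle [Algebra.IsAlgebraic K Kb] [NeZero (2 : Kb)] {r : g ⊗[K] g}
    (hα : α ^ 2 = algebraMap K Kb d) (hα0 : α ≠ 0) (u : g ≃ₗ⁅K⁆ g) (hu : ∀ x, u (u x) = x)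
    (hr : tensorSq (baseEquiv Kb u) (baseChangeTensor Kb r) = flip (baseChangeTensor Kb r)) :
    TwistedCocycle r α where
  u γ := if γ α = α then LieEquiv.refl else baseEquiv Kb u
  continuous := (isLocallyConstant_gal_apply α).comp
    fun β : Kb ↦ if β = α then LieEquiv.refl else baseEquiv Kb u
  cocycle γ σ x := by
    have hne : -α ≠ α := fun h ↦ hα0 (by
      rw [← sub_eq_zero, ← neg_add', neg_eq_zero, ← two_mul] at h
      exact (mul_eq_zero.1 h).resolve_left two_ne_zero)
    have hrefl : galConj γ (LieEquiv.refl : (Kb ⊗[K] g) ≃ₗ⁅Kb⁆ (Kb ⊗[K] g)) x = x := by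
      rw [galConj_apply]
      exact galAct_symm g γ x
    rcases gal_apply_eq_or_eq_neg hα σ with hσ | hσ
    · rw [AlgEquiv.mul_apply, hσ, if_pos rfl, hrefl]
    · rcases gal_apply_eq_or_eq_neg hα γ with hγ | hγ
      · rw [AlgEquiv.mul_apply, hσ, map_neg, hγ, if_neg hne, if_pos rfl, galConj_baseEquiv]
        rfl
      · rw [AlgEquiv.mul_apply, hσ, map_neg, hγ, neg_neg, if_pos rfl, if_neg hne,
          galConj_baseEquiv, baseEquiv_baseEquiv Kb hu]
        rfl
  fixed γ hγ := by
    rw [if_pos hγ]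
    exact LinearMap.congr_fun TensorProduct.map_id _
  flipped γ hγ := by
    rw [if_neg]
    · exact hr
    · intro h
      rw [h, ← sub_eq_zero, sub_neg_eq_add, ← two_mul] at hγ
      exact hα0 ((mul_eq_zero.1 hγ).resolve_left two_ne_zero)

end Cocycles

end LieBialg

end

open LieAlgebra LieAlgebra.IsKilling LieModule LieBialg in
theorem proposition5p4 {K g : Type*} [Field K] [CharZero K]
    [LieRing g] [LieAlgebra K g] [FiniteDimensional K g] [IsSimple K g]
    (H : LieSubalgebra K g) [H.IsCartanSubalgebra] [IsTriangularizable K H g]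
    (b : (rootSystem H).Base) (Q : AdmissibleQuadruple b) (E : Q.RootVectors)
    {Kb : Type*} [Field Kb] [Algebra K Kb] [IsAlgClosure K Kb]
    (α : Kb) (d : K) (hα : α ^ 2 = algebraMap K Kb d) (hd : ¬ IsSquare d) :
    Nonempty (TwistedH1 (Q.rBD E) α) ↔
      ∃ π : Equiv.Perm b.support, IsDiagramAut b π ∧
        Q.Γ₁.map π.toEmbedding = Q.Γ₂ ∧
        Q.Γ₂.map π.toEmbedding = Q.Γ₁ ∧
        (∀ i : Q.Γ₂, ∃ h : π.symm i ∈ Q.Γ₁, π (Q.τ ⟨π.symm i, h⟩) = Q.τ.symm i) ∧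
        TensorProduct.map (cartanAct b π).toLinearMap (cartanAct b π).toLinearMap Q.rh =
          LieBialg.flip Q.rh := by
  have : CharZero Kb := charZero_of_injective_algebraMap (FaithfulSMul.algebraMap_injective K Kb)
  have : Algebra.IsAlgebraic K Kb := IsAlgClosure.isAlgebraic
  have : IsGalois K Kb := inferInstance
  simp only [← isReversedBy_iff]
  constructor
  · rintro ⟨x⟩
    induction x using Quotient.ind with
    | _ v =>
      obtain ⟨γ, hγ⟩ := exists_gal_apply_eq_neg hα hd
      exact exists_isReversedBy (v.flipped γ hγ)
  · rintro ⟨π, hπ⟩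
    obtain ⟨u, hu, hr⟩ := exists_involution E Kb hπ
    have hα0 : α ≠ 0 := by
      rintro rfl
      rw [zero_pow two_ne_zero, eq_comm, map_eq_zero] at hα
      exact hd ⟨0, by rw [hα, mul_zero]⟩
    exact ⟨Quotient.mk _ (involutionCocycle hα hα0 u hu hr)⟩
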